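/- Let $M$ be a closed manifold, let $\xi$ be the Liouville 1-form of $T^*M$ and $\omega=d\xi$ the canonical symplectic form, and let $X_H$ denote the Hamiltonian vector field of $H:T^*M\to\mathbb R$, given by $i_{X_H}\omega=-dH$ (so $\dot x=\partial H/\partial p$, $\dot p=-\partial H/\partial x$). A Tonelli Hamiltonian is a smooth function $H:T^*M\to\mathbb R$ whose Hessian along each fibre is everywhere positive definite and which is superlinear on each fibre, i.e. $H(x,p)/|p|\to\infty$ as $|p|\to\infty$ in $T^*_xM$, for every $x\in M$. The characteristic foliation of a regular level $\Sigma$ of $H$ is the line field $\ker(\omega|_{T\Sigma})$, and two characteristic foliations are conjugate if some diffeomorphism between the hypersurfaces carries one to the other. A smooth 1-form $\lambda$ on $\Sigma$ is stabilizing if every nonzero vector $v$ tangent to the characteristic foliation satisfies $i_v d\lambda=0$ and $\lambda(v)\neq 0$; $\Sigma$ is stable if it has a stabilizing 1-form. **Lemma.** Let $H$ be a Tonelli Hamiltonian, let $k$ be a regular value of $H$, and suppose that $\Sigma_k=H^{-1}(k)$ is stable with stabilizing 1-form $\lambda$. Let $s:\Sigma_k\to\{1,-1\}$ be the sign of $\lambda(X_H)$;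 it is locally constant, so $s\lambda$ is again stabilizing (and $s\lambda=\lambda$ if $\lambda$ is positive on $X_H$). Then there exist $\epsilon>0$, a Tonelli Hamiltonian $\tilde H$ and constants $A,B>0$ such that: 1. $\tilde H^{-1}(r)=H^{-1}(r)$ for every $r\le k-\epsilon$, $\tilde H^{-1}(e^{Ar}+B)=H^{-1}(r)$ for every $r\ge k+\epsilon$, and $\tilde H^{-1}(e^{Ak}+B)=H^{-1}(k)=\Sigma_k$; 2. there exists $0<\delta<\epsilon$ such that $s\lambda$ extends to a smooth 1-form $\tilde\lambda$ on the open set $V=\tilde H^{-1}\big((e^{A(k-\delta)}+B,\;e^{A(k+\delta)}+B)\big)$ (that is, the restriction of $\tilde\lambda$ to $T\Sigma_k$ is $s\lambda$) with the property that $\tilde\lambda(X_{\tilde H})$ is positive and constant on $\tilde H^{-1}(e^{A(k+r)}+B)$ for each $r\in(-\delta,\delta)$; moreover, the characteristic foliations of the hypersurfaces $\tilde H^{-1}(e^{A(k+r)}+B)$, $r\in(-\delta,\delta)$, are all conjugate to each other; 3. $i_{X_{\tilde H}}d\tilde\lambda=0$ on $V$. -/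

import Mathlib

open Set Filter Bornology Bundle
open scoped Manifold ContDiff Topology

noncomputable section

section Forms

/-! One-forms on a boundaryless manifold `N` and their exterior derivative. -/

variable {F : Type*} [NormedAddCommGroup F] [NormedSpace ℝ F]
  {K : Type*} [TopologicalSpace K] (J : ModelWithCorners ℝ F K)
  (N : Type*) [TopologicalSpace N] [ChartedSpace K N] [IsManifold J 1 N]

/-- The total space `T*N` of the cotangent bundle of `N`: pairs `⟨x, p⟩` with `p : T_x N → ℝ`
continuous linear.  Its topology and smooth structure are those of Mathlib's bundle of continuous
linear maps from the tangent bundle to the trivial line bundle. -/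
abbrev CotangentBundle : Type _ :=
  TotalSpace (F →L[ℝ] ℝ) (fun x : N => TangentSpace J x →L[ℝ] Trivial N ℝ x)

/-- A (not necessarily smooth) differential one-form on `N`. -/
abbrev OneForm : Type _ := (z : N) → (TangentSpace J z →L[ℝ] ℝ)

variable {N}

/-- The one-form `lam` is smooth on `U`: it is a smooth section of the cotangent bundle there. -/
def OneForm.SmoothOn (lam : OneForm J N) (U : Set N) : Prop :=
  ContMDiffOn J (J.prod 𝓘(ℝ, F →L[ℝ] ℝ)) ∞
    (fun z => (⟨z, lam z⟩ : CotangentBundle J N)) U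

/-- The coordinate expression of `lam` in the preferred chart at `z`, that is, the pullback of
`lam` to the model vector space under the inverse of that chart. -/
def OneForm.inChart (lam : OneForm J N) (z : N) : F → (F →L[ℝ] ℝ) := fun y =>
  (lam ((extChartAt J z).symm y)).comp (mfderiv 𝓘(ℝ, F) J (extChartAt J z).symm y)

/-- The exterior derivative of a one-form, `dlam_z(v, w)`, computed in the preferred chart at `z`
by the formula `da(v, w) = (D_v a)(w) - (D_w a)(v)`. -/
def OneForm.d (lam : OneForm J N) (z : N) (v w : TangentSpace J z) : ℝ :=
  let Da : F →L[ℝ] F →L[ℝ] ℝ := fderiv ℝ (lam.inChart J z) (extChartAt J z z)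
  let v' : F := mfderiv J 𝓘(ℝ, F) (extChartAt J z) z v
  let w' : F := mfderiv J 𝓘(ℝ, F) (extChartAt J z) z w
  Da v' w' - Da w' v'

end Forms

/-! The cotangent bundle of an `n`-manifold `M`. -/

variable {n : ℕ} {M : Type*} [TopologicalSpace M] [ChartedSpace (EuclideanSpace ℝ (Fin n)) M]
  [IsManifold (𝓡 n) ∞ M]

/-- The model with corners of `T*M`; its model vector space is `ℝⁿ × (ℝⁿ)*`. -/
abbrev cotModel (n : ℕ) :=
  (𝓡 n).prod 𝓘(ℝ, EuclideanSpace ℝ (Fin n) →L[ℝ] ℝ)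

/-- The differential `dH_z` of a function on `T*M`. -/
def dH (H : CotangentBundle (𝓡 n) M → ℝ) : OneForm (cotModel n) (CotangentBundle (𝓡 n) M) :=
  fun z => mfderiv (cotModel n) 𝓘(ℝ, ℝ) H z

/-- The Liouville form `ξ` of `T*M`: `ξ_(x,p)(v) = p(dπ v)`, with `π : T*M → M` the projection. -/
def liouville : OneForm (cotModel n) (CotangentBundle (𝓡 n) M) := fun z =>
  ContinuousLinearMap.comp (M₂ := TangentSpace (𝓡 n) z.proj) z.2
    (mfderiv (cotModel n) (𝓡 n) (TotalSpace.proj : CotangentBundle (𝓡 n) M → M) z)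

/-- The canonical symplectic form `ω = dξ` of `T*M`. -/
def symp (z : CotangentBundle (𝓡 n) M) (v w : TangentSpace (cotModel n) z) : ℝ :=
  OneForm.d (cotModel n) liouville z v w

/-- The Hamiltonian vector field `X_H` of `H`, determined by `ω(X_H, ·) = -dH`
(so that `x' = ∂H/∂p`, `p' = -∂H/∂x` in canonical coordinates). -/
def hamVF (H : CotangentBundle (𝓡 n) M → ℝ) (z : CotangentBundle (𝓡 n) M) :
    TangentSpace (cotModel n) z :=
  Classical.epsilon fun v => ∀ w, symp z v w = - dH H z w

/-- In canonical coordinates, `ξ = p dx`. -/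
lemma liouville_inChart (z : CotangentBundle (𝓡 n) M)
    (y : EuclideanSpace ℝ (Fin n) × (EuclideanSpace ℝ (Fin n) →L[ℝ] ℝ))
    (hy : y ∈ (extChartAt (cotModel n) z).target)
    (u : EuclideanSpace ℝ (Fin n) × (EuclideanSpace ℝ (Fin n) →L[ℝ] ℝ)) :
    liouville.inChart (cotModel n) z y u = y.2 u.1 := by
  set m := (extChartAt (cotModel n) z).symm y with hm
  have hms : m ∈ (extChartAt (cotModel n) z).source := (extChartAt (cotModel n) z).map_target hy
  have hym : extChartAt (cotModel n) z m = y := (extChartAt (cotModel n) z).right_inv hy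
  have hyc : y = (extChartAt (𝓡 n) z.1 m.1, 
      ContinuousLinearMap.inCoordinates _ (TangentSpace (𝓡 n)) ℝ (Trivial M ℝ) z.1 m.1 z.1 m.1 m.2) := by
    rw [← hym, extChartAt_coe, Function.comp_apply, hom_chart]; rfl
  have hmb : m.1 ∈ (chartAt (EuclideanSpace ℝ (Fin n)) z.1).source := by
    rw [extChartAt_source, FiberBundle.chartedSpace_chartAt] at hms
    simp at hms
    exact hms.1
  have hmb' : m.1 ∈ (extChartAt (𝓡 n) z.1).source := by rwa [extChartAt_source]
  have h1 : mfderiv (cotModel n) (𝓡 n) (TotalSpace.proj : CotangentBundle (𝓡 n) M → M) m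
      (mfderiv 𝓘(ℝ, _) (cotModel n) (extChartAt (cotModel n) z).symm y u)
      = mfderiv 𝓘(ℝ, _) (𝓡 n) (extChartAt (𝓡 n) z.1).symm y.1 u.1 := by
    have hd1 : MDifferentiableAt 𝓘(ℝ, EuclideanSpace ℝ (Fin n) × (EuclideanSpace ℝ (Fin n) →L[ℝ] ℝ)) (cotModel n) (extChartAt (cotModel n) z).symm y := by
      have := mdifferentiableWithinAt_extChartAt_symm (I := cotModel n) hy
      rwa [ModelWithCorners.range_eq_univ, mdifferentiableWithinAt_univ] at this
    have hd2 : MDifferentiableAt 𝓘(ℝ, EuclideanSpace ℝ (Fin n)) (𝓡 n) (extChartAt (𝓡 n) z.1).symm y.1 := by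
      have := mdifferentiableWithinAt_extChartAt_symm (I := 𝓡 n) (x := z.1) (z := y.1) (by
        rw [hyc]; exact (extChartAt (𝓡 n) z.1).map_source hmb')
      rwa [ModelWithCorners.range_eq_univ, mdifferentiableWithinAt_univ] at this
    have hdp : MDifferentiableAt (cotModel n) (𝓡 n) (TotalSpace.proj : CotangentBundle (𝓡 n) M → M)
       ((extChartAt (cotModel n) z).symm y) := mdifferentiableAt_proj _
    have e1 := mfderiv_comp_apply y hdp hd1 u
    have hdf : MDifferentiableAt 𝓘(ℝ, EuclideanSpace ℝ (Fin n) × (EuclideanSpace ℝ (Fin n) →L[ℝ] ℝ)) 𝓘(ℝ, EuclideanSpace ℝ (Fin n)) Prod.fst y :=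
      (differentiableAt_fst).mdifferentiableAt
    have e2 := mfderiv_comp_apply y hd2 hdf u
    have e3 : (TotalSpace.proj : CotangentBundle (𝓡 n) M → M) ∘ (extChartAt (cotModel n) z).symm
       =ᶠ[𝓝 y] (extChartAt (𝓡 n) z.1).symm ∘ Prod.fst := by
      filter_upwards [(isOpen_extChartAt_target z).mem_nhds hy] with t ht
      have := FiberBundle.chartedSpace_chartAt_symm_fst (F := EuclideanSpace ℝ (Fin n) →L[ℝ] ℝ) z t (by
          rw [extChartAt_target] at ht; exact ht.1)
      exact this
    rw [e3.mfderiv_eq] at e1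
    refine e1.symm.trans (e2.trans ?_)
    rw [mfderiv_eq_fderiv, fderiv_fst]; rfl
  have h2 := TangentBundle.symmL_trivializationAt (I := 𝓡 n) hmb
  have h3 : y.2 u.1 = m.2 (mfderiv 𝓘(ℝ, _) (𝓡 n) (extChartAt (𝓡 n) z.1).symm y.1 u.1) := by
    have e1 : y.1 = extChartAt (𝓡 n) z.1 m.1 := congrArg Prod.fst hyc
    have e2 := congrArg Prod.snd hyc
    rw [e2, ContinuousLinearMap.inCoordinates, h2, e1, ModelWithCorners.range_eq_univ, mfderivWithin_univ]
    simp
    rfl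
  rw [h3, ← h1]
  rfl

/-- In the canonical coordinates given by the preferred chart at `z`, `ω = dp ∧ dx`. -/
lemma symp_eq (z : CotangentBundle (𝓡 n) M)
    (v w : EuclideanSpace ℝ (Fin n) × (EuclideanSpace ℝ (Fin n) →L[ℝ] ℝ)) :
    symp z v w = v.2 w.1 - w.2 v.1 := by
  have aux : ∀ (G E' : Type) [NormedAddCommGroup G] [NormedSpace ℝ G]
      [NormedAddCommGroup E'] [NormedSpace ℝ E']
      (P : G →L[ℝ] E') (Q : G →L[ℝ] (E' →L[ℝ] ℝ)) (a : G → (G →L[ℝ] ℝ)) (y v w : G),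
      (∀ᶠ t in 𝓝 y, ∀ u, a t u = Q t (P u)) → fderiv ℝ a y v w = Q v (P w) := by
    intro G E' _ _ _ _ P Q a y v w h
    let L : G →L[ℝ] (G →L[ℝ] ℝ) := ((ContinuousLinearMap.compL ℝ G E' ℝ).flip P).comp Q
    have hL : a =ᶠ[𝓝 y] L := h.mono fun t ht => ContinuousLinearMap.ext fun u => ht u
    rw [hL.fderiv_eq, L.fderiv]
    rfl
  have h := fun v w => aux _ _ (ContinuousLinearMap.fst ℝ (EuclideanSpace ℝ (Fin n))
    (EuclideanSpace ℝ (Fin n) →L[ℝ] ℝ)) (ContinuousLinearMap.snd ℝ _ _)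
    (liouville.inChart (cotModel n) z) (extChartAt (cotModel n) z z) v w
    (Filter.mem_of_superset ((isOpen_extChartAt_target z).mem_nhds (mem_extChartAt_target z))
      fun y hy u => liouville_inChart z y hy u)
  unfold symp OneForm.d
  rw [mfderiv_extChartAt_self]
  exact congrArg₂ (· - ·) (h v w) (h w v)

/-- `ω` is non-degenerate, so `hamVF` is well defined. -/
lemma hamVF_iff (H : CotangentBundle (𝓡 n) M → ℝ) (z : CotangentBundle (𝓡 n) M)
    (v : TangentSpace (cotModel n) z) :
    (∀ w, symp z v w = - dH H z w) ↔ v = hamVF H z := by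
  let E := EuclideanSpace ℝ (Fin n)
  have huniq : ∀ v v' : E × (E →L[ℝ] ℝ), (∀ w, symp z v w = symp z v' w) → v = v' := by
    intro v v' h
    replace h : ∀ w : E × (E →L[ℝ] ℝ), v.2 w.1 - w.2 v.1 = v'.2 w.1 - w.2 v'.1 := fun w =>
      (symp_eq z v w).symm.trans ((h w).trans (symp_eq z v' w))
    have h2 : v.2 = v'.2 := by
      ext1 u
      simpa using h (u, 0)
    have h1 : ∀ q : E →L[ℝ] ℝ, q (v.1 - v'.1) = 0 := by
      intro q
      have := h (0, q)
      simp at this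
      rw [map_sub, this, sub_self]
    refine Prod.ext (sub_eq_zero.1 ?_) h2
    exact (inner_self_eq_zero (𝕜 := ℝ)).1 (h1 (innerSL ℝ (v.1 - v'.1)))
  have hex : ∃ v : TangentSpace (cotModel n) z, ∀ w, symp z v w = - dH H z w := by
    let D : (E × (E →L[ℝ] ℝ)) →L[ℝ] ℝ := dH H z
    obtain ⟨x, hx⟩ : ∃ x : E, ∀ q : E →L[ℝ] ℝ, D (0, q) = q x := by
      let ev : (E →L[ℝ] ℝ) →ₗ[ℝ] ℝ :=
        D.toLinearMap ∘ₗ LinearMap.inr ℝ E (E →L[ℝ] ℝ)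
      let e : E →ₗ[ℝ] Module.Dual ℝ (E →L[ℝ] ℝ) :=
        LinearMap.flip (ContinuousLinearMap.coeLM ℝ)
      have hi : Function.Injective e := by
        intro a b hab
        have := LinearMap.congr_fun hab (innerSL ℝ (a - b))
        have h0 : inner ℝ (a - b) a = inner ℝ (a - b) b := this
        rw [← sub_eq_zero, ← inner_sub_right, inner_self_eq_zero, sub_eq_zero] at h0
        exact h0
      have hs : Function.Surjective e := by
        rw [← LinearMap.injective_iff_surjective_of_finrank_eq_finrank]
        · exact hi
        · rw [Subspace.dual_finrank_eq]
          rw [← (LinearMap.toContinuousLinearMap (𝕜 := ℝ) (E := E) (F' := ℝ)).finrank_eq]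
          exact (Subspace.dual_finrank_eq (K := ℝ) (V := E)).symm
      obtain ⟨x, hx⟩ := hs ev
      exact ⟨x, fun q => (LinearMap.congr_fun hx q).symm⟩
    refine ⟨(x, -(D.comp (ContinuousLinearMap.inl ℝ E (E →L[ℝ] ℝ)))), fun w => ?_⟩
    have h1 := symp_eq z (x, -(D.comp (ContinuousLinearMap.inl ℝ E (E →L[ℝ] ℝ)))) w
    refine h1.trans ?_
    change -(D (w.1, 0)) - w.2 x = - D w
    rw [← hx w.2, show D w = D (w.1, 0) + D (0, w.2) by
      rw [← map_add]; congr 1; ext1 <;> simp]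
    ring
  have hs : ∀ w, symp z (hamVF H z) w = - dH H z w := Classical.epsilon_spec hex
  constructor
  · intro h
    exact huniq _ _ fun w => (h w).trans (hs w).symm
  · rintro rfl
    exact hs

/-- `H` restricted to the fibre `T*_x M`.  As vector spaces `T_x M = ℝⁿ` in Mathlib. -/
def onFibre (H : CotangentBundle (𝓡 n) M → ℝ) (x : M) :
    (EuclideanSpace ℝ (Fin n) →L[ℝ] ℝ) → ℝ :=
  fun p => H ⟨x, p⟩

/-- Tonelli Hamiltonians: smooth, fibrewise strictly convex (positive definite fibre Hessian) and
superlinear in each fibre.  All norms on the finite-dimensional space `T*_x M` are equivalent, so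
superlinearity does not depend on the norm. -/
structure IsTonelli (H : CotangentBundle (𝓡 n) M → ℝ) : Prop where
  smooth : ContMDiff (cotModel n) 𝓘(ℝ, ℝ) ∞ H
  convex : ∀ x p q, q ≠ 0 → 0 < fderiv ℝ (fderiv ℝ (onFibre H x)) p q q
  superlinear : ∀ x, Tendsto (fun p => onFibre H x p / ‖p‖) (cobounded _) atTop

/-- `k` is a regular value of `H`: `dH` does not vanish on `H⁻¹(k)`. -/
def IsRegularLevel (H : CotangentBundle (𝓡 n) M → ℝ) (k : ℝ) : Prop :=
  ∀ z ∈ H ⁻¹' {k}, dH H z ≠ 0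

/-- The tangent space at `z` of the regular level of `H` through `z`. -/
def levelTangent (H : CotangentBundle (𝓡 n) M → ℝ) (z : CotangentBundle (𝓡 n) M) :
    Set (TangentSpace (cotModel n) z) :=
  {v | dH H z v = 0}

/-- The tangent line at `z` of the characteristic foliation of the regular level of `H` through
`z`: the kernel of the restriction of `ω` to the tangent space of the level. -/
def charLine (H : CotangentBundle (𝓡 n) M → ℝ) (z : CotangentBundle (𝓡 n) M) :
    Set (TangentSpace (cotModel n) z) :=
  {v | v ∈ levelTangent H z ∧ ∀ w ∈ levelTangent H z, symp z v w = 0}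

/-- `lam`, a one-form that is smooth on a neighbourhood of `H⁻¹(k)`, restricts to a stabilizing
one-form of the regular level `H⁻¹(k)`: non-zero vectors tangent to the characteristic foliation
annihilate `d(lam|_{H⁻¹(k)})` and are not annihilated by `lam`.  Only the restriction of `lam` to
tangent vectors of the level matters, and every smooth one-form on the (closed, embedded)
hypersurface `H⁻¹(k)` is such a restriction. -/
structure IsStabilizing (H : CotangentBundle (𝓡 n) M → ℝ) (k : ℝ)
    (lam : OneForm (cotModel n) (CotangentBundle (𝓡 n) M)) : Prop where
  smooth : ∃ U, IsOpen U ∧ H ⁻¹' {k} ⊆ U ∧ lam.SmoothOn (cotModel n) U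
  annihilates : ∀ z ∈ H ⁻¹' {k}, ∀ v ∈ charLine H z, v ≠ 0 →
    ∀ w ∈ levelTangent H z, lam.d (cotModel n) z v w = 0
  ne_zero : ∀ z ∈ H ⁻¹' {k}, ∀ v ∈ charLine H z, v ≠ 0 → lam z v ≠ 0

/-- The characteristic foliations of the regular levels `H⁻¹(a)` and `H⁻¹(b)` are conjugate: there
is a diffeomorphism `f : H⁻¹(a) → H⁻¹(b)` whose differential maps the tangent lines of the first
foliation onto those of the second.  Smooth maps between the hypersurfaces are given as
restrictions of smooth maps defined on open neighbourhoods. -/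
def ConjugateLevels (H : CotangentBundle (𝓡 n) M → ℝ) (a b : ℝ) : Prop :=
  ∃ (f g : CotangentBundle (𝓡 n) M → CotangentBundle (𝓡 n) M)
    (U W : Set (CotangentBundle (𝓡 n) M)),
    IsOpen U ∧ H ⁻¹' {a} ⊆ U ∧ ContMDiffOn (cotModel n) (cotModel n) ∞ f U ∧
    IsOpen W ∧ H ⁻¹' {b} ⊆ W ∧ ContMDiffOn (cotModel n) (cotModel n) ∞ g W ∧
    MapsTo f (H ⁻¹' {a}) (H ⁻¹' {b}) ∧ MapsTo g (H ⁻¹' {b}) (H ⁻¹' {a}) ∧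
    LeftInvOn g f (H ⁻¹' {a}) ∧ RightInvOn g f (H ⁻¹' {b}) ∧
    ∀ z ∈ H ⁻¹' {a},
      (mfderiv (cotModel n) (cotModel n) f z) '' charLine H z = charLine H (f z)

end

/-! Let S be the level H = k. After multiplication by the sign s, λ is positive on X_H along S
(`IsStabilizing.sign_smul`).

The first half of the proof is a normal form for ω near S. A function t vanishing on S and a vector
field Y with dt(Y) = 1 and ω(Y, ·) = λ along S give a retraction pr onto S and a model form d(pr*ξ +
t pr*λ) that agrees with ω at the points of S. Moser's argument (`exists_moser_diffeo`) removes the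
difference elsewhere: near S, ω = q*ω + d(G q*λ), where q is a retraction onto S and (q, G) are
coordinates (`exists_normal_form`). Let R be the Reeb field of S, tangent to the characteristic
foliation with λ(R) = 1, and lift it to X with dq(X) = R∘q and dG(X) = 0. Since R annihilates both ω
and dλ on TS, X is the Hamiltonian field of G, q*λ takes the value 1 on X, and i_X d(q*λ) = 0.
Shifting G with q fixed preserves X and identifies the levels of G (`exists_stable_coordinates`).
Hence any function of G with positive derivative has the dynamical properties required near S.

The second half restores convexity. G need not be fibrewise convex, but dG is a positive multiple of
dH along S, so the two fibre Hessians are positively proportional on directions tangent to S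
(`hess_proportional`). Passing to exp(AκG) with A large takes care of the transverse direction
(`exists_fibrePos`). The new Hamiltonian is a regularized maximum of exp(A(k + κG)) + 1 and
exp(Aψ(H)) + 1. The profile ψ is nearly flat to the left of k and becomes the identity to the right,
so the first function wins at S and the second at the edges of a tube around S
(`exists_tonelli_extension`). Since H has compact sublevels, ε can be taken so large that the levels
below k - ε are empty for both Hamiltonians, while those above k + ε lie where the new one is
exp(AH) + 1; thus B = 1.

The analytic tools are smooth dependence of flows on initial data, obtained from the implicit
function theorem in a space of curves (`exists_smooth_local_flow`, `exists_smooth_flow`), naturality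
of the exterior derivative (`extd_pullback`), and its invariance along homotopies whose velocity
lies in its kernel (`extd_pullback_invariant`). -/

noncomputable section

set_option linter.unusedSectionVars false

/-! ### Smoothness of composition operators on spaces of continuous functions. -/

section Nemytskii

universe u

/-- A continuous bilinear map applied pointwise to continuous functions, as a bounded operator. -/
def pointwiseBilin (K : Type*) [TopologicalSpace K] [CompactSpace K] {A E G : Type*}
    [NormedAddCommGroup A] [NormedSpace ℝ A]
    [NormedAddCommGroup E] [NormedSpace ℝ E] [NormedAddCommGroup G] [NormedSpace ℝ G]
    (b : A →L[ℝ] E →L[ℝ] G) :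
    C(K, A) →L[ℝ] C(K, E) →L[ℝ] C(K, G) :=
  LinearMap.mkContinuous₂
    (LinearMap.mk₂ ℝ (fun (a : C(K, A)) (h : C(K, E)) =>
        (⟨fun k => b (a k) (h k), by fun_prop⟩ : C(K, G)))
      (by intros; ext; simp) (by intros; ext; simp) (by intros; ext; simp) (by intros; ext; simp))
    ‖b‖
    (by
      intro a h
      refine (ContinuousMap.norm_le _ (by positivity)).2 fun k => ?_
      refine (b.le_opNorm₂ (a k) (h k)).trans ?_
      gcongr
      · exact a.norm_coe_le_norm k
      · exact h.norm_coe_le_norm k)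

/-- The mean value inequality bounds the error at each point of K by the oscillation of the
derivative along the segment from u(k) to v(k). Continuity of v ↦ f' ∘ v in the sup norm makes this
oscillation small uniformly in k. -/
lemma hasFDerivAt_postcomp {K : Type*} [TopologicalSpace K] [CompactSpace K] {A E G : Type*}
    [NormedAddCommGroup A] [NormedSpace ℝ A]
    [NormedAddCommGroup E] [NormedSpace ℝ E] [NormedAddCommGroup G] [NormedSpace ℝ G]
    (b : A →L[ℝ] E →L[ℝ] G)
    (f : C(E, G)) (f' : C(E, A)) (hf : ∀ x, HasFDerivAt f (b (f' x)) x) (u : C(K, E)) :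
    HasFDerivAt (fun v : C(K, E) => f.comp v) (pointwiseBilin K b (f'.comp u)) u := by
  rw [hasFDerivAt_iff_isLittleO, Asymptotics.isLittleO_iff]
  intro c hc
  have hcont : ContinuousAt (fun v : C(K, E) => f'.comp v) u :=
    (ContinuousMap.continuous_postcomp f').continuousAt
  obtain ⟨δ, hδ, hd⟩ := (Metric.continuousAt_iff (f := fun v : C(K, E) => f'.comp v)
    (a := u)).1 hcont (c / (‖b‖ + 1)) (by positivity)
  filter_upwards [Metric.ball_mem_nhds u hδ] with v hv
  refine (ContinuousMap.norm_le _ (by positivity)).2 fun k => ?_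
  have hseg : ∀ y ∈ segment ℝ (u k) (v k), ‖b (f' y) - b (f' (u k))‖ ≤ c := by
    rintro y ⟨a, d, ha, hd', had, rfl⟩
    -- A point of the segment is the value at k of the function a u + d v, which is again δ-close to
    -- u, so the continuity estimate for f' applies to it.
    have h1 : dist (a • u + d • v) u < δ := by
      have : a • u + d • v - u = d • (v - u) := by
        rw [show a = 1 - d by linarith]; module
      rw [dist_eq_norm, this, norm_smul, Real.norm_of_nonneg hd']
      have : dist v u < δ := hv
      rw [dist_eq_norm] at this
      nlinarith [norm_nonneg (v - u)]
    have h2 := (hd h1).le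
    rw [dist_eq_norm] at h2
    have h3 := ((f'.comp (a • u + d • v) - f'.comp u).norm_coe_le_norm k).trans h2
    rw [← map_sub]
    refine (b.le_opNorm _).trans ?_
    refine (mul_le_mul_of_nonneg_left h3 (norm_nonneg b)).trans ?_
    rw [mul_div_assoc', div_le_iff₀ (by positivity)]
    nlinarith [norm_nonneg b]
  have := (convex_segment (𝕜 := ℝ) (u k) (v k)).norm_image_sub_le_of_norm_hasFDerivWithin_le'
    (f := f) (f' := fun y => b (f' y)) (φ := b (f' (u k))) (fun y _ => (hf y).hasFDerivWithinAt)
    hseg (left_mem_segment ℝ _ _) (right_mem_segment ℝ _ _)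
  refine this.trans ?_
  gcongr
  exact (v - u).norm_coe_le_norm k

lemma contDiff_postcomp_succ {K : Type*} [TopologicalSpace K] [CompactSpace K] {A E G : Type*}
    [NormedAddCommGroup A] [NormedSpace ℝ A]
    [NormedAddCommGroup E] [NormedSpace ℝ E] [NormedAddCommGroup G] [NormedSpace ℝ G]
    (b : A →L[ℝ] E →L[ℝ] G)
    (f : C(E, G)) (f' : C(E, A)) (hf : ∀ x, HasFDerivAt f (b (f' x)) x) {n : ℕ}
    (hf' : ContDiff ℝ n (fun v : C(K, E) => f'.comp v)) :
    ContDiff ℝ (n + 1 : ℕ) (fun v : C(K, E) => f.comp v) := by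
  rw [Nat.cast_add, Nat.cast_one, contDiff_succ_iff_hasFDerivAt (n := n)]
  exact ⟨fun u => pointwiseBilin K b (f'.comp u), (pointwiseBilin K b).contDiff.comp hf',
    fun u => hasFDerivAt_postcomp b f f' hf u⟩

/-- The induction passes from f to its derivative, so the target G must vary. Taking E and G in one
universe keeps E →L[ℝ] G within reach of the induction hypothesis. -/
lemma contDiff_postcomp_nat {K : Type*} [TopologicalSpace K] [CompactSpace K] {E : Type u}
    [NormedAddCommGroup E] [NormedSpace ℝ E] (n : ℕ) :
    ∀ {G : Type u} [NormedAddCommGroup G] [NormedSpace ℝ G]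
    (f : C(E, G)), ContDiff ℝ ∞ f → ContDiff ℝ n (fun v : C(K, E) => f.comp v) := by
  induction n with
  | zero =>
    intro G _ _ f _
    exact contDiff_zero.2 (ContinuousMap.continuous_postcomp f)
  | succ n ih =>
    intro G _ _ f hf
    have hf' : ContDiff ℝ ∞ (fderiv ℝ f) := hf.fderiv_right (m := ∞) (by norm_num)
    exact contDiff_postcomp_succ (ContinuousLinearMap.id ℝ (E →L[ℝ] G)) f
      ⟨fderiv ℝ f, hf'.continuous⟩ (fun x => (hf.differentiable (by simp) x).hasFDerivAt)
      (ih _ hf')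

lemma contDiff_postcomp {K : Type*} [TopologicalSpace K] [CompactSpace K] {E : Type*}
    [NormedAddCommGroup E] [NormedSpace ℝ E] (f : C(E, E)) (hf : ContDiff ℝ ∞ f) :
    ContDiff ℝ ∞ (fun v : C(K, E) => f.comp v) :=
  contDiff_infty.2 fun n => contDiff_postcomp_nat n f hf

end Nemytskii

/-! ### Local flows in Banach spaces by the implicit function theorem. -/

section LocalFlow

variable {E : Type*} [NormedAddCommGroup E] [NormedSpace ℝ E] [CompleteSpace E]

/-- The interval `[-1, 1]`. -/
abbrev TimeInt := Icc (-1 : ℝ) 1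

/-- Extension of a continuous function on `[-1, 1]` to the line, constant outside. -/
def extendTime (u : C(TimeInt, E)) : ℝ → E := IccExtend (by norm_num : (-1 : ℝ) ≤ 1) u

lemma continuous_extendTime (u : C(TimeInt, E)) : Continuous (extendTime u) :=
  u.continuous.Icc_extend'

lemma extendTime_of_mem (u : C(TimeInt, E)) {s : ℝ} (hs : s ∈ Icc (-1 : ℝ) 1) :
    extendTime u s = u ⟨s, hs⟩ := IccExtend_of_mem _ _ hs

lemma norm_extendTime_le (u : C(TimeInt, E)) (s : ℝ) : ‖extendTime u s‖ ≤ ‖u‖ :=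
  u.norm_coe_le_norm _

/-- The operator `u ↦ ∫₀ˢ u` on continuous functions on `[-1, 1]`. -/
def primitiveOp : C(TimeInt, E) →L[ℝ] C(TimeInt, E) :=
  LinearMap.mkContinuous
    { toFun := fun u => ⟨fun s => ∫ r in (0 : ℝ)..s, extendTime u r,
        (intervalIntegral.continuous_primitive
          (fun a b => (continuous_extendTime u).intervalIntegrable a b) 0).comp
          continuous_subtype_val⟩
      map_add' := fun u v => by
        ext s
        simp only [ContinuousMap.coe_mk, ContinuousMap.add_apply]
        rw [← intervalIntegral.integral_add ((continuous_extendTime u).intervalIntegrable _ _)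
          ((continuous_extendTime v).intervalIntegrable _ _)]
        rfl
      map_smul' := fun c u => by
        ext s
        simp only [ContinuousMap.coe_mk, ContinuousMap.smul_apply, RingHom.id_apply]
        rw [← intervalIntegral.integral_smul]
        rfl } 1 (by
      intro u
      refine (ContinuousMap.norm_le _ (by positivity)).2 fun s => ?_
      refine (intervalIntegral.norm_integral_le_of_norm_le_const
        (fun r _ => norm_extendTime_le u r)).trans ?_
      rw [mul_comm]
      gcongr
      have := s.2
      rw [sub_zero, abs_le]
      exact this)

/-- A smooth vector field on a Banach space has a smooth local flow. -/
theorem exists_smooth_local_flow (f : E → E) (hf : ContDiff ℝ ∞ f) (x₀ : E) :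
    ∃ φ : ℝ × E → E, ContDiffAt ℝ ∞ φ (0, x₀) ∧ ∃ ε > 0, ∀ x ∈ Metric.ball x₀ ε, φ (0, x) = x ∧
      ∀ t ∈ Ioo (-ε) ε, HasDerivAt (fun s => φ (s, x)) (f (φ (t, x))) t := by
  let fc : C(E, E) := ⟨f, hf.continuous⟩
  let X := C(TimeInt, E)
  let cst : E →L[ℝ] X := ContinuousLinearMap.const ℝ TimeInt
  -- A zero u of Φ((t, x), ·) satisfies u(s) = x + t ∫₀ˢ f(u): it is the solution through x with
  -- time rescaled by t, and u(1) is the flow at time t.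
  let Φ : (ℝ × E) × X → X := fun v => v.2 - cst v.1.2 - v.1.1 • primitiveOp (fc.comp v.2)
  have hΦ : ContDiff ℝ ∞ Φ := by
    have h1 : ContDiff ℝ ∞ (fun v : (ℝ × E) × X => fc.comp v.2) :=
      (contDiff_postcomp fc hf).comp contDiff_snd
    have h2 : ContDiff ℝ ∞ (fun v : (ℝ × E) × X => primitiveOp (fc.comp v.2)) :=
      (primitiveOp (E := E)).contDiff.comp h1
    have h3 : ContDiff ℝ ∞ (fun v : (ℝ × E) × X => cst v.1.2) :=
      cst.contDiff.comp (contDiff_snd.comp contDiff_fst)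
    exact (contDiff_snd.sub h3).sub ((contDiff_fst.comp contDiff_fst).smul h2)
  let u₀ : (ℝ × E) × X := ((0, x₀), cst x₀)
  have hu₀ : Φ u₀ = 0 := by simp [Φ, u₀]
  -- At t = 0 the integral term disappears, so the partial derivative in the curve variable is the
  -- identity.
  have hinv : (fderiv ℝ Φ u₀ ∘L .inr ℝ (ℝ × E) X) = ContinuousLinearMap.id ℝ X := by
    have h1 : HasFDerivAt (fun w : X => Φ (u₀.1, w))
        (fderiv ℝ Φ u₀ ∘L .inr ℝ (ℝ × E) X) (cst x₀) :=
      ((hΦ.differentiable (by simp) u₀).hasFDerivAt).comp (cst x₀)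
        (hasFDerivAt_prodMk_right u₀.1 (cst x₀))
    have h2 : HasFDerivAt (fun w : X => Φ (u₀.1, w)) (ContinuousLinearMap.id ℝ X) (cst x₀) := by
      have : (fun w : X => Φ (u₀.1, w)) = fun w => w - cst x₀ := by
        funext w; simp [Φ, u₀]
      rw [this]
      exact (hasFDerivAt_id _).sub_const _
    exact h1.unique h2
  have hcd : ContDiffAt ℝ ∞ Φ u₀ := hΦ.contDiffAt
  have hinv' : (fderiv ℝ Φ u₀ ∘L .inr ℝ (ℝ × E) X).IsInvertible := by
    rw [hinv]; exact ContinuousLinearMap.isInvertible_equiv (f := ContinuousLinearEquiv.refl ℝ X)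
  let ψ : ℝ × E → X := hcd.implicitFunction (by simp) hinv'
  have hψ : ContDiffAt ℝ ∞ ψ (0, x₀) := hcd.contDiffAt_implicitFunction (by simp) hinv'
  have hψ0 : ψ (0, x₀) = cst x₀ := hcd.implicitFunction_apply_self (by simp) hinv'
  have hev1 : ∀ᶠ p in 𝓝 ((0 : ℝ), x₀), Φ (p, ψ p) = 0 := by
    have := hcd.eventually_apply_implicitFunction (by simp) hinv'
    rw [hu₀] at this
    exact this
  have hev2 : ∀ᶠ v in 𝓝 u₀, Φ v = 0 ↔ ψ v.1 = v.2 := by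
    have := hcd.eventually_apply_eq_iff_implicitFunction (by simp) hinv'
    rw [hu₀] at this
    exact this
  -- a uniform neighbourhood
  obtain ⟨r, hr, hr2⟩ := Metric.eventually_nhds_iff.1 hev2
  have hev3 : ∀ᶠ p in 𝓝 ((0 : ℝ), x₀), dist (ψ p) (cst x₀) < r := by
    have := hψ.continuousAt (Metric.ball_mem_nhds _ hr)
    rw [hψ0] at this
    exact this
  obtain ⟨ε, hε, hε2⟩ := Metric.eventually_nhds_iff.1 (hev1.and hev3)
  set ε' := min (ε / 2) (r / 2) with hε'
  have hε'0 : 0 < ε' := lt_min (by linarith) (by linarith)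
  have hε'1 : ε' < ε := (min_le_left _ _).trans_lt (by linarith)
  have hε'2 : ε' < r := (min_le_right _ _).trans_lt (by linarith)
  let ev : X →L[ℝ] E := ContinuousMap.evalCLM ℝ (⟨1, by norm_num⟩ : TimeInt)
  refine ⟨fun p => ev (ψ p), ev.contDiff.contDiffAt.comp _ hψ, ε', hε'0, fun x hx => ?_⟩
  have hx' : dist x x₀ < ε' := hx
  -- the solution with time scale `ε'`
  have hmem : ∀ t : ℝ, |t| ≤ ε' → dist ((t, x) : ℝ × E) (0, x₀) < ε := fun t ht => by
    rw [Prod.dist_eq]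
    exact max_lt (by rw [Real.dist_eq, sub_zero]; linarith) (hx'.trans hε'1)
  set w : X := ψ (ε', x) with hw
  have hweq := (hε2 (hmem ε' (abs_of_pos hε'0).le)).1
  have hwd := (hε2 (hmem ε' (abs_of_pos hε'0).le)).2
  have hwint : ∀ s : TimeInt, w s = x + ε' • ∫ r in (0 : ℝ)..s, f (extendTime w r) := by
    intro s
    have := congrArg (fun g : X => g s) hweq
    change w s - x - ε' • ∫ r in (0 : ℝ)..s, extendTime (fc.comp w) r = 0 at this
    rw [sub_sub, sub_eq_zero] at this
    exact this
  have hfw : Continuous fun r => f (extendTime w r) :=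
    hf.continuous.comp (continuous_extendTime w)
  -- One curve w, the solution for time scale ε', determines all shorter ones: r ↦ w(s r) solves the
  -- equation with scale s ε' and stays in the uniqueness ball, hence equals ψ(s ε', x). Evaluating
  -- at r = 1 shows that the flow line is w itself, reparametrized.
  have key : ∀ s : TimeInt, ψ (s * ε', x) ⟨1, by norm_num⟩ = w s := by
    intro s
    have hs1 : |(s : ℝ)| ≤ 1 := abs_le.2 s.2
    have hmul : ∀ r ∈ Icc (-1 : ℝ) 1, (s : ℝ) * r ∈ Icc (-1 : ℝ) 1 := by
      intro r hr
      rw [mem_Icc, ← abs_le] at hr ⊢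
      rw [abs_mul]
      nlinarith [abs_nonneg (s : ℝ), abs_nonneg r]
    let ws : X := ⟨fun r => w ⟨s * r, hmul r r.2⟩, by fun_prop⟩
    have hd : dist (((s * ε', x), ws) : (ℝ × E) × X) u₀ < r := by
      rw [Prod.dist_eq, Prod.dist_eq]
      refine max_lt (max_lt ?_ (hx'.trans hε'2)) ?_
      · rw [Real.dist_eq, sub_zero, abs_mul, abs_of_pos hε'0]
        nlinarith
      · refine lt_of_le_of_lt ((ContinuousMap.dist_le dist_nonneg).2 fun q => ?_) hwd
        exact (ContinuousMap.dist_apply_le_dist (f := w) (g := cst x₀) ⟨s * q, hmul q q.2⟩)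
    have hsol : Φ ((s * ε', x), ws) = 0 := by
      ext q
      change w ⟨s * q, hmul q q.2⟩ - x -
        ((s : ℝ) * ε') • ∫ r in (0 : ℝ)..q, extendTime (fc.comp ws) r = 0
      rw [sub_sub, sub_eq_zero, hwint]
      congr 1
      rw [mul_comm (s : ℝ) ε', mul_smul]
      congr 1
      have : ∫ r in (0 : ℝ)..q, extendTime (fc.comp ws) r
          = ∫ r in (0 : ℝ)..q, f (extendTime w (s * r)) := by
        refine intervalIntegral.integral_congr fun r hr => ?_
        have hr' : r ∈ Icc (-1 : ℝ) 1 := by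
          have h0 : (0 : ℝ) ∈ Icc (-1 : ℝ) 1 := by norm_num
          exact (uIcc_subset_Icc h0 q.2) hr
        change extendTime (fc.comp ws) r = f (extendTime w (s * r))
        rw [extendTime_of_mem _ hr', extendTime_of_mem _ (hmul r hr')]
        rfl
      rw [this]
      have h := intervalIntegral.smul_integral_comp_mul_left (a := 0) (b := (q : ℝ))
        (fun r => f (extendTime w r)) (s : ℝ)
      rw [mul_zero] at h
      exact h.symm
    have := (hr2 hd).1 hsol
    change ψ (s * ε', x) = ws at this
    rw [this]
    change w ⟨s * 1, _⟩ = w s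
    congr 1
    ext; simp
  refine ⟨?_, fun t ht => ?_⟩
  · have h0 := key ⟨0, by norm_num⟩
    rw [hwint] at h0
    change ev (ψ (0, x)) = x
    have h1 : ψ (0 * ε', x) ⟨1, by norm_num⟩ = x := by
      refine h0.trans ?_
      simp
    rw [zero_mul] at h1
    exact h1
  · -- differentiate the integral equation
    have h1 : HasDerivAt (fun s : ℝ => x + ε' • ∫ r in (0 : ℝ)..s, f (extendTime w r))
        (ε' • f (extendTime w (t / ε'))) (t / ε') :=
      ((intervalIntegral.integral_hasDerivAt_right (hfw.intervalIntegrable _ _)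
        (hfw.stronglyMeasurableAtFilter _ _) hfw.continuousAt).const_smul ε').const_add x
    have h2 : HasDerivAt (fun t : ℝ => t / ε') (1 / ε') t := by
      simpa using (hasDerivAt_id t).div_const ε'
    have h3 := h1.scomp t h2
    have hti : ∀ t ∈ Ioo (-ε') ε', t / ε' ∈ Icc (-1 : ℝ) 1 := by
      intro t ht
      rw [mem_Icc, le_div_iff₀ hε'0, div_le_iff₀ hε'0]
      constructor <;> linarith [ht.1, ht.2]
    have heq : ∀ t ∈ Ioo (-ε') ε', ev (ψ (t, x)) =
        x + ε' • ∫ r in (0 : ℝ)..(t / ε'), f (extendTime w r) := by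
      intro t ht
      have := key ⟨t / ε', hti t ht⟩
      rw [hwint] at this
      have e : t / ε' * ε' = t := by field_simp
      simp only [e] at this
      exact this
    have h4 : extendTime w (t / ε') = ev (ψ (t, x)) := by
      rw [extendTime_of_mem _ (hti t ht), ← key ⟨t / ε', hti t ht⟩]
      have e : t / ε' * ε' = t := by field_simp
      simp only [e]
      rfl
    have h5 : HasDerivAt (fun s => ev (ψ (s, x))) ((1 / ε') • ε' • f (extendTime w (t / ε'))) t :=
      h3.congr_of_eventuallyEq
        (Filter.mem_of_superset (Ioo_mem_nhds ht.1 ht.2) fun s hs => heq s hs)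
    rw [smul_smul, one_div_mul_cancel hε'0.ne', one_smul, h4] at h5
    exact h5

end LocalFlow

/-! ### Local and compactly supported global flows on manifolds. -/

section ManifoldFlow

lemma exists_pos_le_of_finset {ι : Type*} (T : Finset ι) (e : ι → ℝ) (he : ∀ i, 0 < e i) :
    ∃ d > 0, ∀ i ∈ T, d ≤ e i := by
  classical
  induction T using Finset.induction_on with
  | empty => exact ⟨1, one_pos, by simp⟩
  | insert a T _ ih =>
    obtain ⟨d, hd, h⟩ := ih
    refine ⟨min d (e a), lt_min hd (he a), fun x hx => ?_⟩
    rcases Finset.mem_insert.1 hx with rfl | hx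
    · exact min_le_right _ _
    · exact (min_le_left _ _).trans (h x hx)

variable {F : Type*} [NormedAddCommGroup F] [NormedSpace ℝ F] [FiniteDimensional ℝ F]
  {K : Type*} [TopologicalSpace K] {J : ModelWithCorners ℝ F K}
  {P : Type*} [TopologicalSpace P] [ChartedSpace K P] [IsManifold J ∞ P]
  [J.Boundaryless]

/-- A curve in the domain of a chart which solves the equation in coordinates is an integral
curve. -/
lemma isMIntegralCurveOn_symm_of_hasDerivAt [IsManifold J 1 P] {V : (x : P) → TangentSpace J x} (x₀ : P)
    {g : ℝ → F} {s : Set ℝ}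
    (hg : ∀ t ∈ s, g t ∈ (extChartAt J x₀).target ∧ HasDerivAt g
      (tangentCoordChange J ((extChartAt J x₀).symm (g t)) x₀ ((extChartAt J x₀).symm (g t))
        (V ((extChartAt J x₀).symm (g t)))) t) :
    IsMIntegralCurveOn (fun t => (extChartAt J x₀).symm (g t)) V s := by
  intro t ht
  obtain ⟨hf3', h⟩ := hg t ht
  let xₜ : P := (extChartAt J x₀).symm (g t)
  have hft1 := mem_preimage.mp <|
    mem_of_mem_of_subset hf3' (extChartAt J x₀).target_subset_preimage_source
  have hft2 := mem_extChartAt_source (I := J) xₜ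
  have h1 : tangentCoordChange J x₀ xₜ xₜ (tangentCoordChange J xₜ x₀ xₜ (V xₜ)) = V xₜ :=
    (tangentCoordChange_comp (x := x₀) ⟨⟨hft2, hft1⟩, hft2⟩).trans
      (tangentCoordChange_self (I := J) (x := xₜ) (z := xₜ) (v := V xₜ) hft2)
  have h2 : HasFDerivWithinAt (extChartAt J xₜ ∘ (extChartAt J x₀).symm)
      (tangentCoordChange J x₀ xₜ xₜ) (range J) (extChartAt J x₀ xₜ) :=
    hasFDerivWithinAt_tangentCoordChange ⟨hft1, hft2⟩
  rw [(extChartAt J x₀).right_inv hf3', J.range_eq_univ, hasFDerivWithinAt_univ] at h2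
  have h3 := h2.comp_hasDerivAt t h
  have h4 : HasFDerivAt ((extChartAt J xₜ ∘ (extChartAt J x₀).symm) ∘ g)
      (ContinuousLinearMap.toSpanSingleton ℝ (V xₜ : F)) t :=
    (HasDerivAt.congr_deriv h3 h1).hasFDerivAt
  apply HasMFDerivAt.hasMFDerivWithinAt
  refine ⟨(continuousAt_extChartAt_symm'' hf3').comp h.continuousAt, ?_⟩
  exact h4.hasFDerivWithinAt

/-- A smooth vector field on a manifold has smooth local flows. -/
theorem exists_smooth_local_mflow [IsManifold J 1 P] (V : (x : P) → TangentSpace J x)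
    (hV : ContMDiff J J.tangent ∞ (fun x => (⟨x, V x⟩ : TangentBundle J P))) (x₀ : P) :
    ∃ ψ : ℝ × P → P, ContMDiffAt (𝓘(ℝ, ℝ).prod J) J ∞ ψ (0, x₀) ∧
      ∃ ε > 0, ∀ᶠ x in 𝓝 x₀, ψ (0, x) = x ∧
        IsMIntegralCurveOn (fun t => ψ (t, x)) V (Ioo (-ε) ε) := by
  set c := extChartAt J x₀ with hc
  let f₀ : F → F := fun y => tangentCoordChange J (c.symm y) x₀ (c.symm y) (V (c.symm y))
  have hf₀ : ContDiffOn ℝ ∞ f₀ c.target := by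
    intro y hy
    have hx : c.symm y ∈ c.source := c.map_target hy
    have h1 := (contMDiffAt_iff_of_mem_source (x := x₀) (y := (⟨x₀, V x₀⟩ : TangentBundle J P))
      (x' := c.symm y) (f := fun x => (⟨x, V x⟩ : TangentBundle J P)) (n := ∞) (I := J)
      (I' := J.tangent) (by simpa [hc] using hx) (by
        rw [FiberBundle.chartedSpace_chartAt]
        simpa [hc] using hx)).1 (hV _)
    have h2 := h1.2
    rw [c.right_inv hy, J.range_eq_univ] at h2
    have h3 := (contDiffWithinAt_univ.1 h2).snd
    exact h3.contDiffWithinAt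
  have htgt : c.target ∈ 𝓝 (c x₀) := extChartAt_target_mem_nhds x₀
  obtain ⟨R, hR, hRt⟩ := Metric.nhds_basis_closedBall.mem_iff.1 htgt
  -- The cutoff turns the coordinate expression of V into a smooth field on all of F. It equals 1 on
  -- the ball of radius R / 2, and the flow is used only while it stays there.
  let b : ContDiffBump (c x₀) := ⟨R / 2, R, by linarith, by linarith⟩
  let f : F → F := fun y => b y • f₀ y
  have hf : ContDiff ℝ ∞ f := by
    rw [contDiff_iff_contDiffAt]
    intro y
    by_cases hy : y ∈ c.target
    · exact b.contDiff.contDiffAt.smul (hf₀.contDiffAt ((isOpen_extChartAt_target x₀).mem_nhds hy))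
    · have hyc : y ∉ tsupport b := by
        rw [b.tsupport_eq]
        exact fun h => hy (hRt h)
      have : f =ᶠ[𝓝 y] fun _ => 0 := by
        filter_upwards [(isClosed_tsupport b).isOpen_compl.mem_nhds hyc] with z hz
        simp only [f, image_eq_zero_of_notMem_tsupport hz, zero_smul]
      exact contDiffAt_const.congr_of_eventuallyEq this
  obtain ⟨φ, hφ, ε, hε, hflow⟩ := exists_smooth_local_flow f hf (c x₀)
  have hφ0 : φ (0, c x₀) = c x₀ := (hflow _ (Metric.mem_ball_self hε)).1
  have hev : ∀ᶠ p in 𝓝 ((0 : ℝ), c x₀), φ p ∈ Metric.ball (c x₀) (R / 2) := by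
    have := hφ.continuousAt (Metric.ball_mem_nhds (φ (0, c x₀)) (half_pos hR))
    rw [hφ0] at this
    exact this
  obtain ⟨ε₁, hε₁, hball⟩ := Metric.eventually_nhds_iff.1 hev
  have hcx : ContMDiffAt (𝓘(ℝ, ℝ).prod J) 𝓘(ℝ, ℝ × F) ∞ (fun p : ℝ × P => (p.1, c p.2)) (0, x₀) :=
    contMDiffAt_fst.prodMk_space
      ((contMDiffAt_extChartAt (x := x₀)).comp ((0 : ℝ), x₀) contMDiffAt_snd)
  refine ⟨fun p => c.symm (φ (p.1, c p.2)), ?_, min ε ε₁, lt_min hε hε₁, ?_⟩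
  · have h1 : ContMDiffAt (𝓘(ℝ, ℝ).prod J) 𝓘(ℝ, F) ∞ (fun p : ℝ × P => φ (p.1, c p.2)) (0, x₀) :=
      (hφ.contMDiffAt (n := ∞)).comp ((0 : ℝ), x₀) hcx
    have h2 : ContMDiffAt 𝓘(ℝ, F) J ∞ c.symm (φ (0, c x₀)) := by
      rw [hφ0]
      exact (contMDiffOn_extChartAt_symm x₀).contMDiffAt htgt
    exact h2.comp ((0 : ℝ), x₀) h1
  · have hx1 : ∀ᶠ x in 𝓝 x₀, c x ∈ Metric.ball (c x₀) (min ε ε₁) :=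
      (continuousAt_extChartAt x₀) (Metric.ball_mem_nhds _ (lt_min hε hε₁))
    filter_upwards [hx1, extChartAt_source_mem_nhds (I := J) x₀] with x hx hxs
    have hxε : c x ∈ Metric.ball (c x₀) ε := Metric.ball_subset_ball (min_le_left _ _) hx
    refine ⟨by simp only [(hflow _ hxε).1]; exact c.left_inv hxs, ?_⟩
    refine isMIntegralCurveOn_symm_of_hasDerivAt x₀ (g := fun t => φ (t, c x)) fun t ht => ?_
    have hin : φ (t, c x) ∈ Metric.ball (c x₀) (R / 2) := by
      refine hball ?_
      rw [Prod.dist_eq]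
      refine max_lt ?_ ?_
      · rw [Real.dist_eq, sub_zero]
        exact (abs_lt.2 ht).trans_le (min_le_right _ _)
      · exact lt_of_lt_of_le hx (min_le_right _ _)
    refine ⟨hRt (Metric.ball_subset_closedBall (Metric.ball_subset_ball (by linarith) hin)), ?_⟩
    have := (hflow _ hxε).2 t ⟨(neg_le_neg (min_le_left _ _)).trans_lt ht.1,
      ht.2.trans_le (min_le_left _ _)⟩
    have hb : b (φ (t, c x)) = 1 := b.one_of_mem_closedBall (Metric.ball_subset_closedBall hin)
    simp only [f, hb, one_smul] at this
    exact this

/-- A smooth vector field with compact support has a smooth global flow. -/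
theorem exists_smooth_flow [T2Space P] (V : (x : P) → TangentSpace J x)
    (hV : ContMDiff J J.tangent ∞ (fun x => (⟨x, V x⟩ : TangentBundle J P)))
    (C : Set P) (hC : IsCompact C) (hVC : ∀ x ∉ C, V x = 0) :
    ∃ φ : ℝ × P → P, ContMDiff (𝓘(ℝ, ℝ).prod J) J ∞ φ ∧ (∀ x, φ (0, x) = x) ∧
      (∀ s t x, φ (s + t, x) = φ (s, φ (t, x))) ∧
      ∀ x, IsMIntegralCurve (fun t => φ (t, x)) V := by
  have : IsManifold J 1 P := IsManifold.of_le (n := ∞) (by simp)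
  have hV1 : ContMDiff J J.tangent 1 (fun x => (⟨x, V x⟩ : TangentBundle J P)) :=
    hV.of_le (by simp)
  choose ψ hψ ε hε hψε using exists_smooth_local_mflow V hV
  -- uniform time of existence
  obtain ⟨ε₀, hε₀, hloc⟩ : ∃ ε₀ > 0, ∀ x, ∃ γ : ℝ → P, γ 0 = x ∧
      IsMIntegralCurveOn γ V (Ioo (-ε₀) ε₀) := by
    obtain ⟨T, hT, hTC⟩ := hC.elim_nhds_subcover (fun x => {y | ψ x (0, y) = y ∧
        IsMIntegralCurveOn (fun t => ψ x (t, y)) V (Ioo (-(ε x)) (ε x))}) fun x _ => hψε x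
    obtain ⟨ε₀, hε₀, hle⟩ := exists_pos_le_of_finset T ε hε
    refine ⟨ε₀, hε₀, fun x => ?_⟩
    by_cases hx : x ∈ C
    · obtain ⟨a, ha, h1, h2⟩ := mem_iUnion₂.1 (hTC hx)
      exact ⟨_, h1, h2.mono (Ioo_subset_Ioo (neg_le_neg (hle a ha)) (hle a ha))⟩
    · exact ⟨fun _ => x, rfl, (isMIntegralCurve_const (hVC x hx)).isMIntegralCurveOn _⟩
  -- A time of existence independent of the starting point allows every integral curve to be
  -- continued to the whole line.
  choose γ hγ0 hγ using fun x => exists_isMIntegralCurve_of_isMIntegralCurveOn hV1 hε₀ hloc x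
  have huniq : ∀ {γ₁ γ₂ : ℝ → P}, IsMIntegralCurve γ₁ V → IsMIntegralCurve γ₂ V → γ₁ 0 = γ₂ 0 →
      γ₁ = γ₂ := fun h1 h2 h => isMIntegralCurve_Ioo_eq_of_contMDiff_boundaryless hV1 h1 h2 h
  have hadd : ∀ s t x, γ x (s + t) = γ (γ x t) s := fun s t x =>
    congrFun (huniq (γ₁ := fun s => γ x (s + t)) ((hγ x).comp_add t) (hγ (γ x t))
      (by simp [hγ0])) s
  have hconst : ∀ x ∉ C, ∀ t, γ x t = x := fun x hx t =>
    congrFun (huniq (hγ x) (isMIntegralCurve_const (hVC x hx)) (hγ0 x)) t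
  have hzero : ∀ x₀, ContMDiffAt (𝓘(ℝ, ℝ).prod J) J ∞ (fun p : ℝ × P => γ p.2 p.1) (0, x₀) := by
    intro x₀
    refine (hψ x₀).congr_of_eventuallyEq ?_
    have h1 : ∀ᶠ p in 𝓝 ((0 : ℝ), x₀), p.1 ∈ Ioo (-(ε x₀)) (ε x₀) :=
      continuousAt_fst (Ioo_mem_nhds (by simpa using hε x₀) (hε x₀))
    have h2 := (continuousAt_snd (p := ((0 : ℝ), x₀))).eventually (hψε x₀)
    filter_upwards [h1, h2] with p hp1 hp2
    exact isMIntegralCurveOn_Ioo_eqOn_of_contMDiff_boundaryless (t₀ := 0)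
      ⟨by simpa using hε x₀, hε x₀⟩ hV1 ((hγ p.2).isMIntegralCurveOn _) hp2.2
      ((hγ0 _).trans hp2.1.symm) hp1
  have hsmooth : ContMDiff (𝓘(ℝ, ℝ).prod J) J ∞ (fun p : ℝ × P => γ p.2 p.1) := by
    -- Each finite order is treated separately: C^n regularity at a point spreads to a neighbourhood
    -- for finite n only, and the uniform time found below depends on n.
    rw [contMDiff_infty]
    intro n
    have : IsManifold J n P := IsManifold.of_le (n := ∞) (by exact_mod_cast le_top)
    -- uniform smoothness for small times
    have hev : ∀ x₀, ∃ e > 0, ∃ U ∈ 𝓝 x₀, ∀ x ∈ U, ∀ t ∈ Ioo (-e) e,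
        ContMDiffAt (𝓘(ℝ, ℝ).prod J) J n (fun p : ℝ × P => γ p.2 p.1) (t, x) := by
      intro x₀
      have h1 := (contMDiffAt_iff_contMDiffAt_nhds (by simp)).1
        ((hzero x₀).of_le (m := n) (by exact_mod_cast le_top))
      rw [nhds_prod_eq, eventually_prod_iff] at h1
      obtain ⟨p, hp, q, hq, h⟩ := h1
      obtain ⟨e, he, hep⟩ := Metric.eventually_nhds_iff.1 hp
      refine ⟨e, he, {x | q x}, hq, fun x hx t ht => h (hep ?_) hx⟩
      rw [Real.dist_eq, sub_zero]
      exact abs_lt.2 ht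
    choose e he U hU hUe using hev
    obtain ⟨T, hT, hTC⟩ := hC.elim_nhds_subcover U fun x _ => hU x
    obtain ⟨e₀, he₀, hle⟩ := exists_pos_le_of_finset T e he
    have hsmall : ∀ t ∈ Ioo (-e₀) e₀, ∀ x,
        ContMDiffAt (𝓘(ℝ, ℝ).prod J) J n (fun p : ℝ × P => γ p.2 p.1) (t, x) := by
      intro t ht x
      by_cases hx : x ∈ C
      · obtain ⟨a, ha, h1⟩ := mem_iUnion₂.1 (hTC hx)
        exact hUe a x h1 t ⟨(neg_le_neg (hle a ha)).trans_lt ht.1, ht.2.trans_le (hle a ha)⟩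
      · refine (contMDiffAt_snd (n := n)).congr_of_eventuallyEq ?_
        filter_upwards [continuousAt_snd (hC.isClosed.isOpen_compl.mem_nhds hx)] with p hp
        exact hconst p.2 hp p.1
    have hmap : ∀ m : ℕ, ∀ t ∈ Ioo (-e₀) e₀, ContMDiff J J n (fun x => γ x (m * t)) := by
      intro m t ht
      induction m with
      | zero =>
        simp only [Nat.cast_zero, zero_mul, hγ0]
        exact contMDiff_id
      | succ m ih =>
        have h1 : ContMDiff J J n (fun x => γ x t) := fun x =>
          (hsmall t ht x).comp x (contMDiffAt_const.prodMk contMDiffAt_id)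
        have h2 : (fun x => γ x ((m + 1 : ℕ) * t)) = (fun x => γ x t) ∘ fun x => γ x (m * t) := by
          funext x
          rw [Function.comp_apply, ← hadd]
          congr 1
          push_cast; ring
        rw [h2]
        exact h1.comp ih
    rintro ⟨t, x⟩
    obtain ⟨m, hm⟩ := exists_nat_gt (|t| / e₀)
    have hm0 : 0 < (m : ℝ) := lt_of_le_of_lt (by positivity) hm
    have htm : t / m ∈ Ioo (-e₀) e₀ := by
      rw [mem_Ioo, ← abs_lt, abs_div, abs_of_pos hm0, div_lt_iff₀ hm0]
      rw [div_lt_iff₀ he₀] at hm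
      linarith
    have h1 : ContMDiff J J n (fun x => γ x t) := by
      have := hmap m _ htm
      have e : (m : ℝ) * (t / m) = t := by field_simp
      rwa [e] at this
    -- Near (t, x) the flow is a small-time flow composed with the time-t map, which is smooth as an
    -- iterate of the time-(t/m) map.
    have h2 : (fun p : ℝ × P => γ p.2 p.1) =
        (fun p : ℝ × P => γ p.2 p.1) ∘ fun p : ℝ × P => (p.1 - t, γ p.2 t) := by
      funext p
      simp only [Function.comp_apply]
      rw [← hadd]
      congr 1
      ring
    rw [h2]
    refine ContMDiffAt.comp _ (hsmall _ (by simpa using he₀) _) ?_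
    exact ((contMDiffAt_fst.sub contMDiffAt_const)).prodMk
      (h1.contMDiffAt.comp _ contMDiffAt_snd)
  exact ⟨fun p => γ p.2 p.1, hsmooth, hγ0, hadd, hγ⟩

end ManifoldFlow

/-! ### Calculus of one-forms and their exterior derivatives in charts. -/

section FormCalculus

/-! Tangent spaces are identified with the model vector space throughout: one-forms on `N` are
functions `N → F →L[ℝ] ℝ` and vector fields are functions `N → F`. -/

variable {F : Type*} [NormedAddCommGroup F] [NormedSpace ℝ F]
  {K : Type*} [TopologicalSpace K] {J : ModelWithCorners ℝ F K}
  {N : Type*} [TopologicalSpace N] [ChartedSpace K N] [IsManifold J ∞ N] [J.Boundaryless]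
  {F' : Type*} [NormedAddCommGroup F'] [NormedSpace ℝ F']
  {K' : Type*} [TopologicalSpace K'] {J' : ModelWithCorners ℝ F' K'}
  {N' : Type*} [TopologicalSpace N'] [ChartedSpace K' N'] [IsManifold J' ∞ N'] [J'.Boundaryless]
  {F'' : Type*} [NormedAddCommGroup F''] [NormedSpace ℝ F'']
  {K'' : Type*} [TopologicalSpace K''] {J'' : ModelWithCorners ℝ F'' K''}
  {N'' : Type*} [TopologicalSpace N''] [ChartedSpace K'' N'']

/-- The antisymmetrised derivative of a one-form on a vector space. -/
def curl (a : F → (F →L[ℝ] ℝ)) (y v w : F) : ℝ := fderiv ℝ a y v w - fderiv ℝ a y w v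

lemma curl_congr {a b : F → (F →L[ℝ] ℝ)} {y : F} (h : a =ᶠ[𝓝 y] b) (v w : F) :
    curl a y v w = curl b y v w := by
  unfold curl; rw [h.fderiv_eq]

/-- The terms containing the second derivative of g are symmetric in v and w and cancel. -/
lemma curl_pullback {a : F' → (F' →L[ℝ] ℝ)} {b : F → (F →L[ℝ] ℝ)} {g : F → F'} {y : F}
    (ha : DifferentiableAt ℝ a (g y)) (hg : ContDiffAt ℝ ∞ g y)
    (hb : b =ᶠ[𝓝 y] fun y => (a (g y)).comp (fderiv ℝ g y)) (v w : F) :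
    curl b y v w = curl a (g y) (fderiv ℝ g y v) (fderiv ℝ g y w) := by
  rw [curl_congr hb]
  have hg1 : DifferentiableAt ℝ g y := hg.differentiableAt (by simp)
  have hg2 : DifferentiableAt ℝ (fderiv ℝ g) y :=
    (hg.fderiv_right (m := 1) (by norm_cast)).differentiableAt (by simp)
  have h1 : HasFDerivAt (fun y => a (g y)) ((fderiv ℝ a (g y)).comp (fderiv ℝ g y)) y :=
    ha.hasFDerivAt.comp y hg1.hasFDerivAt
  have h2 := h1.clm_comp hg2.hasFDerivAt
  have hs : IsSymmSndFDerivAt ℝ g y := hg.isSymmSndFDerivAt (by simp; norm_cast)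
  unfold curl
  rw [h2.fderiv]
  simp only [add_apply, ContinuousLinearMap.comp_apply,
    ContinuousLinearMap.flip_apply, ContinuousLinearMap.compL_apply]
  rw [hs.eq v w]
  ring

/-- The differential of a map, on the model vector spaces. -/
def md (J : ModelWithCorners ℝ F K) (J' : ModelWithCorners ℝ F' K') (f : N → N') (z : N) :
    F →L[ℝ] F' := mfderiv J J' f z

lemma md_comp {g : N' → N''} {f : N → N'} (z : N) (hg : MDifferentiableAt J' J'' g (f z))
    (hf : MDifferentiableAt J J' f z) :
    md J J'' (fun x => g (f x)) z = (md J' J'' g (f z)).comp (md J J' f z) :=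
  mfderiv_comp z hg hf

lemma md_congr {f g : N → N'} {z : N} (h : f =ᶠ[𝓝 z] g) : md J J' f z = md J J' g z :=
  h.mfderiv_eq

lemma md_id (z : N) : md J J (fun x : N => x) z = ContinuousLinearMap.id ℝ F := mfderiv_id

lemma md_eq_fderiv (f : F → F') (y : F) : md 𝓘(ℝ, F) 𝓘(ℝ, F') f y = fderiv ℝ f y :=
  mfderiv_eq_fderiv

lemma extChartAt_mdiff {x₀ z : N} (hz : z ∈ (extChartAt J x₀).source) :
    MDifferentiableAt J 𝓘(ℝ, F) (extChartAt J x₀) z :=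
  mdifferentiableAt_extChartAt (by rwa [extChartAt_source] at hz)

lemma extChartAt_symm_mdiff {x₀ : N} {y : F} (hy : y ∈ (extChartAt J x₀).target) :
    MDifferentiableAt 𝓘(ℝ, F) J (extChartAt J x₀).symm y := by
  have := mdifferentiableWithinAt_extChartAt_symm (I := J) hy
  rwa [ModelWithCorners.range_eq_univ, mdifferentiableWithinAt_univ] at this

lemma md_symm_md {x₀ z : N} (hz : z ∈ (extChartAt J x₀).source) (v : F) :
    md 𝓘(ℝ, F) J (extChartAt J x₀).symm (extChartAt J x₀ z)
      (md J 𝓘(ℝ, F) (extChartAt J x₀) z v) = v := by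
  have hy := (extChartAt J x₀).map_source hz
  have h1 := md_comp (J := J) (J' := 𝓘(ℝ, F)) (J'' := J) z
    (extChartAt_symm_mdiff hy) (extChartAt_mdiff hz)
  have h2 : (fun x => (extChartAt J x₀).symm (extChartAt J x₀ x)) =ᶠ[𝓝 z] fun x => x := by
    filter_upwards [(isOpen_extChartAt_source (I := J) x₀).mem_nhds hz] with t ht
    exact (extChartAt J x₀).left_inv ht
  rw [md_congr h2, md_id] at h1
  exact (congrArg (fun L => L v) h1).symm

lemma md_md_symm {x₀ : N} {y : F} (hy : y ∈ (extChartAt J x₀).target) (v : F) :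
    md J 𝓘(ℝ, F) (extChartAt J x₀) ((extChartAt J x₀).symm y)
      (md 𝓘(ℝ, F) J (extChartAt J x₀).symm y v) = v := by
  have hz := (extChartAt J x₀).map_target hy
  have h1 := md_comp (J := 𝓘(ℝ, F)) (J' := J) (J'' := 𝓘(ℝ, F)) y
    (extChartAt_mdiff hz) (extChartAt_symm_mdiff hy)
  have h2 : (fun x => extChartAt J x₀ ((extChartAt J x₀).symm x)) =ᶠ[𝓝 y] fun x => x := by
    filter_upwards [(isOpen_extChartAt_target (I := J) x₀).mem_nhds hy] with t ht
    exact (extChartAt J x₀).right_inv ht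
  rw [md_congr h2, md_id] at h1
  exact (congrArg (fun L => L v) h1).symm

/-- The coordinate expression of a one-form in the preferred chart at `x₀`. -/
def formInChart (J : ModelWithCorners ℝ F K) (lam : N → F →L[ℝ] ℝ) (x₀ : N) (y : F) : F →L[ℝ] ℝ :=
  (lam ((extChartAt J x₀).symm y)).comp (md 𝓘(ℝ, F) J (extChartAt J x₀).symm y)

/-- The exterior derivative of a one-form. -/
def extd (J : ModelWithCorners ℝ F K) (lam : N → F →L[ℝ] ℝ) (z : N) (v w : F) : ℝ :=
  curl (formInChart J lam z) (extChartAt J z z) (md J 𝓘(ℝ, F) (extChartAt J z) z v)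
    (md J 𝓘(ℝ, F) (extChartAt J z) z w)

/-- Smoothness of a one-form at a point. -/
def FormSmoothAt (J : ModelWithCorners ℝ F K) (lam : N → F →L[ℝ] ℝ) (z : N) : Prop :=
  ContDiffAt ℝ ∞ (formInChart J lam z) (extChartAt J z z)

/-- Smoothness of a one-form is stated in the cotangent bundle; this links it to coordinates. The
bundle trivialization is precomposition with the derivative of the inverse chart. -/
lemma trivializationAt_form_snd (lam : OneForm J N) {x₀ x : N} (hx : x ∈ (extChartAt J x₀).source) :
    (trivializationAt (F →L[ℝ] ℝ) (fun x : N => TangentSpace J x →L[ℝ] Trivial N ℝ x) x₀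
      ⟨x, lam x⟩).2 = formInChart J lam x₀ (extChartAt J x₀ x) := by
  let e := trivializationAt (F →L[ℝ] ℝ)
    (fun x : N => TangentSpace J x →L[ℝ] Trivial N ℝ x) x₀
  change (e ⟨x, lam x⟩).2 = _
  have hxc : x ∈ (chartAt K x₀).source := by rwa [extChartAt_source] at hx
  have e0 : (e ⟨x, lam x⟩).2 = ContinuousLinearMap.inCoordinates F (TangentSpace J) ℝ
    (Trivial N ℝ) x₀ x x₀ x (lam x) := by
      simp only [e]
      rw [hom_trivializationAt_apply]
  rw [e0, ContinuousLinearMap.inCoordinates, TangentBundle.symmL_trivializationAt hxc,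
    ModelWithCorners.range_eq_univ, mfderivWithin_univ]
  have e1 : ∀ l : N → F →L[ℝ] ℝ, formInChart J l x₀ (extChartAt J x₀ x) =
      (l x).comp (md 𝓘(ℝ, F) J (extChartAt J x₀).symm (extChartAt J x₀ x)) := fun l => by
    rw [formInChart, (extChartAt J x₀).left_inv hx]
  refine Eq.trans ?_ (e1 lam).symm
  have e2 : Trivialization.continuousLinearMapAt ℝ (trivializationAt ℝ (Trivial N ℝ) x₀) x =
      ContinuousLinearMap.id ℝ ℝ := Bundle.Trivial.continuousLinearMapAt_trivialization ℝ N ℝ x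
  let l₀ : F →L[ℝ] ℝ := lam x
  let l : F →L[ℝ] ℝ := l₀.comp
    (md 𝓘(ℝ, F) J (extChartAt J x₀).symm (extChartAt J x₀ x))
  have e3 : ∀ L : ℝ →L[ℝ] ℝ, L = ContinuousLinearMap.id ℝ ℝ → L.comp l = l := by
    rintro L rfl
    exact ContinuousLinearMap.id_comp _
  exact e3 _ e2

/-- The base point x₀ of the chart is left free, which yields the independence of smoothness from
the chart. -/
lemma contMDiffAt_form_iff_inChart (lam : OneForm J N) {x₀ z : N}
    (hz : z ∈ (extChartAt J x₀).source) :
    ContMDiffAt J (J.prod 𝓘(ℝ, F →L[ℝ] ℝ)) ∞ (fun z => (⟨z, lam z⟩ : CotangentBundle J N)) z ↔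
      ContDiffAt ℝ ∞ (formInChart J lam x₀) (extChartAt J x₀ z) := by
  have hzc : z ∈ (chartAt K x₀).source := by rwa [extChartAt_source] at hz
  have hy := (extChartAt J x₀).map_source hz
  let e := trivializationAt (F →L[ℝ] ℝ)
    (fun x : N => TangentSpace J x →L[ℝ] Trivial N ℝ x) x₀
  have hb : z ∈ e.baseSet := by
    change z ∈ _ ∩ _
    exact ⟨hzc, mem_univ _⟩
  have h1 := Trivialization.contMDiffAt_section_iff (IB := J) (n := ∞) (s := lam) e hb
  have h2 : (fun x => (e ⟨x, lam x⟩).2) =ᶠ[𝓝 z]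
      fun x => formInChart J lam x₀ (extChartAt J x₀ x) := by
    filter_upwards [(isOpen_extChartAt_source (I := J) x₀).mem_nhds hz] with x hx
    exact trivializationAt_form_snd lam hx
  have h3 : ContMDiffAt J (J.prod 𝓘(ℝ, F →L[ℝ] ℝ)) ∞
      (fun z => (⟨z, lam z⟩ : CotangentBundle J N)) z ↔ ContMDiffAt J 𝓘(ℝ, F →L[ℝ] ℝ) ∞
      (fun x => formInChart J lam x₀ (extChartAt J x₀ x)) z :=
    h1.trans ⟨fun h => h.congr_of_eventuallyEq h2.symm, fun h => h.congr_of_eventuallyEq h2⟩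
  rw [h3]
  constructor
  · intro h
    have h5 : ContMDiffAt 𝓘(ℝ, F) J ∞ (extChartAt J x₀).symm (extChartAt J x₀ z) :=
      (contMDiffOn_extChartAt_symm x₀).contMDiffAt
        ((isOpen_extChartAt_target (I := J) x₀).mem_nhds hy)
    have h6 := ContMDiffAt.comp_of_eq h h5 ((extChartAt J x₀).left_inv hz)
    refine (h6.congr_of_eventuallyEq ?_).contDiffAt
    filter_upwards [(isOpen_extChartAt_target (I := J) x₀).mem_nhds hy] with t ht
    simp only [Function.comp_apply]
    rw [(extChartAt J x₀).right_inv ht]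
  · intro h
    exact h.contMDiffAt.comp z (contMDiffAt_extChartAt' hzc)

lemma formSmoothAt_iff (lam : OneForm J N) (z : N) : FormSmoothAt J lam z ↔
    ContMDiffAt J (J.prod 𝓘(ℝ, F →L[ℝ] ℝ)) ∞ (fun z => (⟨z, lam z⟩ : CotangentBundle J N)) z :=
  (contMDiffAt_form_iff_inChart lam (mem_extChartAt_source (I := J) z)).symm

lemma formSmoothAt_iff_inChart (lam : N → F →L[ℝ] ℝ) {x₀ z : N}
    (hz : z ∈ (extChartAt J x₀).source) : FormSmoothAt J lam z ↔
      ContDiffAt ℝ ∞ (formInChart J lam x₀) (extChartAt J x₀ z) :=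
  (formSmoothAt_iff (J := J) lam z).trans (contMDiffAt_form_iff_inChart (J := J) lam hz)

/-- Pullback of a one-form. -/
def formPullback (J : ModelWithCorners ℝ F K) (J' : ModelWithCorners ℝ F' K') (f : N → N')
    (lam : N' → F' →L[ℝ] ℝ) : N → F →L[ℝ] ℝ :=
  fun z => (lam (f z)).comp (md J J' f z)

/-- The coordinate expression of a map. -/
def mapInChart (J : ModelWithCorners ℝ F K) (J' : ModelWithCorners ℝ F' K') (f : N → N') (x₀ : N)
    (x₁ : N') : F → F' := fun y => extChartAt J' x₁ (f ((extChartAt J x₀).symm y))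

lemma fderiv_mapInChart {f : N → N'} {x₀ : N} {x₁ : N'} {y : F}
    (hy : y ∈ (extChartAt J x₀).target) (hf : MDifferentiableAt J J' f ((extChartAt J x₀).symm y))
    (hfy : f ((extChartAt J x₀).symm y) ∈ (extChartAt J' x₁).source) :
    fderiv ℝ (mapInChart J J' f x₀ x₁) y = (md J' 𝓘(ℝ, F') (extChartAt J' x₁)
      (f ((extChartAt J x₀).symm y))).comp ((md J J' f ((extChartAt J x₀).symm y)).comp
        (md 𝓘(ℝ, F) J (extChartAt J x₀).symm y)) := by
  have h1 := md_comp (J := 𝓘(ℝ, F)) (J' := J) (J'' := J') y hf (extChartAt_symm_mdiff hy)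
  have h2 := md_comp (J := 𝓘(ℝ, F)) (J' := J') (J'' := 𝓘(ℝ, F')) y
    (f := fun y => f ((extChartAt J x₀).symm y))
    (extChartAt_mdiff hfy) (hf.comp y (extChartAt_symm_mdiff hy))
  rw [← md_eq_fderiv]
  unfold mapInChart
  rw [h2, h1]

lemma formInChart_pullback (lam : N' → F' →L[ℝ] ℝ) {f : N → N'} {x₀ : N} {x₁ : N'} {y : F}
    (hy : y ∈ (extChartAt J x₀).target) (hf : MDifferentiableAt J J' f ((extChartAt J x₀).symm y))
    (hfy : f ((extChartAt J x₀).symm y) ∈ (extChartAt J' x₁).source) :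
    formInChart J (formPullback J J' f lam) x₀ y =
      (formInChart J' lam x₁ (mapInChart J J' f x₀ x₁ y)).comp
      (fderiv ℝ (mapInChart J J' f x₀ x₁) y) := by
  have e : (extChartAt J' x₁).symm (mapInChart J J' f x₀ x₁ y) = f ((extChartAt J x₀).symm y) :=
    (extChartAt J' x₁).left_inv hfy
  rw [fderiv_mapInChart hy hf hfy]
  ext v
  simp only [formInChart, formPullback, ContinuousLinearMap.comp_apply]
  rw [e]
  unfold mapInChart
  rw [md_symm_md hfy]

lemma contDiffAt_mapInChart {f : N → N'} {x₀ z : N} {x₁ : N'}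
    (hz : z ∈ (extChartAt J x₀).source) (hfz : f z ∈ (extChartAt J' x₁).source)
    (hf : ContMDiffAt J J' ∞ f z) :
    ContDiffAt ℝ ∞ (mapInChart J J' f x₀ x₁) (extChartAt J x₀ z) := by
  rw [contMDiffAt_iff_of_mem_source (x := x₀) (y := x₁) (by rwa [extChartAt_source] at hz)
    (by rwa [extChartAt_source] at hfz), J.range_eq_univ, contDiffWithinAt_univ] at hf
  exact hf.2

lemma ContMDiffAt.eventually_mdifferentiableAt {f : N → N'} {z : N} (hf : ContMDiffAt J J' ∞ f z) :
    ∀ᶠ x in 𝓝 z, MDifferentiableAt J J' f x := by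
  have h := (contMDiffAt_iff_contMDiffAt_nhds (n := 1) (by simp)).1 (hf.of_le (by simp))
  exact h.mono fun x hx => hx.mdifferentiableAt (by simp)

lemma ContMDiffAt.mdiff {f : N → N'} {z : N} (hf : ContMDiffAt J J' ∞ f z) :
    MDifferentiableAt J J' f z := hf.mdifferentiableAt (by simp)

lemma eventually_chart {f : N → N'} {x₀ z : N} {x₁ : N'}
    (hz : z ∈ (extChartAt J x₀).source) (hfz : f z ∈ (extChartAt J' x₁).source)
    (hf : ContMDiffAt J J' ∞ f z) :
    ∀ᶠ y in 𝓝 (extChartAt J x₀ z), y ∈ (extChartAt J x₀).target ∧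
      MDifferentiableAt J J' f ((extChartAt J x₀).symm y) ∧
      f ((extChartAt J x₀).symm y) ∈ (extChartAt J' x₁).source := by
  have h1 := (isOpen_extChartAt_target (I := J) x₀).mem_nhds ((extChartAt J x₀).map_source hz)
  have h2 := (continuousAt_extChartAt_symm' hz)
  rw [ContinuousAt, (extChartAt J x₀).left_inv hz] at h2
  filter_upwards [h1, h2.eventually hf.eventually_mdifferentiableAt,
    h2.eventually (hf.continuousAt.eventually
      ((isOpen_extChartAt_source (I := J') x₁).mem_nhds hfz))] with y a b c
  exact ⟨a, b, c⟩

lemma FormSmoothAt.pullback {lam : N' → F' →L[ℝ] ℝ} {f : N → N'} {z : N}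
    (hl : FormSmoothAt J' lam (f z)) (hf : ContMDiffAt J J' ∞ f z) :
    FormSmoothAt J (formPullback J J' f lam) z := by
  have hz := mem_extChartAt_source (I := J) z
  have hfz := mem_extChartAt_source (I := J') (f z)
  have hg := contDiffAt_mapInChart hz hfz hf
  have e : mapInChart J J' f z (f z) (extChartAt J z z) = extChartAt J' (f z) (f z) := by
    simp [mapInChart]
  refine ContDiffAt.congr_of_eventuallyEq (f := fun y =>
    (formInChart J' lam (f z) (mapInChart J J' f z (f z) y)).comp
      (fderiv ℝ (mapInChart J J' f z (f z)) y)) ?_ ?_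
  · refine ContDiffAt.clm_comp (ContDiffAt.comp (g := formInChart J' lam (f z)) _ ?_ hg) ?_
    · rw [e]; exact hl
    · exact hg.fderiv_right (m := ∞) (by norm_num)
  · filter_upwards [eventually_chart hz hfz hf] with y hy
    exact formInChart_pullback lam hy.1 hy.2.1 hy.2.2

/-- Both charts are arbitrary, so one computation serves twice: with f the identity it shows that
the exterior derivative does not depend on the chart, and with preferred charts it shows that it
commutes with pullback. -/
lemma curl_formInChart_pullback {lam : N' → F' →L[ℝ] ℝ} {f : N → N'} {x₀ z : N} {x₁ : N'}
    (hz : z ∈ (extChartAt J x₀).source) (hfz : f z ∈ (extChartAt J' x₁).source)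
    (hl : FormSmoothAt J' lam (f z)) (hf : ContMDiffAt J J' ∞ f z) (v w : F) :
    curl (formInChart J (formPullback J J' f lam) x₀) (extChartAt J x₀ z)
      (md J 𝓘(ℝ, F) (extChartAt J x₀) z v) (md J 𝓘(ℝ, F) (extChartAt J x₀) z w) =
    curl (formInChart J' lam x₁) (extChartAt J' x₁ (f z))
      (md J' 𝓘(ℝ, F') (extChartAt J' x₁) (f z) (md J J' f z v))
      (md J' 𝓘(ℝ, F') (extChartAt J' x₁) (f z) (md J J' f z w)) := by
  have hg := contDiffAt_mapInChart hz hfz hf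
  have e : mapInChart J J' f x₀ x₁ (extChartAt J x₀ z) = extChartAt J' x₁ (f z) := by
    simp only [mapInChart]; rw [(extChartAt J x₀).left_inv hz]
  have hl' : DifferentiableAt ℝ (formInChart J' lam x₁)
      (mapInChart J J' f x₀ x₁ (extChartAt J x₀ z)) := by
    rw [e]
    exact ((formSmoothAt_iff_inChart lam hfz).1 hl).differentiableAt (by simp)
  have hev := eventually_chart hz hfz hf
  rw [curl_pullback (b := formInChart J (formPullback J J' f lam) x₀) hl' hg
    (hev.mono fun y hy => formInChart_pullback lam hy.1 hy.2.1 hy.2.2), e]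
  obtain ⟨h1, h2, h3⟩ := hev.self_of_nhds
  rw [fderiv_mapInChart h1 h2 h3]
  simp only [ContinuousLinearMap.comp_apply]
  rw [md_symm_md hz, md_symm_md hz, (extChartAt J x₀).left_inv hz]

lemma formPullback_id (lam : N → F →L[ℝ] ℝ) : formPullback J J (fun x : N => x) lam = lam := by
  funext z
  rw [formPullback, md_id]
  ext v; rfl

/-- The exterior derivative may be computed in any chart. -/
lemma extd_eq_curl {lam : N → F →L[ℝ] ℝ} {x₀ z : N} (hz : z ∈ (extChartAt J x₀).source)
    (hl : FormSmoothAt J lam z) (v w : F) :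
    extd J lam z v w = curl (formInChart J lam x₀) (extChartAt J x₀ z)
      (md J 𝓘(ℝ, F) (extChartAt J x₀) z v) (md J 𝓘(ℝ, F) (extChartAt J x₀) z w) := by
  have h := curl_formInChart_pullback (J := J) (J' := J) (f := fun x : N => x) (x₁ := z)
    hz (mem_extChartAt_source (I := J) z) hl contMDiffAt_id v w
  rw [formPullback_id] at h
  rw [h, md_id]
  rfl

/-- The exterior derivative commutes with pullback. -/
theorem extd_pullback {lam : N' → F' →L[ℝ] ℝ} {f : N → N'} {z : N}
    (hl : FormSmoothAt J' lam (f z)) (hf : ContMDiffAt J J' ∞ f z) (v w : F) :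
    extd J (formPullback J J' f lam) z v w =
      extd J' lam (f z) (md J J' f z v) (md J J' f z w) :=
  curl_formInChart_pullback (mem_extChartAt_source (I := J) z)
    (mem_extChartAt_source (I := J') (f z)) hl hf v w

lemma formInChart_congr {lam mu : N → F →L[ℝ] ℝ} {z : N} (h : lam =ᶠ[𝓝 z] mu) :
    formInChart J lam z =ᶠ[𝓝 (extChartAt J z z)] formInChart J mu z := by
  have h2 := (continuousAt_extChartAt_symm (I := J) z)
  rw [ContinuousAt, extChartAt_to_inv] at h2
  filter_upwards [h2.eventually h] with y hy
  rw [formInChart, formInChart, hy]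

lemma FormSmoothAt.congr {lam mu : N → F →L[ℝ] ℝ} {z : N} (hl : FormSmoothAt J lam z)
    (h : mu =ᶠ[𝓝 z] lam) : FormSmoothAt J mu z :=
  ContDiffAt.congr_of_eventuallyEq hl (formInChart_congr h)

lemma extd_congr {lam mu : N → F →L[ℝ] ℝ} {z : N} (h : lam =ᶠ[𝓝 z] mu) (v w : F) :
    extd J lam z v w = extd J mu z v w :=
  curl_congr (formInChart_congr h) _ _

lemma FormSmoothAt.add {lam mu : N → F →L[ℝ] ℝ} {z : N} (hl : FormSmoothAt J lam z)
    (hm : FormSmoothAt J mu z) : FormSmoothAt J (fun x => lam x + mu x) z := by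
  have : formInChart J (fun x => lam x + mu x) z
      = fun y => formInChart J lam z y + formInChart J mu z y := by
    funext y; ext v; rfl
  unfold FormSmoothAt
  rw [this]
  exact ContDiffAt.add hl hm

lemma extd_add {lam mu : N → F →L[ℝ] ℝ} {z : N} (hl : FormSmoothAt J lam z)
    (hm : FormSmoothAt J mu z) (v w : F) :
    extd J (fun x => lam x + mu x) z v w = extd J lam z v w + extd J mu z v w := by
  have : formInChart J (fun x => lam x + mu x) z
      = fun y => formInChart J lam z y + formInChart J mu z y := by
    funext y; ext v; rfl
  have h1 : DifferentiableAt ℝ (formInChart J lam z) (extChartAt J z z) :=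
    ContDiffAt.differentiableAt hl (by simp)
  have h2 : DifferentiableAt ℝ (formInChart J mu z) (extChartAt J z z) :=
    ContDiffAt.differentiableAt hm (by simp)
  unfold extd curl
  rw [this, (h1.hasFDerivAt.add h2.hasFDerivAt : HasFDerivAt (fun y => _ + _) _ _).fderiv]
  simp only [add_apply]
  ring

lemma contDiffAt_inChart {f : N → ℝ} {z : N} (hf : ContMDiffAt J 𝓘(ℝ, ℝ) ∞ f z) :
    ContDiffAt ℝ ∞ (fun y => f ((extChartAt J z).symm y)) (extChartAt J z z) := by
  have := contDiffAt_mapInChart (J' := 𝓘(ℝ, ℝ)) (x₁ := f z) (mem_extChartAt_source (I := J) z)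
    (by simp) hf
  exact this

lemma FormSmoothAt.smul {lam : N → F →L[ℝ] ℝ} {f : N → ℝ} {z : N} (hl : FormSmoothAt J lam z)
    (hf : ContMDiffAt J 𝓘(ℝ, ℝ) ∞ f z) : FormSmoothAt J (fun x => f x • lam x) z := by
  have : formInChart J (fun x => f x • lam x) z
      = fun y => f ((extChartAt J z).symm y) • formInChart J lam z y := by
    funext y; ext v; rfl
  unfold FormSmoothAt
  rw [this]
  exact (contDiffAt_inChart hf).smul hl

lemma extd_smul {lam : N → F →L[ℝ] ℝ} {f : N → ℝ} {z : N} (hl : FormSmoothAt J lam z)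
    (hf : ContMDiffAt J 𝓘(ℝ, ℝ) ∞ f z) (v w : F) :
    extd J (fun x => f x • lam x) z v w =
      md J 𝓘(ℝ, ℝ) f z v * lam z w - md J 𝓘(ℝ, ℝ) f z w * lam z v + f z * extd J lam z v w := by
  have : formInChart J (fun x => f x • lam x) z
      = fun y => f ((extChartAt J z).symm y) • formInChart J lam z y := by
    funext y; ext v; rfl
  have h1 : DifferentiableAt ℝ (formInChart J lam z) (extChartAt J z z) :=
    ContDiffAt.differentiableAt hl (by simp)
  have h2 := (contDiffAt_inChart hf).differentiableAt (by simp)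
  have hz := mem_extChartAt_source (I := J) z
  have h3 : fderiv ℝ (fun y => f ((extChartAt J z).symm y)) (extChartAt J z z)
      = (md J 𝓘(ℝ, ℝ) f z).comp (md 𝓘(ℝ, F) J (extChartAt J z).symm (extChartAt J z z)) := by
    rw [← md_eq_fderiv]
    have := md_comp (J := 𝓘(ℝ, F)) (J' := J) (J'' := 𝓘(ℝ, ℝ)) (g := f) (extChartAt J z z)
      (f := (extChartAt J z).symm) (by rw [extChartAt_to_inv]; exact hf.mdiff)
      (extChartAt_symm_mdiff (mem_extChartAt_target z))
    rw [extChartAt_to_inv] at this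
    exact this
  unfold extd curl
  have h4 := h2.hasFDerivAt.smul h1.hasFDerivAt
  rw [this, show fderiv ℝ (fun y => f ((extChartAt J z).symm y) • formInChart J lam z y) _ = _
    from h4.fderiv]
  simp only [add_apply, smul_apply, ContinuousLinearMap.smulRight_apply]
  rw [h3]
  simp only [ContinuousLinearMap.comp_apply, formInChart, smul_eq_mul]
  rw [md_symm_md hz, md_symm_md hz, extChartAt_to_inv]
  ring

/-- The form df is the pullback under f of the constant form on the line, so d(df) = 0 is an
instance of naturality. -/
lemma FormSmoothAt.md {f : N → ℝ} {z : N} (hf : ContMDiffAt J 𝓘(ℝ, ℝ) ∞ f z) :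
    FormSmoothAt J (md J 𝓘(ℝ, ℝ) f) z ∧ ∀ v w, extd J (_root_.md J 𝓘(ℝ, ℝ) f) z v w = 0 := by
  let c : ℝ → ℝ →L[ℝ] ℝ := fun _ => ContinuousLinearMap.id ℝ ℝ
  have e : formInChart 𝓘(ℝ, ℝ) c (f z) = c := by
    funext y
    simp only [formInChart, c, extChartAt_model_space_eq_id]
    ext
    simp only [ContinuousLinearMap.comp_apply]
    exact congrArg (fun L => L 1) (md_id (J := 𝓘(ℝ, ℝ)) (N := ℝ) y)
  have hc : FormSmoothAt 𝓘(ℝ, ℝ) c (f z) := by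
    unfold FormSmoothAt
    rw [e]
    exact contDiffAt_const
  have h1 : _root_.md J 𝓘(ℝ, ℝ) f = formPullback J 𝓘(ℝ, ℝ) f c := by
    funext x; ext v; rfl
  rw [h1]
  refine ⟨hc.pullback hf, fun v w => ?_⟩
  rw [extd_pullback hc hf]
  unfold extd
  rw [e]
  simp [curl, c]

lemma extd_add_right (lam : N → F →L[ℝ] ℝ) (z : N) (v w w' : F) :
    extd J lam z v (w + w') = extd J lam z v w + extd J lam z v w' := by
  simp only [extd, curl, map_add, add_apply]; ring

lemma extd_smul_right (lam : N → F →L[ℝ] ℝ) (z : N) (v w : F) (c : ℝ) :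
    extd J lam z v (c • w) = c * extd J lam z v w := by
  simp only [extd, curl, map_smul, smul_apply, smul_eq_mul]; ring

lemma extd_swap (lam : N → F →L[ℝ] ℝ) (z : N) (v w : F) :
    extd J lam z v w = - extd J lam z w v := by
  simp only [extd, curl]; ring

lemma extd_self (lam : N → F →L[ℝ] ℝ) (z : N) (v : F) : extd J lam z v v = 0 := by
  simp only [extd, curl]; ring

lemma extd_add_left (lam : N → F →L[ℝ] ℝ) (z : N) (v v' w : F) :
    extd J lam z (v + v') w = extd J lam z v w + extd J lam z v' w := by
  rw [extd_swap, extd_add_right, extd_swap (v := v), extd_swap (v := v')]; ring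

lemma extd_smul_left (lam : N → F →L[ℝ] ℝ) (z : N) (v w : F) (c : ℝ) :
    extd J lam z (c • v) w = c * extd J lam z v w := by
  rw [extd_swap, extd_smul_right, extd_swap (v := v)]; ring

end FormCalculus

/-! ### Invariance of dΞ along homotopies with velocity in its kernel. -/

section Invariance

variable {F : Type*} [NormedAddCommGroup F] [NormedSpace ℝ F]
  {K : Type*} [TopologicalSpace K] {J : ModelWithCorners ℝ F K}
  {N : Type*} [TopologicalSpace N] [ChartedSpace K N] [IsManifold J ∞ N] [J.Boundaryless]
  {F' : Type*} [NormedAddCommGroup F'] [NormedSpace ℝ F']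
  {K' : Type*} [TopologicalSpace K'] {J' : ModelWithCorners ℝ F' K'}
  {N' : Type*} [TopologicalSpace N'] [ChartedSpace K' N'] [IsManifold J' ∞ N'] [J'.Boundaryless]

lemma formInChart_model (a : F → F →L[ℝ] ℝ) (x : F) : formInChart 𝓘(ℝ, F) a x = a := by
  funext y
  simp only [formInChart, extChartAt_model_space_eq_id]
  ext v
  simp only [ContinuousLinearMap.comp_apply]
  exact congrArg (fun L => a y (L v)) (md_id (J := 𝓘(ℝ, F)) (N := F) y)

lemma extd_model (a : F → F →L[ℝ] ℝ) (x v w : F) : extd 𝓘(ℝ, F) a x v w = curl a x v w := by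
  unfold extd
  rw [formInChart_model]
  simp only [extChartAt_model_space_eq_id]
  have h : md 𝓘(ℝ, F) 𝓘(ℝ, F) (PartialEquiv.refl F) x = ContinuousLinearMap.id ℝ F :=
    md_id (J := 𝓘(ℝ, F)) (N := F) x
  rw [h]
  rfl

lemma formSmoothAt_model {a : F → F →L[ℝ] ℝ} {x : F} :
    FormSmoothAt 𝓘(ℝ, F) a x ↔ ContDiffAt ℝ ∞ a x := by
  unfold FormSmoothAt
  rw [formInChart_model]
  exact Iff.rfl

/-- If `e` lies in the kernel of `da` near `x`, then `da` is invariant in the direction `e`. -/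
lemma hasDerivAt_curl_of_ker {a : F → F →L[ℝ] ℝ} {g : ℝ → F} {t : ℝ} {e : F}
    (hg : HasDerivAt g e t) (ha : ContDiffAt ℝ ∞ a (g t))
    (he : ∀ᶠ y in 𝓝 (g t), ∀ w, curl a y e w = 0) (U W : F) :
    HasDerivAt (fun s => curl a (g s) U W) 0 t := by
  have hd : DifferentiableAt ℝ (fderiv ℝ a) (g t) :=
    (ha.fderiv_right (m := 1) (by norm_cast)).differentiableAt (by simp)
  have hs : IsSymmSndFDerivAt ℝ a (g t) := ha.isSymmSndFDerivAt (by simp; norm_cast)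
  -- This is da(e, U) = 0 differentiated in the direction W. Together with the symmetry of the
  -- second derivative of a, it gives the coordinate form of L_e da = d(i_e da) = 0.
  have key : ∀ U W : F, fderiv ℝ (fderiv ℝ a) (g t) W e U = fderiv ℝ (fderiv ℝ a) (g t) W U e := by
    intro U W
    have h1 : (fun y => fderiv ℝ a y e U - fderiv ℝ a y U e) =ᶠ[𝓝 (g t)] fun _ => 0 :=
      he.mono fun y hy => hy U
    have h2 : HasFDerivAt (fun y => fderiv ℝ a y e U - fderiv ℝ a y U e) _ (g t) :=
      ((hd.hasFDerivAt.clm_apply (hasFDerivAt_const e _)).clm_apply (hasFDerivAt_const U _)).sub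
      ((hd.hasFDerivAt.clm_apply (hasFDerivAt_const U _)).clm_apply (hasFDerivAt_const e _))
    have h3 := h2.fderiv
    rw [h1.fderiv_eq] at h3
    have h4 := congrArg (fun L => L W) h3
    simp at h4
    linarith
  have h2 : HasFDerivAt (fun y => fderiv ℝ a y U W - fderiv ℝ a y W U) _ (g t) :=
      ((hd.hasFDerivAt.clm_apply (hasFDerivAt_const U _)).clm_apply (hasFDerivAt_const W _)).sub
      ((hd.hasFDerivAt.clm_apply (hasFDerivAt_const W _)).clm_apply (hasFDerivAt_const U _))
  refine HasDerivAt.congr_deriv (h2.comp_hasDerivAt t hg) ?_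
  simp only [ContinuousLinearMap.comp_apply, sub_apply, add_apply,
    ContinuousLinearMap.flip_apply, zero_apply, map_zero, zero_add]
  have e1 := congrArg (fun L => L W) (hs.eq e U)
  have e2 := congrArg (fun L => L e) (hs.eq U W)
  have e3 := congrArg (fun L => L U) (hs.eq e W)
  have k1 := key W U
  have k2 := key U W
  linarith

/-- If the velocity of a smooth homotopy lies in the kernel of `dΞ`, then the pullbacks of `dΞ`
do not change along the homotopy. -/
theorem extd_pullback_invariant {G : ℝ × N → N'} {Xi : N' → F' →L[ℝ] ℝ} {z : N}
    (hG : ContMDiff (𝓘(ℝ, ℝ).prod J) J' ∞ G)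
    (hXi : ∀ t ∈ Icc (0 : ℝ) 1, FormSmoothAt J' Xi (G (t, z)))
    (hker : ∀ t ∈ Icc (0 : ℝ) 1, ∀ᶠ p in 𝓝 (t, z), FormSmoothAt J' Xi (G p) ∧
      ∀ w, extd J' Xi (G p) (md (𝓘(ℝ, ℝ).prod J) J' G p (1, 0)) w = 0) (v w : F) :
    extd J' Xi (G (1, z)) (md J J' (fun x => G (1, x)) z v) (md J J' (fun x => G (1, x)) z w) =
    extd J' Xi (G (0, z)) (md J J' (fun x => G (0, x)) z v) (md J J' (fun x => G (0, x)) z w) := by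
  set c := extChartAt J z with hc
  have hzs : z ∈ c.source := mem_extChartAt_source (I := J) z
  have hcz : c z ∈ c.target := mem_extChartAt_target (I := J) z
  let i : ℝ × F → ℝ × N := fun y => (y.1, c.symm y.2)
  have hi : ∀ y : ℝ × F, y.2 ∈ c.target →
      ContMDiffAt 𝓘(ℝ, ℝ × F) (𝓘(ℝ, ℝ).prod J) ∞ i y := by
    intro y hy
    have h1 : ContMDiffAt 𝓘(ℝ, ℝ × F) 𝓘(ℝ, ℝ) ∞ (fun y : ℝ × F => y.1) y :=
      contDiffAt_fst.contMDiffAt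
    have h2 : ContMDiffAt 𝓘(ℝ, ℝ × F) 𝓘(ℝ, F) ∞ (fun y : ℝ × F => y.2) y :=
      contDiffAt_snd.contMDiffAt
    have h3 : ContMDiffAt 𝓘(ℝ, F) J ∞ c.symm y.2 :=
      (contMDiffOn_extChartAt_symm z).contMDiffAt
        ((isOpen_extChartAt_target (I := J) z).mem_nhds hy)
    exact h1.prodMk (h3.comp y h2)
  let Gh : ℝ × F → N' := fun y => G (i y)
  have hGh : ∀ y : ℝ × F, y.2 ∈ c.target → ContMDiffAt 𝓘(ℝ, ℝ × F) J' ∞ Gh y :=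
    fun y hy => (hG _).comp y (hi y hy)
  -- On ℝ × F the velocity of the homotopy becomes the constant vector (1, 0), which lies in the
  -- kernel of da, so `hasDerivAt_curl_of_ker` applies along the lines s ↦ (s, c z).
  let a : ℝ × F → ℝ × F →L[ℝ] ℝ := formPullback 𝓘(ℝ, ℝ × F) J' Gh Xi
  have hcurl : ∀ y : ℝ × F, y.2 ∈ c.target → FormSmoothAt J' Xi (Gh y) → ∀ v w,
      curl a y v w = extd J' Xi (Gh y) (md 𝓘(ℝ, ℝ × F) J' Gh y v)
        (md 𝓘(ℝ, ℝ × F) J' Gh y w) := fun y hy hX v w => by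
    rw [← extd_model]
    exact extd_pullback hX (hGh y hy) v w
  have hslice : ∀ y : ℝ × F, y.2 ∈ c.target → ∀ v : F, md 𝓘(ℝ, ℝ × F) J' Gh y (0, v) =
      md 𝓘(ℝ, F) J' (fun x => Gh (y.1, x)) y.2 v := by
    intro y hy v
    have h1 : MDifferentiableAt 𝓘(ℝ, F) 𝓘(ℝ, ℝ × F) (fun x : F => (y.1, x)) y.2 :=
      ((hasFDerivAt_const y.1 y.2).prodMk (hasFDerivAt_id y.2)).differentiableAt.mdifferentiableAt
    have h2 := md_comp (J := 𝓘(ℝ, F)) (J' := 𝓘(ℝ, ℝ × F)) (J'' := J') (g := Gh)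
      (f := fun x : F => (y.1, x)) y.2 (hGh y hy).mdiff h1
    rw [h2, md_eq_fderiv,
      (((hasFDerivAt_const y.1 y.2).prodMk (hasFDerivAt_id y.2)) :
        HasFDerivAt (fun x : F => (y.1, x)) _ y.2).fderiv]
    rfl
  have hslice' : ∀ t : ℝ, ∀ v : F, md 𝓘(ℝ, ℝ × F) J' Gh (t, c z) (0, md J 𝓘(ℝ, F) c z v) =
      md J J' (fun x => G (t, x)) z v := by
    intro t v
    rw [hslice _ hcz]
    have h0 : ContMDiffAt J J' ∞ (fun x => G (t, x)) z :=
      (hG _).comp z (contMDiffAt_const.prodMk contMDiffAt_id)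
    have hb : c.symm (c z) = z := c.left_inv hzs
    have h1 := md_comp (J := 𝓘(ℝ, F)) (J' := J) (J'' := J') (g := fun x => G (t, x))
      (f := c.symm) (c z) (by rw [hb]; exact h0.mdiff)
      (extChartAt_symm_mdiff hcz)
    refine (congrArg (fun L => L (md J 𝓘(ℝ, F) c z v)) h1).trans ?_
    simp only [ContinuousLinearMap.comp_apply]
    rw [hc, md_symm_md hzs, ← hc, hb]
  have hbase : ∀ t : ℝ, i (t, c z) = (t, z) := fun t => by
    change (t, c.symm (c z)) = _
    rw [c.left_inv hzs]
  have htime : ∀ y : ℝ × F, y.2 ∈ c.target → md 𝓘(ℝ, ℝ × F) J' Gh y (1, 0) =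
      md (𝓘(ℝ, ℝ).prod J) J' G (i y) (1, 0) := by
    intro y hy
    have h2 := md_comp (J := 𝓘(ℝ, ℝ × F)) (J' := 𝓘(ℝ, ℝ).prod J) (J'' := J') (g := G)
      (f := i) y (hG _).mdiff (hi y hy).mdiff
    refine (congrArg (fun L => L (1, 0)) h2).trans ?_
    simp only [ContinuousLinearMap.comp_apply]
    congr 1
    have h3 : MDifferentiableAt 𝓘(ℝ, ℝ) 𝓘(ℝ, ℝ × F) (fun s : ℝ => (s, y.2)) y.1 :=
      ((hasFDerivAt_id y.1).prodMk (hasFDerivAt_const y.2 y.1)).differentiableAt.mdifferentiableAt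
    have h4 := md_comp (J := 𝓘(ℝ, ℝ)) (J' := 𝓘(ℝ, ℝ × F)) (J'' := 𝓘(ℝ, ℝ).prod J) (g := i)
      (f := fun s : ℝ => (s, y.2)) y.1 (hi y hy).mdiff h3
    have h4' : fderiv ℝ (fun s : ℝ => (s, y.2)) y.1 = _ :=
      ((hasFDerivAt_id y.1).prodMk (hasFDerivAt_const y.2 y.1)).fderiv
    rw [md_eq_fderiv, h4'] at h4
    have h5 := congrArg (fun L => L 1) h4
    simp only [ContinuousLinearMap.comp_apply] at h5
    refine Eq.trans ?_ (h5.symm.trans ?_)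
    · rfl
    · have h6 := mfderiv_prodMk (I := 𝓘(ℝ, ℝ)) (I' := 𝓘(ℝ, ℝ)) (I'' := J) (x := y.1)
        (f := fun s : ℝ => s) (g := fun _ : ℝ => c.symm y.2) mdifferentiableAt_id
        mdifferentiableAt_const
      have h7 : md 𝓘(ℝ, ℝ) (𝓘(ℝ, ℝ).prod J) (fun s : ℝ => (s, c.symm y.2)) y.1 =
        (md 𝓘(ℝ, ℝ) 𝓘(ℝ, ℝ) (fun s : ℝ => s) y.1).prod
          (md 𝓘(ℝ, ℝ) J (fun _ : ℝ => c.symm y.2) y.1) := h6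
      have h8 : md 𝓘(ℝ, ℝ) J (fun _ : ℝ => c.symm y.2) y.1 = 0 := mfderiv_const
      have h9 : md 𝓘(ℝ, ℝ) 𝓘(ℝ, ℝ) (fun s : ℝ => s) y.1 = ContinuousLinearMap.id ℝ ℝ := md_id y.1
      refine (congrArg (fun L => L 1) h7).trans ?_
      rw [h8, h9]
      rfl
  have hder : ∀ t ∈ Icc (0 : ℝ) 1, ∀ v w, HasDerivAt
      (fun s : ℝ => curl a (s, c z) (0, v) (0, w)) 0 t := by
    intro t ht v w
    refine hasDerivAt_curl_of_ker (g := fun s : ℝ => (s, c z)) (e := (1, 0))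
      ((hasDerivAt_id t).prodMk (hasDerivAt_const t (c z))) ?_ ?_ _ _
    · rw [← formSmoothAt_model]
      refine FormSmoothAt.pullback ?_ (hGh (t, c z) hcz)
      change FormSmoothAt J' Xi (G (i (t, c z)))
      rw [hbase]
      exact hXi t ht
    · have h1 : Tendsto i (𝓝 (t, c z)) (𝓝 (t, z)) := by
        have := (hi (t, c z) hcz).continuousAt
        rwa [ContinuousAt, hbase] at this
      have h2 : ∀ᶠ y : ℝ × F in 𝓝 (t, c z), y.2 ∈ c.target :=
        continuousAt_snd.eventually ((isOpen_extChartAt_target (I := J) z).mem_nhds hcz)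
      filter_upwards [h2, h1.eventually (hker t ht)] with y hy hk w
      rw [hcurl y hy hk.1, htime y hy]
      exact hk.2 _
  have hconst : curl a (1, c z) (0, md J 𝓘(ℝ, F) c z v) (0, md J 𝓘(ℝ, F) c z w) =
      curl a (0, c z) (0, md J 𝓘(ℝ, F) c z v) (0, md J 𝓘(ℝ, F) c z w) := by
    refine constant_of_has_deriv_right_zero (a := (0 : ℝ)) (b := 1)
      (f := fun s => curl a (s, c z) (0, md J 𝓘(ℝ, F) c z v) (0, md J 𝓘(ℝ, F) c z w))
      (fun t ht => (hder t ht _ _).continuousAt.continuousWithinAt)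
      (fun t ht => (hder t (Ico_subset_Icc_self ht) _ _).hasDerivWithinAt) 1
      (by simp)
  have hX : ∀ t ∈ Icc (0 : ℝ) 1, FormSmoothAt J' Xi (Gh (t, c z)) := fun t ht => by
    change FormSmoothAt J' Xi (G (i (t, c z)))
    rw [hbase]
    exact hXi t ht
  have hGb : ∀ t, Gh (t, c z) = G (t, z) := fun t => congrArg G (hbase t)
  rw [hcurl (1, c z) hcz (hX 1 (by simp)), hcurl (0, c z) hcz (hX 0 (by simp)), hslice', hslice',
    hslice', hslice', hGb, hGb] at hconst
  exact hconst

end Invariance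

/-! ### Smooth vector fields, duality with one-forms, and flows near compact sets. -/

section VectorFields

variable {F : Type*} [NormedAddCommGroup F] [NormedSpace ℝ F]
  {K : Type*} [TopologicalSpace K] {J : ModelWithCorners ℝ F K}
  {N : Type*} [TopologicalSpace N] [ChartedSpace K N] [IsManifold J ∞ N] [J.Boundaryless]

/-- The coordinate expression of a vector field in the preferred chart at `x₀`. -/
def vfInChart (J : ModelWithCorners ℝ F K) (V : N → F) (x₀ : N) (y : F) : F :=
  md J 𝓘(ℝ, F) (extChartAt J x₀) ((extChartAt J x₀).symm y) (V ((extChartAt J x₀).symm y))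

/-- Smoothness of a vector field at a point. -/
def VFSmoothAt (J : ModelWithCorners ℝ F K) (V : N → F) (z : N) : Prop :=
  ContDiffAt ℝ ∞ (vfInChart J V z) (extChartAt J z z)

lemma contMDiffAt_of_comp_chart {E : Type*} [NormedAddCommGroup E] [NormedSpace ℝ E] {f : N → E}
    {g : F → E} {z : N} (hg : ContDiffAt ℝ ∞ g (extChartAt J z z))
    (h : ∀ x ∈ (extChartAt J z).source, f x = g (extChartAt J z x)) :
    ContMDiffAt J 𝓘(ℝ, E) ∞ f z :=
  (hg.contMDiffAt.comp z contMDiffAt_extChartAt).congr_of_eventuallyEq (by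
    filter_upwards [(isOpen_extChartAt_source (I := J) z).mem_nhds
      (mem_extChartAt_source (I := J) z)] with x hx
    exact h x hx)

lemma VFSmoothAt.contMDiffAt {V : N → F} {z : N} (hV : VFSmoothAt J V z) :
    ContMDiffAt J J.tangent ∞ (fun x => (⟨x, V x⟩ : TangentBundle J N)) z := by
  have h0 := contMDiffAt_section (IB := J) (n := ∞) (F := F) (E := TangentSpace J (M := N))
    (s := V) z
  refine h0.2 (contMDiffAt_of_comp_chart hV fun x hx => ?_)
  have hxc : x ∈ (chartAt K z).source := by rwa [extChartAt_source] at hx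
  have h1 := TangentBundle.continuousLinearMapAt_trivializationAt (I := J) hxc
  have h2 : (trivializationAt F (TangentSpace J) z ⟨x, V x⟩).2 =
      (trivializationAt F (TangentSpace J) z).continuousLinearMapAt ℝ x (V x) := by
    rw [Trivialization.continuousLinearMapAt_apply, Trivialization.coe_linearMapAt_of_mem]
    exact hxc
  refine h2.trans ((congrArg (fun L => L (V x)) h1).trans ?_)
  unfold vfInChart
  rw [(extChartAt J z).left_inv hx]
  rfl

lemma vfInChart_congr {V W : N → F} {z : N} (h : V =ᶠ[𝓝 z] W) :
    vfInChart J V z =ᶠ[𝓝 (extChartAt J z z)] vfInChart J W z := by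
  have h2 := (continuousAt_extChartAt_symm (I := J) z)
  rw [ContinuousAt, extChartAt_to_inv] at h2
  filter_upwards [h2.eventually h] with y hy
  rw [vfInChart, vfInChart, hy]

lemma VFSmoothAt.congr {V W : N → F} {z : N} (hV : VFSmoothAt J V z) (h : W =ᶠ[𝓝 z] V) :
    VFSmoothAt J W z := ContDiffAt.congr_of_eventuallyEq hV (vfInChart_congr h)

lemma VFSmoothAt.smul {V : N → F} {f : N → ℝ} {z : N} (hV : VFSmoothAt J V z)
    (hf : ContMDiffAt J 𝓘(ℝ, ℝ) ∞ f z) : VFSmoothAt J (fun x => f x • V x) z := by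
  have : vfInChart J (fun x => f x • V x) z
      = fun y => f ((extChartAt J z).symm y) • vfInChart J V z y := by
    funext y
    exact map_smul _ _ _
  unfold VFSmoothAt
  rw [this]
  exact (contDiffAt_inChart hf).smul hV

lemma VFSmoothAt.zero (z : N) : VFSmoothAt J (fun _ => (0 : F)) z := by
  have : vfInChart J (fun _ : N => (0 : F)) z = fun _ => 0 := by
    funext y
    exact map_zero _
  unfold VFSmoothAt
  rw [this]
  exact contDiffAt_const

lemma FormSmoothAt.apply {lam : N → F →L[ℝ] ℝ} {V : N → F} {z : N} (hl : FormSmoothAt J lam z)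
    (hV : VFSmoothAt J V z) : ContMDiffAt J 𝓘(ℝ, ℝ) ∞ (fun x => lam x (V x)) z := by
  refine contMDiffAt_of_comp_chart (ContDiffAt.clm_apply hl hV) fun x hx => ?_
  simp only [formInChart, vfInChart, ContinuousLinearMap.comp_apply]
  rw [(extChartAt J z).left_inv hx, md_symm_md hx]

lemma exists_dual_of_nondegenerate [FiniteDimensional ℝ F] {B : F →L[ℝ] F →L[ℝ] ℝ}
    (hB : ∀ v, (∀ w, B v w = 0) → v = 0) : ∃ e : F ≃L[ℝ] (F →L[ℝ] ℝ), (e : F →L[ℝ] _) = B := by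
  have hi : Function.Injective B.toLinearMap := by
    refine (injective_iff_map_eq_zero _).2 fun v hv => hB v fun w => ?_
    exact congrArg (fun L : F →L[ℝ] ℝ => L w) hv
  have hd : Module.finrank ℝ F = Module.finrank ℝ (F →L[ℝ] ℝ) := by
    rw [← (LinearMap.toContinuousLinearMap (𝕜 := ℝ) (E := F) (F' := ℝ)).finrank_eq]
    exact (Subspace.dual_finrank_eq (K := ℝ) (V := F)).symm
  refine ⟨(LinearEquiv.ofInjectiveOfFinrankEq B.toLinearMap hi hd).toContinuousLinearEquiv, ?_⟩
  ext v w
  rfl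

set_option synthInstance.maxHeartbeats 400000 in
/-- The bilinear form `dΞ + β ⊗ β` in the chart at `x₀`. -/
lemma exists_bilin_inChart {Xi be : N → F →L[ℝ] ℝ} {x₀ : N}
    (hX : ∀ᶠ x in 𝓝 x₀, FormSmoothAt J Xi x) (hb : FormSmoothAt J be x₀) :
    ∃ Bh : F → F →L[ℝ] F →L[ℝ] ℝ, ContDiffAt ℝ ∞ Bh (extChartAt J x₀ x₀) ∧
      ∀ᶠ x in 𝓝 x₀, ∀ v w, extd J Xi x v w + be x v * be x w =
        Bh (extChartAt J x₀ x) (md J 𝓘(ℝ, F) (extChartAt J x₀) x v)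
          (md J 𝓘(ℝ, F) (extChartAt J x₀) x w) := by
  let a := formInChart J Xi x₀
  let b := formInChart J be x₀
  have hX0 : ContDiffAt ℝ ∞ a (extChartAt J x₀ x₀) := hX.self_of_nhds
  refine ⟨fun y => fderiv ℝ a y - (fderiv ℝ a y).flip + (b y).smulRight (b y), ?_, ?_⟩
  · have h1 : ContDiffAt ℝ ∞ (fderiv ℝ a) (extChartAt J x₀ x₀) :=
      hX0.fderiv_right (m := ∞) (by norm_num)
    let L : (F →L[ℝ] F →L[ℝ] ℝ) →L[ℝ] (F →L[ℝ] F →L[ℝ] ℝ) :=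
      (ContinuousLinearMap.flipₗᵢ ℝ F F ℝ).toContinuousLinearEquiv.toContinuousLinearMap
    have h2 : ContDiffAt ℝ ∞ (L ∘ fderiv ℝ a) (extChartAt J x₀ x₀) :=
      ContDiffAt.continuousLinearMap_comp (F := F →L[ℝ] F →L[ℝ] ℝ) (G := F →L[ℝ] F →L[ℝ] ℝ) L h1
    exact (h1.sub h2).add (ContDiffAt.smulRight hb hb)
  · filter_upwards [hX, (isOpen_extChartAt_source (I := J) x₀).mem_nhds
      (mem_extChartAt_source (I := J) x₀)] with x hx hxs v w
    rw [extd_eq_curl hxs hx]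
    have h3 : ∀ v, be x v = b (extChartAt J x₀ x) (md J 𝓘(ℝ, F) (extChartAt J x₀) x v) := by
      intro v
      simp only [b, formInChart, ContinuousLinearMap.comp_apply]
      rw [(extChartAt J x₀).left_inv hxs, md_symm_md hxs]
    rw [h3, h3]
    rfl

/-- Nondegeneracy of `dΞ + β ⊗ β` is an open condition, and the vector fields dual to smooth
one-forms are smooth. -/
theorem dual_vf [FiniteDimensional ℝ F] {Xi be : N → F →L[ℝ] ℝ} {x₀ : N}
    (hX : ∀ᶠ x in 𝓝 x₀, FormSmoothAt J Xi x) (hb : FormSmoothAt J be x₀)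
    (hB : ∀ v, (∀ w, extd J Xi x₀ v w + be x₀ v * be x₀ w = 0) → v = 0) :
    (∀ᶠ x in 𝓝 x₀, (∀ v, (∀ w, extd J Xi x v w + be x v * be x w = 0) → v = 0) ∧
      ∀ l : F →L[ℝ] ℝ, ∃ v, ∀ w, extd J Xi x v w + be x v * be x w = l w) ∧
    ∀ (ga : N → F →L[ℝ] ℝ) (V : N → F), FormSmoothAt J ga x₀ →
      (∀ᶠ x in 𝓝 x₀, ∀ w, extd J Xi x (V x) w + be x (V x) * be x w = ga x w) →
      VFSmoothAt J V x₀ := by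
  obtain ⟨Bh, hBh, hev⟩ := exists_bilin_inChart hX hb
  set c := extChartAt J x₀ with hc
  have hs : x₀ ∈ c.source := mem_extChartAt_source (I := J) x₀
  have hct : c x₀ ∈ c.target := c.map_source hs
  have hsurj : ∀ x ∈ c.source, ∀ v : F, md J 𝓘(ℝ, F) c x (md 𝓘(ℝ, F) J c.symm (c x) v) = v := by
    intro x hx v
    have := md_md_symm (J := J) (c.map_source hx) v
    rwa [← hc, c.left_inv hx] at this
  obtain ⟨e, he⟩ := exists_dual_of_nondegenerate (B := Bh (c x₀)) (by
    intro v hv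
    have h1 : md 𝓘(ℝ, F) J c.symm (c x₀) v = 0 := by
      refine hB _ fun w => ?_
      rw [hev.self_of_nhds, hsurj x₀ hs]
      exact hv _
    rw [← hsurj x₀ hs v, h1, map_zero])
  have hnear : ∀ᶠ y in 𝓝 (c x₀), ∃ e : F ≃L[ℝ] (F →L[ℝ] ℝ), (e : F →L[ℝ] _) = Bh y := by
    -- Invertible operators form an open set, so the form stays nondegenerate near the base point.
    have h1 : Set.range ((↑) : (F ≃L[ℝ] (F →L[ℝ] ℝ)) → F →L[ℝ] (F →L[ℝ] ℝ)) ∈ 𝓝 (Bh (c x₀)) := by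
      rw [← he]
      exact ContinuousLinearEquiv.nhds e
    exact hBh.continuousAt.eventually h1
  have hcc : ContinuousAt c x₀ := continuousAt_extChartAt (I := J) x₀
  have hsrc : c.source ∈ 𝓝 x₀ := (isOpen_extChartAt_source (I := J) x₀).mem_nhds hs
  refine ⟨?_, fun ga V hga hV => ?_⟩
  · filter_upwards [hev, hcc.eventually hnear, hsrc] with x hx he hxs
    obtain ⟨e, he⟩ := he
    refine ⟨fun v hv => ?_, fun l => ?_⟩
    · have h1 : e (md J 𝓘(ℝ, F) c x v) = 0 := by
        ext u
        have h2 := hv (md 𝓘(ℝ, F) J c.symm (c x) u)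
        rw [hx, hsurj x hxs, ← he] at h2
        exact h2
      rw [map_eq_zero_iff _ e.injective] at h1
      rw [← md_symm_md hxs v, ← hc, h1, map_zero]
    refine ⟨md 𝓘(ℝ, F) J c.symm (c x) (e.symm (l.comp (md 𝓘(ℝ, F) J c.symm (c x)))), fun w => ?_⟩
    rw [hx, hsurj x hxs, ← he]
    simp only [ContinuousLinearEquiv.coe_coe, ContinuousLinearEquiv.apply_symm_apply,
      ContinuousLinearMap.comp_apply]
    rw [hc, md_symm_md hxs]
  · have h1 : ContDiffAt ℝ ∞ (fun y => ContinuousLinearMap.inverse (Bh y) (formInChart J ga x₀ y))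
        (c x₀) := by
      refine ContDiffAt.clm_apply ?_ hga
      have h2 : ContDiffAt ℝ ∞ ContinuousLinearMap.inverse (Bh (c x₀)) := by
        rw [← he]
        exact contDiffAt_map_inverse e
      exact h2.comp _ hBh
    refine ContDiffAt.congr_of_eventuallyEq h1 ?_
    have hcs : Tendsto c.symm (𝓝 (c x₀)) (𝓝 x₀) := by
      have := continuousAt_extChartAt_symm (I := J) x₀
      rwa [ContinuousAt, extChartAt_to_inv] at this
    filter_upwards [hnear, hcs.eventually (hev.and hV),
      (isOpen_extChartAt_target (I := J) x₀).mem_nhds hct] with y hy hy2 hyt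
    obtain ⟨e', he'⟩ := hy
    rw [← he', ContinuousLinearMap.inverse_equiv]
    have h3 : e' (vfInChart J V x₀ y) = formInChart J ga x₀ y := by
      ext u
      have h4 := hy2.2 (md 𝓘(ℝ, F) J c.symm y u)
      rw [hy2.1, c.right_inv hyt, hc, md_md_symm hyt, ← hc, ← he'] at h4
      exact h4
    rw [← h3]
    exact (e'.symm_apply_apply _).symm

/-- A vector field which is smooth near a compact set agrees near that set with one that has a
smooth flow. -/
theorem exists_flow_near [FiniteDimensional ℝ F] [T2Space N] [SigmaCompactSpace N] {C : Set N}
    (hC : IsCompact C) (V : N → F) (hV : ∀ᶠ x in 𝓝ˢ C, VFSmoothAt J V x) :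
    ∃ (V' : N → F) (φ : ℝ × N → N), (∀ᶠ x in 𝓝ˢ C, V' x = V x) ∧ (∀ x, VFSmoothAt J V' x) ∧
      ContMDiff (𝓘(ℝ, ℝ).prod J) J ∞ φ ∧ (∀ x, φ (0, x) = x) ∧
      (∀ s t x, φ (s + t, x) = φ (s, φ (t, x))) ∧
      ∀ x, IsMIntegralCurve (I := J) (fun t => φ (t, x)) V' := by
  have : LocallyCompactSpace K := J.locallyCompactSpace
  have : LocallyCompactSpace N := ChartedSpace.locallyCompactSpace K N
  obtain ⟨U, hUo, hCU, hU⟩ := eventually_nhdsSet_iff_exists.1 hV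
  obtain ⟨L, hL, hCL, hLU⟩ := exists_compact_between hC hUo hCU
  obtain ⟨χ, hχ0, hχ1, -⟩ := exists_contMDiffMap_zero_one_nhds_of_isClosed J (n := ⊤)
    (s := (interior L)ᶜ) (t := C) isOpen_interior.isClosed_compl hC.isClosed
    (disjoint_compl_left_iff_subset.2 hCL)
  have hsm : ∀ x, VFSmoothAt J (fun x => χ x • V x) x := by
    intro x
    by_cases hx : x ∈ interior L
    · exact (hU x (hLU (interior_subset hx))).smul χ.contMDiff.contMDiffAt
    · have h1 : ∀ᶠ y in 𝓝 x, χ y = 0 := eventually_nhdsSet_iff_forall.1 hχ0 x hx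
      refine (VFSmoothAt.zero x).congr ?_
      filter_upwards [h1] with y hy
      rw [hy, zero_smul]
  obtain ⟨φ, h1, h2, h3, h4⟩ := exists_smooth_flow (J := J) (fun x => χ x • V x)
    (fun x => (hsm x).contMDiffAt) L hL (fun x hx => by
      have : χ x = 0 := hχ0.self_of_nhdsSet x fun h => hx (interior_subset h)
      rw [this]
      exact zero_smul ℝ (V x))
  refine ⟨_, φ, ?_, hsm, h1, h2, h3, h4⟩
  filter_upwards [hχ1] with x hx
  rw [hx, one_smul]

end VectorFields

/-! ### Differentials on products, and functions along flow lines. -/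

section FlowLemmas

variable {F : Type*} [NormedAddCommGroup F] [NormedSpace ℝ F]
  {K : Type*} [TopologicalSpace K] {J : ModelWithCorners ℝ F K}
  {N : Type*} [TopologicalSpace N] [ChartedSpace K N] [IsManifold J ∞ N] [J.Boundaryless]
  {F' : Type*} [NormedAddCommGroup F'] [NormedSpace ℝ F']
  {K' : Type*} [TopologicalSpace K'] {J' : ModelWithCorners ℝ F' K'}
  {N' : Type*} [TopologicalSpace N'] [ChartedSpace K' N'] [IsManifold J' ∞ N'] [J'.Boundaryless]
  {F'' : Type*} [NormedAddCommGroup F''] [NormedSpace ℝ F'']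
  {K'' : Type*} [TopologicalSpace K''] {J'' : ModelWithCorners ℝ F'' K''}
  {N'' : Type*} [TopologicalSpace N''] [ChartedSpace K'' N'']

lemma md_const (c : N') (z : N) : md J J' (fun _ : N => c) z = 0 := mfderiv_const

lemma md_fst (x : N × N') (v : F × F') : md (J.prod J') J Prod.fst x v = v.1 :=
  congrArg (fun L : F × F' →L[ℝ] F => L v) (mfderiv_fst (I := J) (I' := J') (x := x))

lemma md_snd (x : N × N') (v : F × F') : md (J.prod J') J' Prod.snd x v = v.2 :=
  congrArg (fun L : F × F' →L[ℝ] F' => L v) (mfderiv_snd (I := J) (I' := J') (x := x))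

lemma md_prodMk {f : N → N'} {g : N → N''} {z : N} (hf : MDifferentiableAt J J' f z)
    (hg : MDifferentiableAt J J'' g z) (v : F) :
    md J (J'.prod J'') (fun x => (f x, g x)) z v = (md J J' f z v, md J J'' g z v) :=
  congrArg (fun L : F →L[ℝ] F' × F'' => L v) (mfderiv_prodMk hf hg)

lemma mdiff_id (z : N) : MDifferentiableAt J J (fun x : N => x) z := mdifferentiableAt_id

lemma md_id_apply (z : N) (v : F) : md J J (fun x : N => x) z v = v :=
  congrArg (fun L : F →L[ℝ] F => L v) (md_id z)

lemma md_const_apply (c : N') (z : N) (v : F) : md J J' (fun _ : N => c) z v = 0 :=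
  congrArg (fun L : F →L[ℝ] F' => L v) (md_const c z)

lemma md_comp_apply {g : N' → N''} {f : N → N'} (z : N) (hg : MDifferentiableAt J' J'' g (f z))
    (hf : MDifferentiableAt J J' f z) (v : F) :
    md J J'' (fun x => g (f x)) z v = md J' J'' g (f z) (md J J' f z v) :=
  congrArg (fun L => L v) (md_comp z hg hf)

/-- The differential of a map on a product with `ℝ`. -/
lemma md_prod_line {G : ℝ × N → N'} {p : ℝ × N}
    (hG : MDifferentiableAt (𝓘(ℝ, ℝ).prod J) J' G p) (r : ℝ) (v : F) :
    md (𝓘(ℝ, ℝ).prod J) J' G p (r, v) =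
      r • md 𝓘(ℝ, ℝ) J' (fun s => G (s, p.2)) p.1 1 + md J J' (fun x => G (p.1, x)) p.2 v := by
  have h1 := md_comp_apply (J := 𝓘(ℝ, ℝ)) (J' := 𝓘(ℝ, ℝ).prod J) (J'' := J') (g := G)
    (f := fun s : ℝ => (s, p.2)) p.1 hG ((mdiff_id _).prodMk mdifferentiableAt_const) 1
  have h2 := md_comp_apply (J := J) (J' := 𝓘(ℝ, ℝ).prod J) (J'' := J') (g := G)
    (f := fun x : N => (p.1, x)) p.2 hG (mdifferentiableAt_const.prodMk (mdiff_id _)) v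
  rw [h1, h2, md_prodMk (mdiff_id _) mdifferentiableAt_const,
    md_prodMk mdifferentiableAt_const (mdiff_id _), md_const_apply, md_const_apply,
    md_id_apply, md_id_apply]
  rw [← map_smul, ← map_add]
  congr 1
  simp

lemma IsMIntegralCurve.md_eq {V : N → F} {γ : ℝ → N}
    (h : IsMIntegralCurve (I := J) γ V) (t : ℝ) :
    MDifferentiableAt 𝓘(ℝ, ℝ) J γ t ∧ md 𝓘(ℝ, ℝ) J γ t 1 = V (γ t) := by
  refine ⟨(h t).mdifferentiableAt, ?_⟩
  refine (congrArg (fun L : ℝ →L[ℝ] F => L 1) (h t).mfderiv).trans ?_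
  exact one_smul ℝ (V (γ t))

/-- The tube lemma: compactness of [0, 1] passes from one orbit segment inside C to all segments
with nearby starting point and duration. -/
lemma near_segment {X : Type*} [TopologicalSpace X] {φ : ℝ × X → X} (hφ : Continuous φ) {C : Set X}
    {P : X → Prop} (hP : ∀ᶠ x in 𝓝ˢ C, P x) {s₀ : ℝ} {x₀ : X}
    (h : ∀ σ ∈ Icc (0 : ℝ) 1, φ (σ * s₀, x₀) ∈ C) :
    ∀ᶠ p in 𝓝 (s₀, x₀), ∀ σ ∈ Icc (0 : ℝ) 1, P (φ (σ * p.1, p.2)) := by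
  refine isCompact_Icc.eventually_forall_of_forall_eventually fun σ hσ => ?_
  have hc : Continuous fun q : (ℝ × X) × ℝ => φ (q.2 * q.1.1, q.1.2) := by fun_prop
  exact hc.continuousAt.eventually (eventually_nhdsSet_iff_forall.1 hP _ (h σ hσ))

/-- A function with unit derivative along a vector field grows at unit speed along its flow. -/
lemma apply_flow_eq_add {V : N → F} {f : N → ℝ} {φ : ℝ × N → N} {x : N} {s : ℝ}
    (hφ0 : φ (0, x) = x) (hint : IsMIntegralCurve (I := J) (fun t => φ (t, x)) V)
    (h : ∀ σ ∈ Icc (0 : ℝ) 1, MDifferentiableAt J 𝓘(ℝ, ℝ) f (φ (σ * s, x)) ∧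
      md J 𝓘(ℝ, ℝ) f (φ (σ * s, x)) (V (φ (σ * s, x))) = 1) {σ : ℝ} (hσ : σ ∈ Icc (0 : ℝ) 1) :
    f (φ (σ * s, x)) = f x + σ * s := by
  have hd : ∀ σ ∈ Icc (0 : ℝ) 1, HasDerivAt (fun σ => f (φ (σ * s, x)) - σ * s) 0 σ := by
    intro σ hσ
    obtain ⟨h1, h2⟩ := h σ hσ
    obtain ⟨h3, h4⟩ := hint.md_eq (J := J) (σ * s)
    have h5 := md_comp_apply (J := 𝓘(ℝ, ℝ)) (J' := J) (J'' := 𝓘(ℝ, ℝ)) (g := f)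
      (f := fun t => φ (t, x)) (σ * s) h1 h3 1
    rw [h4, h2, md_eq_fderiv] at h5
    have h6 : DifferentiableAt ℝ (fun t => f (φ (t, x))) (σ * s) :=
      mdifferentiableAt_iff_differentiableAt.1
        (MDifferentiableAt.comp (g := f) (f := fun t => φ (t, x)) (σ * s) h1 h3)
    have h7 : HasDerivAt (fun t => f (φ (t, x))) 1 (σ * s) := by
      have := h6.hasDerivAt
      rwa [← fderiv_apply_one_eq_deriv, h5] at this
    have h8 : HasDerivAt (fun σ : ℝ => σ * s) s σ := by simpa using (hasDerivAt_id σ).mul_const s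
    have h10 : HasDerivAt (fun σ => f (φ (σ * s, x))) (1 * s) σ :=
      HasDerivAt.comp (h₂ := fun t => f (φ (t, x))) (h := fun σ => σ * s) σ h7 h8
    have h9 : HasDerivAt (fun σ => f (φ (σ * s, x)) - σ * s) (1 * s - s) σ := h10.fun_sub h8
    rwa [one_mul, sub_self] at h9
  have hc := constant_of_has_deriv_right_zero (a := (0 : ℝ)) (b := 1)
    (fun t ht => (hd t ht).continuousAt.continuousWithinAt)
    (fun t ht => (hd t (Ico_subset_Icc_self ht)).hasDerivWithinAt) σ hσ
  simp only [zero_mul, hφ0, sub_zero] at hc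
  linarith

lemma apply_flow_eq_add_near {V V' : N → F} {f : N → ℝ} {φ : ℝ × N → N} {C : Set N}
    (hφ : Continuous φ) (hφ0 : ∀ x, φ (0, x) = x)
    (hint : ∀ x, IsMIntegralCurve (I := J) (fun t => φ (t, x)) V')
    (hV : ∀ᶠ x in 𝓝ˢ C, V' x = V x)
    (hf : ∀ᶠ x in 𝓝ˢ C, MDifferentiableAt J 𝓘(ℝ, ℝ) f x ∧ md J 𝓘(ℝ, ℝ) f x (V x) = 1)
    {s₀ : ℝ} {x₀ : N} (h : ∀ σ ∈ Icc (0 : ℝ) 1, φ (σ * s₀, x₀) ∈ C) :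
    ∀ᶠ p in 𝓝 (s₀, x₀), ∀ σ ∈ Icc (0 : ℝ) 1, f (φ (σ * p.1, p.2)) = f p.2 + σ * p.1 := by
  filter_upwards [near_segment hφ (hV.and hf) h] with p hp σ hσ
  refine apply_flow_eq_add (J := J) (hφ0 _) (hint _) (fun τ hτ => ?_) hσ
  obtain ⟨h1, h2, h3⟩ := hp τ hτ
  rw [h1]
  exact ⟨h2, h3⟩

end FlowLemmas

/-! ### Moser's argument along a compact set. -/

section Moser

variable {F : Type*} [NormedAddCommGroup F] [NormedSpace ℝ F] [FiniteDimensional ℝ F]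
  {K : Type*} [TopologicalSpace K] {J : ModelWithCorners ℝ F K}
  {N : Type*} [TopologicalSpace N] [ChartedSpace K N] [IsManifold J ∞ N] [J.Boundaryless]

/-- The path of forms `ξ + s α`, as a one-form on `N × ℝ`. -/
def pathForm (J : ModelWithCorners ℝ F K) (xi al : N → F →L[ℝ] ℝ) : N × ℝ → F × ℝ →L[ℝ] ℝ :=
  fun x => formPullback (J.prod 𝓘(ℝ, ℝ)) J Prod.fst xi x +
    x.2 • formPullback (J.prod 𝓘(ℝ, ℝ)) J Prod.fst al x

lemma pathForm_smooth {xi al : N → F →L[ℝ] ℝ} {x : N × ℝ} (hxi : FormSmoothAt J xi x.1)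
    (hal : FormSmoothAt J al x.1) : FormSmoothAt (J.prod 𝓘(ℝ, ℝ)) (pathForm J xi al) x :=
  (hxi.pullback contMDiffAt_fst).add ((hal.pullback contMDiffAt_fst).smul contMDiffAt_snd)

/-- Here d(ξ + sα) = dξ + ds ∧ α + s dα on N × ℝ. A vector (v, 1) in its kernel satisfies d(ξ +
sα)(v, ·) = -α on N, which is Moser's equation, so the isotopy is the flow of an autonomous field on
N × ℝ. -/
lemma extd_pathForm {xi al : N → F →L[ℝ] ℝ} {x : N × ℝ} (hxi : FormSmoothAt J xi x.1)
    (hal : FormSmoothAt J al x.1) (v w : F × ℝ) :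
    extd (J.prod 𝓘(ℝ, ℝ)) (pathForm J xi al) x v w = extd J xi x.1 v.1 w.1 +
      (v.2 * al x.1 w.1 - w.2 * al x.1 v.1 + x.2 * extd J al x.1 v.1 w.1) := by
  have h1 := hxi.pullback (J := J.prod 𝓘(ℝ, ℝ)) (f := (Prod.fst : N × ℝ → N)) (z := x) contMDiffAt_fst
  have h2 := hal.pullback (J := J.prod 𝓘(ℝ, ℝ)) (f := (Prod.fst : N × ℝ → N)) (z := x) contMDiffAt_fst
  have h3 : ContMDiffAt (J.prod 𝓘(ℝ, ℝ)) 𝓘(ℝ, ℝ) ∞ (Prod.snd : N × ℝ → ℝ) x := contMDiffAt_snd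
  unfold pathForm
  rw [extd_add h1 (h2.smul h3), extd_smul h2 h3, extd_pullback hxi contMDiffAt_fst,
    extd_pullback hal contMDiffAt_fst]
  simp only [formPullback, ContinuousLinearMap.comp_apply, md_fst, md_snd]

lemma eventually_fst_nhdsSet {X Y : Type*} [TopologicalSpace X] [TopologicalSpace Y] {S : Set X}
    {T : Set Y} {P : X → Prop} (h : ∀ᶠ x in 𝓝ˢ S, P x) : ∀ᶠ p in 𝓝ˢ (S ×ˢ T), P p.1 := by
  rw [eventually_nhdsSet_iff_forall] at h ⊢
  exact fun p hp => continuousAt_fst.eventually (h p.1 hp.1)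

/-- The vector field spanning the kernel of `d(ξ + s α)`, normalised by `ds = 1`. -/
lemma exists_moser_vf {S : Set N} {xi al : N → F →L[ℝ] ℝ}
    (hxi : ∀ᶠ x in 𝓝ˢ S, FormSmoothAt J xi x) (hal : ∀ᶠ x in 𝓝ˢ S, FormSmoothAt J al x)
    (hnd : ∀ x ∈ S, ∀ v, (∀ w, extd J xi x v w = 0) → v = 0)
    (hal0 : ∀ x ∈ S, al x = 0) (hdal : ∀ x ∈ S, ∀ v w, extd J al x v w = 0) :
    ∃ V : N × ℝ → F × ℝ, (∀ x ∈ S ×ˢ (univ : Set ℝ), V x = (0, 1)) ∧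
      ∀ᶠ x in 𝓝ˢ (S ×ˢ (univ : Set ℝ)), VFSmoothAt (J.prod 𝓘(ℝ, ℝ)) V x ∧ (V x).2 = 1 ∧
        ∀ w, extd (J.prod 𝓘(ℝ, ℝ)) (pathForm J xi al) x (V x) w = 0 := by
  classical
  set Xi := pathForm J xi al with hXi
  -- Over S the vector (0, 1) spans the kernel of the form; adding ds ⊗ ds makes it nondegenerate
  -- there, hence nearby. The kernel field is then found as the field dual to ds.
  let be : N × ℝ → F × ℝ →L[ℝ] ℝ := md (J.prod 𝓘(ℝ, ℝ)) 𝓘(ℝ, ℝ) Prod.snd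
  have hbe : ∀ x v, be x v = v.2 := fun x v => md_snd x v
  have hbs : ∀ x, FormSmoothAt (J.prod 𝓘(ℝ, ℝ)) be x := fun x =>
    (FormSmoothAt.md (f := (Prod.snd : N × ℝ → ℝ)) contMDiffAt_snd).1
  have hsm : ∀ᶠ x in 𝓝ˢ (S ×ˢ (univ : Set ℝ)), FormSmoothAt J xi x.1 ∧ FormSmoothAt J al x.1 :=
    eventually_fst_nhdsSet (hxi.and hal)
  have hXs : ∀ᶠ x in 𝓝ˢ (S ×ˢ (univ : Set ℝ)), FormSmoothAt (J.prod 𝓘(ℝ, ℝ)) Xi x :=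
    hsm.mono fun x hx => pathForm_smooth hx.1 hx.2
  have hB : ∀ x ∈ S ×ˢ (univ : Set ℝ), ∀ v w,
      extd (J.prod 𝓘(ℝ, ℝ)) Xi x v w + be x v * be x w = extd J xi x.1 v.1 w.1 + v.2 * w.2 := by
    intro x hx v w
    have h1 := hsm.self_of_nhdsSet x hx
    rw [hXi, extd_pathForm h1.1 h1.2, hal0 x.1 hx.1, hdal x.1 hx.1, hbe, hbe]
    simp
  have hBn : ∀ x ∈ S ×ˢ (univ : Set ℝ), ∀ v,
      (∀ w, extd (J.prod 𝓘(ℝ, ℝ)) Xi x v w + be x v * be x w = 0) → v = 0 := by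
    intro x hx v hv
    have h1 : v.1 = 0 := hnd x.1 hx.1 _ fun w => by
      have := hv (w, 0)
      rw [hB x hx] at this
      simpa using this
    have h2 : v.2 = 0 := by
      have := hv (0, 1)
      rw [hB x hx, h1] at this
      have h0 : extd J xi x.1 0 0 = 0 := extd_self _ _ _
      simp only [h0] at this
      simpa using this
    exact Prod.ext h1 h2
  have hexx : ∀ x, ∃ v : F × ℝ,
    ((∃ v, ∀ w, extd (J.prod 𝓘(ℝ, ℝ)) Xi x v w + be x v * be x w = be x w) →
      ∀ w, extd (J.prod 𝓘(ℝ, ℝ)) Xi x v w + be x v * be x w = be x w) := by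
    intro x
    by_cases h : ∃ v, ∀ w, extd (J.prod 𝓘(ℝ, ℝ)) Xi x v w + be x v * be x w = be x w
    · obtain ⟨v, hv⟩ := h
      exact ⟨v, fun _ => hv⟩
    · exact ⟨0, fun h' => (h h').elim⟩
  choose V hV using hexx
  have hev : ∀ᶠ x in 𝓝ˢ (S ×ˢ (univ : Set ℝ)),
      (∀ v, (∀ w, extd (J.prod 𝓘(ℝ, ℝ)) Xi x v w + be x v * be x w = 0) → v = 0) ∧
      ∀ w, extd (J.prod 𝓘(ℝ, ℝ)) Xi x (V x) w + be x (V x) * be x w = be x w := by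
    rw [eventually_nhdsSet_iff_forall] at hXs ⊢
    intro x hx
    exact (dual_vf (hXs x hx) (hbs x) (hBn x hx)).1.mono fun y hy => ⟨hy.1, hV y (hy.2 (be y))⟩
  have hVs : ∀ᶠ x in 𝓝ˢ (S ×ˢ (univ : Set ℝ)), VFSmoothAt (J.prod 𝓘(ℝ, ℝ)) V x := by
    have h1 := hev.eventually_nhdsSet
    have h2 := hXs.eventually_nhdsSet
    filter_upwards [h1, h2] with x h1 h2
    exact (dual_vf h2 (hbs x) h1.self_of_nhds.1).2 be V (hbs x) (h1.mono fun y hy => hy.2)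
  have hVS : ∀ x ∈ S ×ˢ (univ : Set ℝ), V x = (0, 1) := by
    intro x hx
    have h1 := (hev.self_of_nhdsSet x hx).2
    rw [← sub_eq_zero]
    refine hBn x hx _ fun w => ?_
    have h2 := h1 w
    rw [hB x hx] at h2 ⊢
    rw [hbe] at h2
    simp only [Prod.fst_sub, Prod.snd_sub, sub_zero]
    linarith
  refine ⟨V, hVS, ?_⟩
  have hne : ∀ᶠ x in 𝓝ˢ (S ×ˢ (univ : Set ℝ)), (V x).2 ≠ 0 := by
    rw [eventually_nhdsSet_iff_forall] at hVs ⊢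
    intro x hx
    have h1 : ContinuousAt (fun x => be x (V x)) x :=
      ((hbs x).apply (hVs x hx).self_of_nhds).continuousAt
    have h2 : be x (V x) ≠ 0 := by
      rw [hbe, hVS x hx]
      exact one_ne_zero
    filter_upwards [h1.eventually_ne h2] with y hy
    rwa [hbe] at hy
  filter_upwards [hev, hVs, hne] with x h1 h2 h3
  -- Inserting V into its own defining equation gives (ds V)² = ds V. Since ds V does not vanish
  -- near S it equals 1, and the equation reduces to i_V d(ξ + sα) = 0.
  have h4 : (V x).2 = 1 := by
    have := h1.2 (V x)
    rw [extd_self, hbe, zero_add] at this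
    exact mul_right_cancel₀ h3 (by rw [this, one_mul])
  refine ⟨h2, h4, fun w => ?_⟩
  have := h1.2 w
  rw [hbe x (V x), h4] at this
  linarith

/-- Moser's argument: if `α` and `dα` vanish along the compact set `S`, then the forms `dξ` and
`d(ξ + α)` are related by a diffeomorphism near `S` which fixes `S`. -/
theorem exists_moser_diffeo [T2Space N] [SigmaCompactSpace N] {S : Set N} (hS : IsCompact S)
    {xi al : N → F →L[ℝ] ℝ}
    (hxi : ∀ᶠ x in 𝓝ˢ S, FormSmoothAt J xi x) (hal : ∀ᶠ x in 𝓝ˢ S, FormSmoothAt J al x)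
    (hnd : ∀ x ∈ S, ∀ v, (∀ w, extd J xi x v w = 0) → v = 0)
    (hal0 : ∀ x ∈ S, al x = 0) (hdal : ∀ x ∈ S, ∀ v w, extd J al x v w = 0) :
    ∃ θ θi : N → N, ContMDiff J J ∞ θ ∧ ContMDiff J J ∞ θi ∧ (∀ x ∈ S, θ x = x) ∧
      (∀ x ∈ S, θi x = x) ∧
      (∀ᶠ x in 𝓝ˢ S, θi (θ x) = x) ∧ (∀ᶠ x in 𝓝ˢ S, θ (θi x) = x) ∧
      (∀ᶠ x in 𝓝ˢ S, ∀ v w, extd J (fun x => xi x + al x) (θ x) (md J J θ x v) (md J J θ x w) =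
        extd J xi x v w) ∧
      ∀ U ∈ 𝓝ˢ S, ∀ᶠ x in 𝓝ˢ S, x ∉ S → ∃ γ : ℝ → N, Continuous γ ∧ γ 0 = x ∧ γ 1 = θ x ∧
        ∀ s ∈ Icc (0 : ℝ) 1, γ s ∈ U ∧ γ s ∉ S := by
  obtain ⟨V, hVS, hV⟩ := exists_moser_vf hxi hal hnd hal0 hdal
  -- Only s in [0, 1] matters; the longer interval leaves room for uniqueness of integral curves on
  -- an open interval in `hline`.
  set C : Set (N × ℝ) := S ×ˢ Icc (-1 : ℝ) 2 with hCdef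
  have hCu : 𝓝ˢ C ≤ 𝓝ˢ (S ×ˢ (univ : Set ℝ)) := nhdsSet_mono (prod_mono_right (subset_univ _))
  have hCc : IsCompact C := hS.prod isCompact_Icc
  have hVC := hV.filter_mono hCu
  obtain ⟨V', Φ, hVV, hV's, hΦs, hΦ0, hΦa, hΦi⟩ := exists_flow_near (J := J.prod 𝓘(ℝ, ℝ)) hCc V
    (hVC.mono fun x hx => hx.1)
  have hΦc : Continuous Φ := hΦs.continuous
  have hline : ∀ y ∈ S, ∀ c ∈ Ioo (-1 : ℝ) 2, ∀ τ, c + τ ∈ Ioo (-1 : ℝ) 2 →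
      Φ (τ, (y, c)) = (y, c + τ) := by
    intro y hy c hc τ hτ
    have h1 : IsMIntegralCurveOn (I := J.prod 𝓘(ℝ, ℝ)) (fun τ : ℝ => (y, c + τ)) V'
        (Ioo (-1 - c) (2 - c)) := by
      intro τ hτ
      have hm : (y, c + τ) ∈ C := ⟨hy, by constructor <;> linarith [hτ.1, hτ.2]⟩
      have e1 : V' (y, c + τ) = (0, 1) :=
        (hVV.self_of_nhdsSet _ hm).trans (hVS _ ⟨hy, trivial⟩)
      have h2 : HasMFDerivAt 𝓘(ℝ, ℝ) J (fun _ : ℝ => y) τ (0 : ℝ →L[ℝ] F) :=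
        hasMFDerivAt_const y τ
      have h3 : HasMFDerivAt 𝓘(ℝ, ℝ) 𝓘(ℝ, ℝ) (fun τ : ℝ => c + τ) τ
          (ContinuousLinearMap.id ℝ ℝ) :=
        ((hasFDerivAt_id τ).const_add c).hasMFDerivAt
      have h4 := (h2.prodMk h3).hasMFDerivWithinAt (s := Ioo (-1 - c) (2 - c))
      have e2 : (0 : ℝ →L[ℝ] F).prod (ContinuousLinearMap.id ℝ ℝ) =
          ContinuousLinearMap.toSpanSingleton ℝ (V' (y, c + τ)) := by
        ext <;> simp [e1]
      exact (Eq.rec (motive := fun L _ => HasMFDerivWithinAt 𝓘(ℝ, ℝ) (J.prod 𝓘(ℝ, ℝ))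
        (fun τ : ℝ => (y, c + τ)) (Ioo (-1 - c) (2 - c)) τ L) h4 e2)
    have h2 := isMIntegralCurveOn_Ioo_eqOn_of_contMDiff_boundaryless (t₀ := 0)
      (γ := fun τ => Φ (τ, (y, c))) (γ' := fun τ : ℝ => (y, c + τ)) (v := V')
      (I := J.prod 𝓘(ℝ, ℝ)) (a := -1 - c) (b := 2 - c)
      (by constructor <;> linarith [hc.1, hc.2])
      (fun x => ((hV's x).contMDiffAt.of_le (by simp)))
      ((hΦi _).isMIntegralCurveOn _) h1 (by simp [hΦ0])
    exact h2 (by constructor <;> linarith [hτ.1, hτ.2])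
  have hsndV : ∀ᶠ x in 𝓝ˢ C, MDifferentiableAt (J.prod 𝓘(ℝ, ℝ)) 𝓘(ℝ, ℝ) (Prod.snd : N × ℝ → ℝ) x ∧
      md (J.prod 𝓘(ℝ, ℝ)) 𝓘(ℝ, ℝ) Prod.snd x (V x) = 1 := by
    filter_upwards [hVC] with x hx
    exact ⟨mdifferentiableAt_snd, (md_snd x (V x)).trans hx.2.1⟩
  have hseg : ∀ y ∈ S, ∀ σ ∈ Icc (0 : ℝ) 1, Φ (σ * 1, (y, 0)) ∈ C := by
    intro y hy σ hσ
    rw [hline y hy 0 (by norm_num) _ (by constructor <;> linarith [hσ.1, hσ.2])]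
    exact ⟨hy, by constructor <;> linarith [hσ.1, hσ.2]⟩
  have hsegb : ∀ y ∈ S, ∀ σ ∈ Icc (0 : ℝ) 1, Φ (σ * (-1), (y, 1)) ∈ C := by
    intro y hy σ hσ
    rw [hline y hy 1 (by norm_num) _ (by constructor <;> linarith [hσ.1, hσ.2])]
    exact ⟨hy, by constructor <;> linarith [hσ.1, hσ.2]⟩
  have hin : ∀ c : ℝ, Continuous fun x : N => ((1 : ℝ), (x, c)) := fun c => by fun_prop
  have hin' : ∀ c : ℝ, Continuous fun x : N => ((-1 : ℝ), (x, c)) := fun c => by fun_prop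
  have hgood : ∀ U ∈ 𝓝ˢ C, ∀ᶠ x in 𝓝ˢ S, ∀ σ ∈ Icc (0 : ℝ) 1, Φ (σ, (x, 0)) ∈ U := by
    intro U hU
    rw [eventually_nhdsSet_iff_forall]
    intro y hy
    have h1 := near_segment hΦc (P := fun x => x ∈ U) hU (hseg y hy)
    filter_upwards [(hin 0).continuousAt.eventually h1] with x hx σ hσ
    simpa using hx σ hσ
  have hsnd : ∀ᶠ x in 𝓝ˢ S, ∀ σ ∈ Icc (0 : ℝ) 1, (Φ (σ, (x, 0))).2 = σ := by
    rw [eventually_nhdsSet_iff_forall]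
    intro y hy
    have h1 := apply_flow_eq_add_near (J := J.prod 𝓘(ℝ, ℝ)) (f := Prod.snd) hΦc hΦ0 hΦi hVV hsndV
      (hseg y hy)
    filter_upwards [(hin 0).continuousAt.eventually h1] with x hx σ hσ
    simpa using hx σ hσ
  have hsndb : ∀ᶠ x in 𝓝ˢ S, (Φ (-1, (x, 1))).2 = 0 := by
    rw [eventually_nhdsSet_iff_forall]
    intro y hy
    have h1 := apply_flow_eq_add_near (J := J.prod 𝓘(ℝ, ℝ)) (f := Prod.snd) hΦc hΦ0 hΦi hVV hsndV
      (hsegb y hy)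
    filter_upwards [(hin' 1).continuousAt.eventually h1] with x hx
    simpa using hx 1 (by simp)
  have hcancel : ∀ s x, Φ (-s, Φ (s, x)) = x := fun s x => by rw [← hΦa, neg_add_cancel, hΦ0]
  have hcancel' : ∀ s x, Φ (s, Φ (-s, x)) = x := fun s x => by rw [← hΦa, add_neg_cancel, hΦ0]
  -- The flow maps between the slices s = 0 and s = 1. The cut-off field has ds-component 1 only
  -- near C, so they are inverse to each other only near S.
  let θ : N → N := fun x => (Φ (1, (x, 0))).1
  let θi : N → N := fun x => (Φ (-1, (x, 1))).1
  have hsl : ∀ s c : ℝ, ContMDiff J (J.prod 𝓘(ℝ, ℝ)) ∞ fun x : N => Φ (s, (x, c)) := fun s c =>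
    hΦs.comp (contMDiff_const.prodMk (contMDiff_id.prodMk contMDiff_const))
  have hθs : ContMDiff J J ∞ θ := contMDiff_fst.comp (hsl 1 0)
  have hθis : ContMDiff J J ∞ θi := contMDiff_fst.comp (hsl (-1) 1)
  refine ⟨θ, θi, hθs, hθis, ?_, ?_, ?_, ?_, ?_, ?_⟩
  · intro x hx
    simp only [θ]
    rw [hline x hx 0 (by norm_num) 1 (by norm_num)]
  · intro x hx
    simp only [θi]
    rw [hline x hx 1 (by norm_num) (-1) (by norm_num)]
  · filter_upwards [hsnd] with x hx
    have h1 : Φ (1, (x, 0)) = (θ x, 1) := Prod.ext rfl (hx 1 (by simp))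
    simp only [θi]
    rw [← h1, hcancel]
  · filter_upwards [hsndb] with x hx
    have h1 : Φ (-1, (x, 1)) = (θi x, 0) := Prod.ext rfl hx
    simp only [θ]
    rw [← h1, hcancel']
  · have hgd := hgood _ ((hVC.and (hVV.and (eventually_fst_nhdsSet
      (hxi.and hal)))).eventually_nhdsSet)
    have hg2 := hgood _ ((eventually_fst_nhdsSet (hxi.and hal)) :
      ∀ᶠ x in 𝓝ˢ C, FormSmoothAt J xi x.1 ∧ FormSmoothAt J al x.1)
    filter_upwards [hgd, hg2, hsnd, hsnd.eventually_nhdsSet] with x hx hx2 hx3 hx4 v w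
    let G : ℝ × N → N × ℝ := fun p => Φ (p.1, (p.2, 0))
    have hG : ContMDiff (𝓘(ℝ, ℝ).prod J) (J.prod 𝓘(ℝ, ℝ)) ∞ G :=
      hΦs.comp (contMDiff_fst.prodMk (contMDiff_snd.prodMk contMDiff_const))
    have hinv := extd_pullback_invariant (Xi := pathForm J xi al) (z := x) hG
      (fun t ht => pathForm_smooth (hx2 t ht).1 (hx2 t ht).2) (fun t ht => by
        have h1 := (hG.continuous.continuousAt (x := (t, x))).eventually (hx t ht)
        filter_upwards [h1] with p hp
        refine ⟨pathForm_smooth hp.2.2.1 hp.2.2.2, fun w => ?_⟩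
        have h2 := md_prod_line (J := J) (J' := J.prod 𝓘(ℝ, ℝ)) (p := p) (hG p).mdiff 1 0
        rw [map_zero, add_zero, one_smul] at h2
        have h3 : md 𝓘(ℝ, ℝ) (J.prod 𝓘(ℝ, ℝ)) (fun s => G (s, p.2)) p.1 1 = V (G p) :=
          ((hΦi (p.2, 0)).md_eq (J := J.prod 𝓘(ℝ, ℝ)) p.1).2.trans hp.2.1
        rw [h2, h3]
        exact hp.1.2.2 w) v w
    have e0 : (fun x => G (0, x)) = fun x => (x, 0) := by
      funext x
      exact hΦ0 _
    have e1 : (fun x => G (1, x)) =ᶠ[𝓝 x] fun x => (θ x, 1) := by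
      filter_upwards [hx4] with y hy
      exact Prod.ext rfl (hy 1 (by simp))
    have d0 : ∀ v, md J (J.prod 𝓘(ℝ, ℝ)) (fun x => G (0, x)) x v = (v, 0) := by
      intro v
      rw [e0, md_prodMk (mdiff_id _) mdifferentiableAt_const, md_const_apply, md_id_apply]
    have d1 : ∀ v, md J (J.prod 𝓘(ℝ, ℝ)) (fun x => G (1, x)) x v = (md J J θ x v, 0) := by
      intro v
      rw [md_congr e1, md_prodMk (hθs x).mdiff mdifferentiableAt_const, md_const_apply]
    have p1 : G (1, x) = (θ x, 1) := e1.self_of_nhds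
    have p0 : G (0, x) = (x, 0) := hΦ0 _
    rw [d0, d0, d1, d1, p0, p1] at hinv
    have hs0 := hx2 0 (by simp)
    have hs1 := hx2 1 (by simp)
    rw [hΦ0] at hs0
    have hs1' : FormSmoothAt J xi (θ x) ∧ FormSmoothAt J al (θ x) := hs1
    rw [extd_pathForm (x := (θ x, 1)) hs1'.1 hs1'.2,
      extd_pathForm (x := (x, 0)) hs0.1 hs0.2] at hinv
    rw [extd_add hs1'.1 hs1'.2]
    simp only at hinv
    linarith
  -- The track of x under the isotopy stays in U by `hgood`. It cannot enter S, because the orbits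
  -- through S × [0, 1] are vertical there, so a point that meets S started in S.
  · intro U hU
    filter_upwards [hsnd, hgood _ (eventually_fst_nhdsSet (P := fun x => x ∈ U) hU)]
      with x hx hxU hxS
    refine ⟨fun s => (Φ (s, (x, 0))).1, by fun_prop, congrArg Prod.fst (hΦ0 (x, 0)), rfl, fun s hs => ⟨hxU s hs, ?_⟩⟩
    intro hmem
    apply hxS
    set y := (Φ (s, (x, 0))).1 with hy
    have h1 : Φ (s, (x, 0)) = (y, s) := Prod.ext rfl (hx s hs)
    have h2 : Φ (s, (y, 0)) = (y, s) := by
      rw [hline y hmem 0 (by norm_num) s (by constructor <;> linarith [hs.1, hs.2]), zero_add]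
    have h3 := hcancel s (x, 0)
    rw [h1, ← h2, hcancel] at h3
    have h4 : y = x := congrArg Prod.fst h3
    rwa [← h4]

end Moser

/-! ### Tubular normal form of dξ near a hypersurface. -/

section NormalForm

variable {F : Type*} [NormedAddCommGroup F] [NormedSpace ℝ F] [FiniteDimensional ℝ F]
  {K : Type*} [TopologicalSpace K] {J : ModelWithCorners ℝ F K}
  {N : Type*} [TopologicalSpace N] [ChartedSpace K N] [IsManifold J ∞ N] [J.Boundaryless]

lemma tendsto_nhdsSet_of_fixed {X : Type*} [TopologicalSpace X] {S : Set X} {f : X → X}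
    (hf : ∀ x ∈ S, ContinuousAt f x) (hid : ∀ x ∈ S, f x = x) :
    Tendsto f (𝓝ˢ S) (𝓝ˢ S) := by
  intro U hU
  rw [mem_map, mem_nhdsSet_iff_forall]
  intro x hx
  refine (hf x hx) ?_
  rw [hid x hx]
  exact mem_nhdsSet_iff_forall.1 hU x hx

lemma md_mul {f g : N → ℝ} {z : N} (hf : MDifferentiableAt J 𝓘(ℝ, ℝ) f z)
    (hg : MDifferentiableAt J 𝓘(ℝ, ℝ) g z) (v : F) :
    md J 𝓘(ℝ, ℝ) (fun x => f x * g x) z v =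
      f z * md J 𝓘(ℝ, ℝ) g z v + g z * md J 𝓘(ℝ, ℝ) f z v := by
  have h1 := (hf.hasMFDerivAt.mul hg.hasMFDerivAt).mfderiv
  exact congrArg (fun L : F →L[ℝ] ℝ => L v) h1

/-- This is `dual_vf` with β = 0. Z is picked pointwise, and nondegeneracy makes the choice unique,
hence smooth, near S. -/
lemma exists_dual_vf_near {S : Set N} {xi lam : N → F →L[ℝ] ℝ}
    (hxi : ∀ᶠ x in 𝓝ˢ S, FormSmoothAt J xi x) (hlam : ∀ᶠ x in 𝓝ˢ S, FormSmoothAt J lam x)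
    (hnd : ∀ x ∈ S, ∀ v, (∀ w, extd J xi x v w = 0) → v = 0) :
    ∃ Z : N → F, ∀ᶠ x in 𝓝ˢ S, VFSmoothAt J Z x ∧ ∀ w, extd J xi x (Z x) w = lam x w := by
  let be : N → F →L[ℝ] ℝ := md J 𝓘(ℝ, ℝ) fun _ => (0 : ℝ)
  have hbe : ∀ x v, be x v = 0 := fun x v => md_const_apply _ x v
  have hbs : ∀ x, FormSmoothAt J be x := fun x => (FormSmoothAt.md contMDiffAt_const).1
  have hexx : ∀ x, ∃ v : F, (∃ v, ∀ w, extd J xi x v w = lam x w) →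
      ∀ w, extd J xi x v w = lam x w := by
    intro x
    by_cases h : ∃ v, ∀ w, extd J xi x v w = lam x w
    · obtain ⟨v, hv⟩ := h
      exact ⟨v, fun _ => hv⟩
    · exact ⟨0, fun h' => (h h').elim⟩
  choose Z hZ using hexx
  refine ⟨Z, ?_⟩
  have hBn : ∀ x, (∀ v, (∀ w, extd J xi x v w = 0) → v = 0) →
      ∀ v, (∀ w, extd J xi x v w + be x v * be x w = 0) → v = 0 := by
    intro x h v hv
    refine h v fun w => ?_
    have := hv w
    rwa [hbe, zero_mul, add_zero] at this
  have hev : ∀ᶠ x in 𝓝ˢ S, (∀ v, (∀ w, extd J xi x v w = 0) → v = 0) ∧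
      ∀ w, extd J xi x (Z x) w = lam x w := by
    rw [eventually_nhdsSet_iff_forall] at hxi ⊢
    intro x hx
    filter_upwards [(dual_vf (hxi x hx) (hbs x) (hBn x (hnd x hx))).1] with y hy
    constructor
    · intro v hv
      refine hy.1 v fun w => ?_
      rw [hbe, hv, zero_mul, add_zero]
    · refine hZ y ?_
      obtain ⟨v, hv⟩ := hy.2 (lam y)
      refine ⟨v, fun w => ?_⟩
      rw [← hv w, hbe, zero_mul, add_zero]
  filter_upwards [hev.eventually_nhdsSet, hxi.eventually_nhdsSet, hlam] with x h1 h2 h3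
  refine ⟨(dual_vf h2 (hbs x) (hBn x h1.self_of_nhds.1)).2 lam Z h3 (h1.mono fun y hy w => ?_),
    h1.self_of_nhds.2⟩
  rw [hbe, zero_mul, add_zero]
  exact hy.2 w

/-- A defining function `t` of `S` together with a transverse vector field `Y` dual to `λ` along
`S` and satisfying `dt(Y) = 1`. -/
lemma exists_transverse_vf {S : Set N} {xi lam : N → F →L[ℝ] ℝ} {h : N → ℝ} {X : N → F}
    (hxi : ∀ᶠ x in 𝓝ˢ S, FormSmoothAt J xi x) (hlam : ∀ᶠ x in 𝓝ˢ S, FormSmoothAt J lam x)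
    (hnd : ∀ x ∈ S, ∀ v, (∀ w, extd J xi x v w = 0) → v = 0)
    (hh : ∀ᶠ x in 𝓝ˢ S, ContMDiffAt J 𝓘(ℝ, ℝ) ∞ h x) (hS : ∀ x, x ∈ S ↔ h x = 0)
    (hX : ∀ x ∈ S, ∀ w, extd J xi x (X x) w = - md J 𝓘(ℝ, ℝ) h x w)
    (hpos : ∀ x ∈ S, 0 < lam x (X x)) :
    ∃ (t ρ : N → ℝ) (Y : N → F), (∀ᶠ x in 𝓝ˢ S, ContMDiffAt J 𝓘(ℝ, ℝ) ∞ t x ∧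
      VFSmoothAt J Y x ∧ md J 𝓘(ℝ, ℝ) t x (Y x) = 1 ∧ 0 < ρ x ∧ t x * ρ x = h x) ∧
      ∀ x ∈ S, t x = 0 ∧ (∀ w, extd J xi x (Y x) w = lam x w) ∧
        ∀ w, md J 𝓘(ℝ, ℝ) h x w = 0 → md J 𝓘(ℝ, ℝ) t x w = 0 := by
  obtain ⟨Z, hZ⟩ := exists_dual_vf_near hxi hlam hnd
  -- On S, dh(Z) = -dξ(X, Z) = dξ(Z, X) = λ(X) > 0. Thus t = h / ρ satisfies dt(Z) = 1 on S, and
  -- dividing Z by s = dt(Z) gives the same normalization near S.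
  let ρ : N → ℝ := fun x => md J 𝓘(ℝ, ℝ) h x (Z x)
  have hρs : ∀ᶠ x in 𝓝ˢ S, ContMDiffAt J 𝓘(ℝ, ℝ) ∞ ρ x := by
    filter_upwards [hh, hZ] with x h1 h2
    exact (FormSmoothAt.md h1).1.apply h2.1
  have hρS : ∀ x ∈ S, ρ x = lam x (X x) := by
    intro x hx
    have h1 := (hZ.self_of_nhdsSet x hx).2 (X x)
    rw [extd_swap, hX x hx, neg_neg] at h1
    exact h1
  have hev : ∀ {f : N → ℝ}, (∀ᶠ x in 𝓝ˢ S, ContMDiffAt J 𝓘(ℝ, ℝ) ∞ f x) → (∀ x ∈ S, 0 < f x) →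
      ∀ᶠ x in 𝓝ˢ S, 0 < f x := by
    intro f hf hp
    rw [eventually_nhdsSet_iff_forall] at hf ⊢
    intro x hx
    exact (hf x hx).self_of_nhds.continuousAt.eventually (lt_mem_nhds (hp x hx))
  have hρp : ∀ᶠ x in 𝓝ˢ S, 0 < ρ x := hev hρs fun x hx => by rw [hρS x hx]; exact hpos x hx
  let t : N → ℝ := fun x => h x * (ρ x)⁻¹
  have hts : ∀ᶠ x in 𝓝ˢ S, ContMDiffAt J 𝓘(ℝ, ℝ) ∞ t x := by
    filter_upwards [hh, hρs, hρp] with x h1 h2 h3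
    have h4 : ContMDiffAt J 𝓘(ℝ, ℝ) ∞ (fun x => (ρ x)⁻¹) x := h2.inv₀ h3.ne'
    exact h1.mul h4
  have htρ : ∀ᶠ x in 𝓝ˢ S, t x * ρ x = h x := by
    filter_upwards [hρp] with x h1
    simp only [t]
    field_simp
  have ht0 : ∀ x ∈ S, t x = 0 := fun x hx => by simp only [t]; rw [(hS x).1 hx, zero_mul]
  have hdt : ∀ x ∈ S, ∀ w, ρ x * md J 𝓘(ℝ, ℝ) t x w = md J 𝓘(ℝ, ℝ) h x w := by
    intro x hx w
    have h1 : (fun x => t x * ρ x) =ᶠ[𝓝 x] h := eventually_nhdsSet_iff_forall.1 htρ x hx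
    have h2 := md_mul (hts.self_of_nhdsSet x hx).mdiff (hρs.self_of_nhdsSet x hx).mdiff w
    rw [md_congr h1, ht0 x hx] at h2
    linarith
  let s : N → ℝ := fun x => md J 𝓘(ℝ, ℝ) t x (Z x)
  have hss : ∀ᶠ x in 𝓝ˢ S, ContMDiffAt J 𝓘(ℝ, ℝ) ∞ s x := by
    filter_upwards [hts, hZ] with x h1 h2
    exact (FormSmoothAt.md h1).1.apply h2.1
  have hsS : ∀ x ∈ S, s x = 1 := by
    intro x hx
    have h1 := hdt x hx (Z x)
    exact mul_left_cancel₀ (hρp.self_of_nhdsSet x hx).ne' (h1.trans (mul_one _).symm)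
  have hsp : ∀ᶠ x in 𝓝ˢ S, 0 < s x := hev hss fun x hx => by rw [hsS x hx]; exact one_pos
  refine ⟨t, ρ, fun x => (s x)⁻¹ • Z x, ?_, fun x hx => ⟨ht0 x hx, fun w => ?_, fun w hw => ?_⟩⟩
  · filter_upwards [hts, hZ, hss, hsp, hρp, htρ] with x h1 h2 h3 h4 h5 h6
    have h7 : ContMDiffAt J 𝓘(ℝ, ℝ) ∞ (fun x => (s x)⁻¹) x := h3.inv₀ h4.ne'
    refine ⟨h1, h2.1.smul h7, ?_, h5, h6⟩
    rw [map_smul]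
    exact inv_mul_cancel₀ h4.ne'
  · simp only [hsS x hx, inv_one, one_smul]
    exact (hZ.self_of_nhdsSet x hx).2 w
  · have h1 := hdt x hx w
    rw [hw] at h1
    exact (mul_eq_zero.1 h1).resolve_left (hρp.self_of_nhdsSet x hx).ne'

/-- The tubular coordinates of a stable hypersurface: near `S`, the form `dξ` is
`q^*dξ + d(G q^*λ)`, where `q` is a retraction onto `S` and `(q, G)` are coordinates. -/
theorem exists_normal_form [T2Space N] [SigmaCompactSpace N] {S : Set N} (hSc : IsCompact S)
    {xi lam : N → F →L[ℝ] ℝ} {h : N → ℝ} {X : N → F}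
    (hxi : ∀ᶠ x in 𝓝ˢ S, FormSmoothAt J xi x) (hlam : ∀ᶠ x in 𝓝ˢ S, FormSmoothAt J lam x)
    (hnd : ∀ x ∈ S, ∀ v, (∀ w, extd J xi x v w = 0) → v = 0)
    (hh : ∀ᶠ x in 𝓝ˢ S, ContMDiffAt J 𝓘(ℝ, ℝ) ∞ h x) (hS : ∀ x, x ∈ S ↔ h x = 0)
    (hX : ∀ x ∈ S, ∀ w, extd J xi x (X x) w = - md J 𝓘(ℝ, ℝ) h x w)
    (hpos : ∀ x ∈ S, 0 < lam x (X x)) :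
    ∃ (G : N → ℝ) (q pr : N → N) (Θ : N × ℝ → N),
      (∀ᶠ z in 𝓝ˢ S, ContMDiffAt J 𝓘(ℝ, ℝ) ∞ G z ∧ ContMDiffAt J J ∞ q z ∧ q z ∈ S ∧
        Θ (q z, G z) = z ∧ (0 < h z → 0 < G z) ∧ (h z < 0 → G z < 0) ∧
        ∀ v w, extd J xi z v w = extd J xi (q z) (md J J q z v) (md J J q z w) +
          md J 𝓘(ℝ, ℝ) G z v * lam (q z) (md J J q z w) -
          md J 𝓘(ℝ, ℝ) G z w * lam (q z) (md J J q z v) +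
          G z * extd J lam (q z) (md J J q z v) (md J J q z w)) ∧
      (∀ᶠ z in 𝓝ˢ S, ContMDiffAt J J ∞ pr z ∧ pr z ∈ S) ∧
      (∀ z ∈ S, q z = z ∧ pr z = z ∧ G z = 0 ∧ Θ (z, 0) = z ∧
        ∀ v, md J 𝓘(ℝ, ℝ) h z v = 0 → md J J pr z v = v) ∧
      ∀ z ∈ S, ∀ᶠ p in 𝓝 (z, (0 : ℝ)), ContMDiffAt (J.prod 𝓘(ℝ, ℝ)) J ∞ Θ p ∧
        q (Θ p) = pr p.1 ∧ G (Θ p) = p.2 := by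
  obtain ⟨t, ρ, Y, hnear, hon⟩ := exists_transverse_vf hxi hlam hnd hh hS hX hpos
  obtain ⟨Y', φ, hYY, hYs, hφs, hφ0, hφa, hφi⟩ := exists_flow_near (J := J) hSc Y
    (hnear.mono fun x hx => hx.2.1)
  have hφc : Continuous φ := hφs.continuous
  have htφ : ∀ y ∈ S, ∀ᶠ p in 𝓝 ((0 : ℝ), y), t (φ p) = t p.2 + p.1 := by
    intro y hy
    have h1 := apply_flow_eq_add_near (J := J) (f := t) (s₀ := 0) (x₀ := y) hφc hφ0 hφi hYY
      (hnear.mono fun x hx => ⟨hx.1.mdiff, hx.2.2.1⟩) (fun σ _ => by rwa [mul_zero, hφ0])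
    filter_upwards [h1] with p hp
    simpa using hp 1 (by simp)
  -- As dt(Y) = 1, flowing along Y for time -t ends on t = 0, that is, in S.
  let pr : N → N := fun z => φ (- t z, z)
  have hprs : ∀ᶠ z in 𝓝ˢ S, ContMDiffAt J J ∞ pr z := by
    filter_upwards [hnear] with z hz
    exact (hφs _).comp z (hz.1.neg.prodMk contMDiffAt_id)
  have hprid : ∀ z ∈ S, pr z = z := fun z hz => by
    simp only [pr]; rw [(hon z hz).1, neg_zero, hφ0]
  have hprt : Tendsto pr (𝓝ˢ S) (𝓝ˢ S) :=
    tendsto_nhdsSet_of_fixed (fun x hx => (hprs.self_of_nhdsSet x hx).continuousAt) hprid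
  have hmemS : ∀ᶠ z in 𝓝ˢ S, t z = 0 → z ∈ S := by
    filter_upwards [hnear] with z hz h0
    rw [hS, ← hz.2.2.2.2, h0, zero_mul]
  have htcont : ∀ y ∈ S, Tendsto t (𝓝 y) (𝓝 0) := by
    intro y hy
    have := (hnear.self_of_nhdsSet y hy).1.continuousAt
    rwa [ContinuousAt, (hon y hy).1] at this
  have hprS : ∀ᶠ z in 𝓝ˢ S, pr z ∈ S := by
    have h1 : ∀ᶠ z in 𝓝ˢ S, t (pr z) = 0 := by
      rw [eventually_nhdsSet_iff_forall]
      intro y hy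
      have h2 : Tendsto (fun z => (- t z, z)) (𝓝 y) (𝓝 ((0 : ℝ), y)) := by
        have := (htcont y hy).neg
        rw [neg_zero] at this
        exact this.prodMk_nhds tendsto_id
      filter_upwards [h2.eventually (htφ y hy)] with z hz
      simp only [pr]
      rw [hz]
      ring
    filter_upwards [h1, hprt.eventually hmemS] with z h1 h2
    exact h2 h1
  have hφmd : ∀ z ∈ S, ∀ r v, md (𝓘(ℝ, ℝ).prod J) J φ (0, z) (r, v) = r • Y z + v := by
    intro z hz r v
    rw [md_prod_line (hφs _).mdiff]
    have h1 : (fun x => φ (((0 : ℝ), z).1, x)) = fun x => x := by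
      funext x
      exact hφ0 x
    have h2 := ((hφi z).md_eq (J := J) 0).2
    rw [h1, md_id_apply]
    simp only
    rw [h2, hφ0, hYY.self_of_nhdsSet z hz]
  have hprmd : ∀ z ∈ S, ∀ v, md J J pr z v = v + (- md J 𝓘(ℝ, ℝ) t z v) • Y z := by
    intro z hz v
    have h0 := (hnear.self_of_nhdsSet z hz).1
    have h1 := md_comp_apply (J := J) (J' := 𝓘(ℝ, ℝ).prod J) (J'' := J) (g := φ)
      (f := fun z => (- t z, z)) z (hφs _).mdiff (h0.neg.mdiff.prodMk (mdiff_id z)) v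
    refine h1.trans ?_
    rw [md_prodMk h0.neg.mdiff (mdiff_id z), md_id_apply]
    have h2 : md J 𝓘(ℝ, ℝ) (fun x => - t x) z v = - md J 𝓘(ℝ, ℝ) t z v := by
      have := h0.mdiff.hasMFDerivAt.neg.mfderiv
      exact congrArg (fun L : F →L[ℝ] ℝ => L v) this
    rw [h2, (hon z hz).1, neg_zero, hφmd z hz, add_comm]
  -- the comparison form
  let xi1 : N → F →L[ℝ] ℝ := fun x => formPullback J J pr xi x + t x • formPullback J J pr lam x
  -- The exact term du leaves dα unchanged. On S it equals ξ(Y) dt, exactly what is missing for α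
  -- itself to vanish there.
  let u : N → ℝ := fun x => t x * xi x (Y x)
  let al : N → F →L[ℝ] ℝ := fun x => (xi1 x + (-1 : ℝ) • xi x) + md J 𝓘(ℝ, ℝ) u x
  have hus : ∀ᶠ x in 𝓝ˢ S, ContMDiffAt J 𝓘(ℝ, ℝ) ∞ u x := by
    filter_upwards [hnear, hxi] with x h1 h2
    exact h1.1.mul (h2.apply h1.2.1)
  have hpx : ∀ᶠ x in 𝓝ˢ S, FormSmoothAt J (formPullback J J pr xi) x := by
    filter_upwards [hprs, hprt.eventually hxi] with x h1 h2
    exact h2.pullback h1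
  have hpl : ∀ᶠ x in 𝓝ˢ S, FormSmoothAt J (formPullback J J pr lam) x := by
    filter_upwards [hprs, hprt.eventually hlam] with x h1 h2
    exact h2.pullback h1
  have hxi1s : ∀ᶠ x in 𝓝ˢ S, FormSmoothAt J xi1 x := by
    filter_upwards [hpx, hpl, hnear] with x h1 h2 h3
    exact h1.add (h2.smul h3.1)
  have hneg : ∀ {x}, FormSmoothAt J xi x → FormSmoothAt J (fun x => (-1 : ℝ) • xi x) x :=
    fun {x} hx => hx.smul (f := fun _ => (-1 : ℝ)) contMDiffAt_const
  have hals : ∀ᶠ x in 𝓝ˢ S, FormSmoothAt J al x := by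
    filter_upwards [hxi1s, hxi, hus] with x h1 h2 h3
    exact (h1.add (hneg h2)).add (FormSmoothAt.md h3).1
  have hxi1d : ∀ᶠ x in 𝓝ˢ S, ∀ v w, extd J xi1 x v w =
      extd J xi (pr x) (md J J pr x v) (md J J pr x w) +
      (md J 𝓘(ℝ, ℝ) t x v * lam (pr x) (md J J pr x w) -
        md J 𝓘(ℝ, ℝ) t x w * lam (pr x) (md J J pr x v) +
        t x * extd J lam (pr x) (md J J pr x v) (md J J pr x w)) := by
    filter_upwards [hpx, hpl, hnear, hprs, hprt.eventually hxi, hprt.eventually hlam]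
      with x h1 h2 h3 h4 h5 h6 v w
    simp only [xi1]
    rw [extd_add h1 (h2.smul h3.1), extd_smul h2 h3.1, extd_pullback h5 h4, extd_pullback h6 h4]
    rfl
  have hxa : ∀ᶠ x in 𝓝ˢ S, ∀ v w, extd J (fun x => xi x + al x) x v w = extd J xi1 x v w := by
    filter_upwards [hxi1s, hus] with x h1 h2 v w
    have e : (fun x => xi x + al x) = fun x => xi1 x + md J 𝓘(ℝ, ℝ) u x := by
      funext x
      simp only [al]
      module
    rw [e, extd_add h1 (FormSmoothAt.md h2).1, (FormSmoothAt.md h2).2, add_zero]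
  have hYlam : ∀ z ∈ S, lam z (Y z) = 0 := fun z hz => by
    rw [← (hon z hz).2.1, extd_self]
  have hal0 : ∀ z ∈ S, al z = 0 := by
    intro z hz
    have h1 := (hnear.self_of_nhdsSet z hz).1.mdiff
    have h2 := ((hxi.self_of_nhdsSet z hz).apply (hnear.self_of_nhdsSet z hz).2.1).mdiff
    ext v
    have h3 := md_mul h1 h2 v
    simp only [al, xi1, add_apply, smul_apply, (hon z hz).1, zero_smul, add_zero]
    rw [show md J 𝓘(ℝ, ℝ) u z v = _ from h3, (hon z hz).1]
    simp only [formPullback, ContinuousLinearMap.comp_apply, hprid z hz, hprmd z hz, map_add,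
      map_smul, smul_eq_mul, zero_apply]
    ring
  -- On S the derivative of pr is v ↦ v - dt(v) Y, and dξ(Y, ·) = λ with λ(Y) = 0; the terms of type
  -- dt ∧ λ cancel.
  have hdal : ∀ z ∈ S, ∀ v w, extd J al z v w = 0 := by
    intro z hz v w
    have h1 := hxi1s.self_of_nhdsSet z hz
    have h2 := hxi.self_of_nhdsSet z hz
    have h3 := hus.self_of_nhdsSet z hz
    have h4 : extd J al z v w = _ := extd_add (h1.add (hneg h2)) (FormSmoothAt.md h3).1 v w
    rw [h4, extd_add h1 (hneg h2), (FormSmoothAt.md h3).2,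
      extd_smul h2 (f := fun _ => (-1 : ℝ)) contMDiffAt_const, md_const_apply, md_const_apply,
      hxi1d.self_of_nhdsSet z hz, (hon z hz).1, hprid z hz, hprmd z hz, hprmd z hz]
    simp only [extd_add_left, extd_add_right, extd_smul_left, extd_smul_right, map_add, map_smul,
      smul_eq_mul, (hon z hz).2.1, hYlam z hz, extd_self]
    rw [extd_swap xi z v (Y z), (hon z hz).2.1]
    ring
  obtain ⟨θ, θi, hθs, hθis, hθ1, hθi1, hθ2, hθ3, hθd, hθp⟩ :=
    exists_moser_diffeo hSc hxi hals hnd hal0 hdal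
  have hθt : Tendsto θ (𝓝ˢ S) (𝓝ˢ S) :=
    tendsto_nhdsSet_of_fixed (fun x _ => hθs.continuous.continuousAt) hθ1
  let G : N → ℝ := fun z => t (θ z)
  let q : N → N := fun z => pr (θ z)
  -- The inverse of (q, G): flow along Y from S for the prescribed time, then undo θ. Composing with
  -- pr extends it from S × ℝ to an open set, where smoothness makes sense.
  let Θ : N × ℝ → N := fun p => θi (φ (p.2, pr p.1))
  have hGs : ∀ᶠ z in 𝓝ˢ S, ContMDiffAt J 𝓘(ℝ, ℝ) ∞ G z := by
    filter_upwards [hθt.eventually hnear] with z hz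
    exact hz.1.comp z (hθs z)
  have hqs : ∀ᶠ z in 𝓝ˢ S, ContMDiffAt J J ∞ q z := by
    filter_upwards [hθt.eventually hprs] with z hz
    exact hz.comp z (hθs z)
  refine ⟨G, q, pr, Θ, ?_, hprs.and hprS, ?_, ?_⟩
  -- The isotopy from z to θ z avoids S, so t does not vanish along it, and t(θ z) has the sign of
  -- t(z), which is that of h(z).
  · have hsign : ∀ᶠ z in 𝓝ˢ S, (0 < h z → 0 < G z) ∧ (h z < 0 → G z < 0) := by
      have h1 := hθp {x | 0 < ρ x ∧ t x * ρ x = h x ∧ ContinuousAt t x}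
        (hnear.mono fun x hx => ⟨hx.2.2.2.1, hx.2.2.2.2, hx.1.continuousAt⟩)
      filter_upwards [h1] with z hz
      by_cases hzS : z ∈ S
      · rw [(hS z).1 hzS]
        simp
      obtain ⟨γ, hγc, hγ0, hγ1, hγ⟩ := hz hzS
      have hne : ∀ s ∈ Icc (0 : ℝ) 1, t (γ s) ≠ 0 := by
        intro s hs h0
        obtain ⟨h2, h3⟩ := hγ s hs
        apply h3
        rw [hS, ← h2.2.1, h0, zero_mul]
      have hcont : ContinuousOn (fun s => t (γ s)) (Icc 0 1) := fun s hs =>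
        (ContinuousAt.comp (g := t) (hγ s hs).1.2.2 hγc.continuousAt).continuousWithinAt
      have e0 := (hγ 0 (by simp)).1
      rw [hγ0] at e0
      have hG1 : G z = t (γ 1) := by rw [hγ1]
      constructor
      · intro hp
        have htp : 0 < t (γ 0) := by
          rw [hγ0]
          exact pos_of_mul_pos_left (e0.2.1.symm ▸ hp) e0.1.le
        by_contra hle
        rw [hG1, not_lt] at hle
        obtain ⟨s, hs, hs0⟩ := intermediate_value_Icc' zero_le_one hcont ⟨hle, htp.le⟩
        exact hne s hs hs0
      · intro hp
        have htp : t (γ 0) < 0 := by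
          rw [hγ0]
          by_contra hge
          rw [not_lt] at hge
          have := mul_nonneg hge e0.1.le
          rw [e0.2.1] at this
          linarith
        by_contra hle
        rw [hG1, not_lt] at hle
        obtain ⟨s, hs, hs0⟩ := intermediate_value_Icc zero_le_one hcont ⟨htp.le, hle⟩
        exact hne s hs hs0
    filter_upwards [hGs, hqs, hsign, hθt.eventually hprS, hθ2, hθd, hθt.eventually hxa,
      hθt.eventually hxi1d, hθt.eventually hnear, hθt.eventually hprs]
      with z h1 h2 h3 h4 h5 h6 h7 h8 h9 h10
    refine ⟨h1, h2, h4, ?_, h3.1, h3.2, fun v w => ?_⟩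
    · simp only [Θ, G, q]
      rw [hprid _ h4]
      simp only [pr]
      rw [← hφa, add_neg_cancel, hφ0, h5]
    · have e1 : ∀ v, md J J q z v = md J J pr (θ z) (md J J θ z v) := fun v =>
        md_comp_apply (g := pr) (f := θ) z h10.mdiff (hθs z).mdiff v
      have e2 : ∀ v, md J 𝓘(ℝ, ℝ) G z v = md J 𝓘(ℝ, ℝ) t (θ z) (md J J θ z v) := fun v =>
        md_comp_apply (g := t) (f := θ) z h9.1.mdiff (hθs z).mdiff v
      rw [← h6, h7, h8, e1, e1, e2, e2]
      simp only [q, G]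
      ring
  · intro z hz
    have ez := hθ1 z hz
    refine ⟨by simp only [q]; rw [ez, hprid z hz], hprid z hz, by simp only [G]; rw [ez, (hon z hz).1],
      by simp only [Θ]; rw [hprid z hz, hφ0, hθi1 z hz], fun v hv => ?_⟩
    rw [hprmd z hz, (hon z hz).2.2 v hv, neg_zero, zero_smul, add_zero]
  · intro z hz
    have hpr1 : Tendsto (fun p : N × ℝ => pr p.1) (𝓝 (z, (0 : ℝ))) (𝓝 z) := by
      have h1 := (hprs.self_of_nhdsSet z hz).continuousAt
      rw [ContinuousAt, hprid z hz] at h1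
      exact h1.comp continuousAt_fst
    have hψ : Tendsto (fun p : N × ℝ => (p.2, pr p.1)) (𝓝 (z, (0 : ℝ))) (𝓝 ((0 : ℝ), z)) :=
      Tendsto.prodMk_nhds continuousAt_snd hpr1
    have hψ2 : Tendsto (fun p : N × ℝ => φ (p.2, pr p.1)) (𝓝 (z, (0 : ℝ))) (𝓝 z) := by
      have h1 := hφc.continuousAt (x := ((0 : ℝ), z))
      rw [ContinuousAt, hφ0] at h1
      exact h1.comp hψ
    have hz' := fun {P : N → Prop} (h : ∀ᶠ x in 𝓝ˢ S, P x) => eventually_nhdsSet_iff_forall.1 h z hz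
    have hfst : Tendsto (fun p : N × ℝ => p.1) (𝓝 (z, (0 : ℝ))) (𝓝 z) := continuousAt_fst
    have hsm : ∀ᶠ p in 𝓝 (z, (0 : ℝ)), ContMDiffAt (J.prod 𝓘(ℝ, ℝ)) J ∞ Θ p := by
      filter_upwards [hfst.eventually (hz' hprs)] with p hp
      have h1 : ContMDiffAt (J.prod 𝓘(ℝ, ℝ)) J ∞ (fun p : N × ℝ => pr p.1) p :=
        ContMDiffAt.comp (g := pr) (f := Prod.fst) p hp contMDiffAt_fst
      exact (hθis _).comp p ((hφs _).comp p (contMDiffAt_snd.prodMk h1))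
    filter_upwards [hsm, hψ.eventually (htφ z hz), hψ2.eventually (hz' hθ3),
      hfst.eventually (hz' hprS)] with p h1 h2 h3 h4
    have ht : t (φ (p.2, pr p.1)) = p.2 := by
      rw [h2, (hon _ h4).1, zero_add]
    refine ⟨h1, ?_, ?_⟩
    · simp only [q, Θ]
      rw [h3]
      conv_lhs => simp only [pr]
      rw [ht]
      change φ (-p.2, φ (p.2, pr p.1)) = _
      rw [← hφa, neg_add_cancel, hφ0]
    · simp only [G, Θ]
      rw [h3, ht]

end NormalForm

/-! ### The Reeb field near a stable hypersurface. -/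

section StableCoordinates

variable {F : Type*} [NormedAddCommGroup F] [NormedSpace ℝ F] [FiniteDimensional ℝ F]
  {K : Type*} [TopologicalSpace K] {J : ModelWithCorners ℝ F K}
  {N : Type*} [TopologicalSpace N] [ChartedSpace K N] [IsManifold J ∞ N] [J.Boundaryless]

/-- Near a stable hypersurface `S` there are a defining function `G` of `S` and an extension `lam'`
of `λ` such that the Hamiltonian vector field `X` of `G` satisfies `lam'(X) = 1` and
`i_X dlam' = 0`, and such that the levels of `G` are related by a family of diffeomorphisms `Ψ`
preserving `X`. -/
theorem exists_stable_coordinates [T2Space N] [SigmaCompactSpace N] {S : Set N} (hSc : IsCompact S)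
    {xi lam : N → F →L[ℝ] ℝ} {h : N → ℝ} {Xh : N → F}
    (hxi : ∀ᶠ x in 𝓝ˢ S, FormSmoothAt J xi x) (hlam : ∀ᶠ x in 𝓝ˢ S, FormSmoothAt J lam x)
    (hnd : ∀ x ∈ S, ∀ v, (∀ w, extd J xi x v w = 0) → v = 0)
    (hh : ∀ᶠ x in 𝓝ˢ S, ContMDiffAt J 𝓘(ℝ, ℝ) ∞ h x) (hS : ∀ x, x ∈ S ↔ h x = 0)
    (hX : ∀ x ∈ S, ∀ w, extd J xi x (Xh x) w = - md J 𝓘(ℝ, ℝ) h x w)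
    (hpos : ∀ x ∈ S, 0 < lam x (Xh x))
    (hker : ∀ x ∈ S, ∀ w, md J 𝓘(ℝ, ℝ) h x w = 0 → extd J lam x (Xh x) w = 0) :
    ∃ (G : N → ℝ) (lam' : N → F →L[ℝ] ℝ) (X : N → F) (Ψ : ℝ → N → N), ∃ W₀ ∈ 𝓝ˢ S,
      (∀ z ∈ W₀, ContMDiffAt J 𝓘(ℝ, ℝ) ∞ G z ∧ FormSmoothAt J lam' z ∧
        (0 < h z → 0 < G z) ∧ (h z < 0 → G z < 0) ∧
        (∀ w, extd J xi z (X z) w = - md J 𝓘(ℝ, ℝ) G z w) ∧ lam' z (X z) = 1 ∧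
        ∀ w, extd J lam' z (X z) w = 0) ∧
      (∀ z ∈ S, G z = 0 ∧ (∀ w, md J 𝓘(ℝ, ℝ) G z w * lam z (Xh z) = md J 𝓘(ℝ, ℝ) h z w) ∧
        ∀ w, md J 𝓘(ℝ, ℝ) h z w = 0 → lam' z w = lam z w) ∧
      ∀ W ∈ 𝓝ˢ S, W ⊆ W₀ → ∃ δ > 0, ∀ s, ∀ z ∈ W, |G z| < δ → |G z + s| < δ →
        Ψ s z ∈ W ∧ G (Ψ s z) = G z + s ∧ Ψ (-s) (Ψ s z) = z ∧ ContMDiffAt J J ∞ (Ψ s) z ∧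
        md J J (Ψ s) z (X z) = X (Ψ s z) := by
  obtain ⟨G, q, pr, Θ, hnear, hpr, hon, hΘ⟩ :=
    exists_normal_form hSc hxi hlam hnd hh hS hX hpos
  -- The Reeb field on S. Only tangent vectors of S are tested below, which is all that stability
  -- controls.
  let R : N → F := fun y => (lam y (Xh y))⁻¹ • Xh y
  have hR : ∀ y ∈ S, md J 𝓘(ℝ, ℝ) h y (R y) = 0 ∧ lam y (R y) = 1 ∧
      ∀ w, md J 𝓘(ℝ, ℝ) h y w = 0 → extd J xi y (R y) w = 0 ∧ extd J lam y (R y) w = 0 := by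
    intro y hy
    have h1 := hX y hy (Xh y)
    rw [extd_self, zero_eq_neg] at h1
    refine ⟨?_, ?_, fun w hw => ⟨?_, ?_⟩⟩
    · simp only [R, map_smul, h1, smul_zero]
    · simp only [R, map_smul, smul_eq_mul]
      exact inv_mul_cancel₀ (hpos y hy).ne'
    · simp only [R, extd_smul_left]
      rw [hX y hy, hw, neg_zero, mul_zero]
    · simp only [R, extd_smul_left]
      rw [hker y hy w hw, mul_zero]
  have hqt : Tendsto q (𝓝ˢ S) (𝓝ˢ S) := tendsto_nhdsSet_of_fixed
    (fun x hx => (hnear.self_of_nhdsSet x hx).2.1.continuousAt) fun x hx => (hon x hx).1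
  have hprt : Tendsto pr (𝓝ˢ S) (𝓝ˢ S) := tendsto_nhdsSet_of_fixed
    (fun x hx => (hpr.self_of_nhdsSet x hx).1.continuousAt) fun x hx => (hon x hx).2.1
  have hz' := fun {P : N → Prop} (h : ∀ᶠ x in 𝓝ˢ S, P x) (z : N) (hz : z ∈ S) =>
    eventually_nhdsSet_iff_forall.1 h z hz
  -- on tangent vectors of `S`
  have hqtan : ∀ z ∈ S, ∀ v, md J 𝓘(ℝ, ℝ) h z v = 0 →
      md J J q z v = v ∧ md J 𝓘(ℝ, ℝ) G z v = 0 := by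
    intro z hz v hv
    have hp := (hon z hz).2.2.2.2 v hv
    have hpz := (hon z hz).2.1
    have hpd := (hpr.self_of_nhdsSet z hz).1.mdiff
    obtain ⟨hG, hq, -⟩ := hnear.self_of_nhdsSet z hz
    constructor
    · have h1 : (fun x => q (pr x)) =ᶠ[𝓝 z] pr := by
        filter_upwards [hz' hpr z hz] with x hx
        exact (hon _ hx.2).1
      have h2 := md_comp_apply (J := J) (J' := J) (J'' := J) (g := q) (f := pr) z
        (by rw [hpz]; exact hq.mdiff) hpd v
      rw [md_congr h1, hp, hpz] at h2
      exact h2.symm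
    · have h1 : (fun x => G (pr x)) =ᶠ[𝓝 z] fun _ => 0 := by
        filter_upwards [hz' hpr z hz] with x hx
        exact (hon _ hx.2).2.2.1
      have h2 := md_comp_apply (J := J) (J' := J) (J'' := 𝓘(ℝ, ℝ)) (g := G) (f := pr) z
        (by rw [hpz]; exact hG.mdiff) hpd v
      rw [md_congr h1, hp, hpz, md_const_apply] at h2
      exact h2.symm
  -- Since q maps into S, h ∘ q vanishes identically; hence dq takes values tangent to S, where R
  -- annihilates both dξ and dλ.
  have hhq : ∀ᶠ z in 𝓝ˢ S, ∀ w, md J 𝓘(ℝ, ℝ) h (q z) (md J J q z w) = 0 := by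
    filter_upwards [hnear.eventually_nhdsSet, hqt.eventually hh] with z h1 h2 w
    have h3 : (fun x => h (q x)) =ᶠ[𝓝 z] fun _ => 0 := by
      filter_upwards [h1] with x hx
      exact (hS _).1 hx.2.2.1
    have h4 := md_comp_apply (J := J) (J' := J) (J'' := 𝓘(ℝ, ℝ)) (g := h) (f := q) z h2.mdiff
      h1.self_of_nhds.2.1.mdiff w
    rw [md_congr h3, md_const_apply] at h4
    exact h4.symm
  -- the coordinates `(q, G)`
  have hqG : ∀ y ∈ S, Tendsto (fun z => (q z, G z)) (𝓝 y) (𝓝 (y, (0 : ℝ))) := by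
    intro y hy
    obtain ⟨hG, hq, -⟩ := hnear.self_of_nhdsSet y hy
    have h1 := hG.continuousAt
    have h2 := hq.continuousAt
    rw [ContinuousAt, (hon y hy).2.2.1] at h1
    rw [ContinuousAt, (hon y hy).1] at h2
    exact h2.prodMk_nhds h1
  let good : N × ℝ → Prop := fun p => ContMDiffAt (J.prod 𝓘(ℝ, ℝ)) J ∞ Θ p ∧
        q (Θ p) = pr p.1 ∧ G (Θ p) = p.2
  have hgood : ∀ᶠ z in 𝓝ˢ S, ∀ᶠ p in 𝓝 (q z, G z), good p := by
    rw [eventually_nhdsSet_iff_forall]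
    intro y hy
    exact (hqG y hy).eventually (hΘ y hy).eventually_nhds
  -- The lift of R along S at constant G, taken through Θ. Its components under dq and dG are read
  -- off from q ∘ Θ = pr ∘ fst and G ∘ Θ = snd.
  let X : N → F := fun z => md (J.prod 𝓘(ℝ, ℝ)) J Θ (q z, G z) (R (q z), 0)
  have hXX : ∀ᶠ z in 𝓝ˢ S, md J J q z (X z) = R (q z) ∧ md J 𝓘(ℝ, ℝ) G z (X z) = 0 := by
    filter_upwards [hnear, hgood, hqt.eventually hpr] with z h1 h2 h3
    obtain ⟨hG, hq, hqS, hΘz, -⟩ := h1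
    have hΘs := h2.self_of_nhds.1
    constructor
    · have h4 : (fun p => q (Θ p)) =ᶠ[𝓝 (q z, G z)] fun p => pr p.1 := h2.mono fun p hp => hp.2.1
      have h5 := md_comp_apply (J := J.prod 𝓘(ℝ, ℝ)) (J' := J) (J'' := J) (g := q) (f := Θ)
        (q z, G z) (by rw [hΘz]; exact hq.mdiff) hΘs.mdiff (R (q z), 0)
      have h6 := md_comp_apply (J := J.prod 𝓘(ℝ, ℝ)) (J' := J) (J'' := J) (g := pr) (f := Prod.fst)
        (q z, G z) h3.1.mdiff mdifferentiableAt_fst (R (q z), 0)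
      rw [md_congr h4, h6, hΘz, md_fst] at h5
      exact h5.symm.trans ((hon _ hqS).2.2.2.2 _ (hR _ hqS).1)
    · have h4 : (fun p => G (Θ p)) =ᶠ[𝓝 (q z, G z)] fun p => p.2 := h2.mono fun p hp => hp.2.2
      have h5 := md_comp_apply (J := J.prod 𝓘(ℝ, ℝ)) (J' := J) (J'' := 𝓘(ℝ, ℝ)) (g := G) (f := Θ)
        (q z, G z) (by rw [hΘz]; exact hG.mdiff) hΘs.mdiff (R (q z), 0)
      rw [md_congr h4, hΘz, show md (J.prod 𝓘(ℝ, ℝ)) 𝓘(ℝ, ℝ) (fun p : N × ℝ => p.2) (q z, G z)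
        (R (q z), 0) = _ from md_snd (J := J) (J' := 𝓘(ℝ, ℝ)) (q z, G z) (R (q z), 0)] at h5
      exact h5.symm
  have hinj : ∀ᶠ z in 𝓝ˢ S, ∀ v w, md J J q z v = md J J q z w →
      md J 𝓘(ℝ, ℝ) G z v = md J 𝓘(ℝ, ℝ) G z w → v = w := by
    filter_upwards [hnear.eventually_nhdsSet, hgood] with z h1 h2 v w hq hG
    have h3 : (fun x => Θ (q x, G x)) =ᶠ[𝓝 z] fun x => x := h1.mono fun x hx => hx.2.2.2.1
    have h0 := h1.self_of_nhds
    have h4 : ∀ v, v = md (J.prod 𝓘(ℝ, ℝ)) J Θ (q z, G z)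
        (md J J q z v, md J 𝓘(ℝ, ℝ) G z v) := by
      intro v
      have h5 := md_comp_apply (J := J) (J' := J.prod 𝓘(ℝ, ℝ)) (J'' := J) (g := Θ)
        (f := fun x => (q x, G x)) z h2.self_of_nhds.1.mdiff (h0.2.1.mdiff.prodMk h0.1.mdiff) v
      rwa [md_congr h3, md_id_apply, md_prodMk h0.2.1.mdiff h0.1.mdiff] at h5
    rw [h4 v, h4 w, hq, hG]
  let W₀ : Set N := {z | (ContMDiffAt J 𝓘(ℝ, ℝ) ∞ G z ∧ ContMDiffAt J J ∞ q z ∧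
    q z ∈ S ∧ Θ (q z, G z) = z) ∧ (∀ᶠ x in 𝓝 z, q x ∈ S) ∧
    (md J J q z (X z) = R (q z) ∧ md J 𝓘(ℝ, ℝ) G z (X z) = 0) ∧
    (∀ v w, md J J q z v = md J J q z w → md J 𝓘(ℝ, ℝ) G z v = md J 𝓘(ℝ, ℝ) G z w → v = w) ∧
    FormSmoothAt J (formPullback J J q lam) z ∧ (0 < h z → 0 < G z) ∧ (h z < 0 → G z < 0) ∧
    (∀ w, extd J xi z (X z) w = - md J 𝓘(ℝ, ℝ) G z w) ∧ formPullback J J q lam z (X z) = 1 ∧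
        ∀ w, extd J (formPullback J J q lam) z (X z) w = 0}
  have hW₀ : W₀ ∈ 𝓝ˢ S := by
    filter_upwards [hnear, hnear.eventually_nhdsSet, hXX, hinj, hqt.eventually hlam, hhq]
      with z h1 h2 h3 h4 h5 h6
    obtain ⟨hG, hq, hqS, hΘz, hs1, hs2, hom⟩ := h1
    refine ⟨⟨hG, hq, hqS, hΘz⟩, h2.mono fun x hx => hx.2.2.1, h3, h4, h5.pullback hq, hs1, hs2,
      fun w => ?_, ?_, fun w => ?_⟩
    -- Insert X into dξ = q*dξ + dG ∧ q*λ + G q*dλ. The outer terms vanish by stability, and dG(X) =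
    -- 0, λ(R) = 1 leave -dG.
    · obtain ⟨-, hR1, hR2⟩ := hR _ hqS
      rw [hom, h3.1, h3.2, hR1, (hR2 _ (h6 w)).1, (hR2 _ (h6 w)).2]
      ring
    · simp only [formPullback, ContinuousLinearMap.comp_apply]
      rw [h3.1]
      exact (hR _ hqS).2.1
    · rw [extd_pullback h5 hq, h3.1]
      exact ((hR _ hqS).2.2 _ (h6 w)).2
  refine ⟨G, formPullback J J q lam, X, fun s z => Θ (q z, G z + s), W₀, hW₀, ?_, ?_, ?_⟩
  · intro z hz
    obtain ⟨⟨h1, -⟩, -, -, -, h2, h3, h4, h5, h6, h7⟩ := hz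
    exact ⟨h1, h2, h3, h4, h5, h6, h7⟩
  · intro z hz
    refine ⟨(hon z hz).2.2.1, fun w => ?_, fun w hw => ?_⟩
    -- On S the normal form with X_h inserted reads -dh = -λ(X_h) dG.
    · obtain ⟨hG, hq, hqS, hΘz, hs1, hs2, hom⟩ := hnear.self_of_nhdsSet z hz
      have hXt : md J 𝓘(ℝ, ℝ) h z (Xh z) = 0 := by
        have h1 := hX z hz (Xh z)
        rwa [extd_self, zero_eq_neg] at h1
      have h1 := hom (Xh z) w
      have h2 := hhq.self_of_nhdsSet z hz w
      rw [(hon z hz).1] at h1 h2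
      rw [(hqtan z hz _ hXt).1, (hqtan z hz _ hXt).2, hX z hz, hX z hz, h2,
        (hon z hz).2.2.1] at h1
      linarith
    · simp only [formPullback, ContinuousLinearMap.comp_apply]
      rw [(hon z hz).1, (hqtan z hz w hw).1]
  · intro W hW hWW
    -- Compactness of S gives one δ for which Θ is good on S × (-δ, δ) and maps it into W.
    have h1 : ∀ᶠ s in 𝓝 (0 : ℝ), ∀ y ∈ S, (∀ᶠ p in 𝓝 (y, s), good p) ∧ Θ (y, s) ∈ W := by
      refine hSc.eventually_forall_of_forall_eventually fun y hy => ?_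
      have hsw : Tendsto (fun p : ℝ × N => (p.2, p.1)) (𝓝 ((0 : ℝ), y)) (𝓝 (y, (0 : ℝ))) :=
        (continuous_swap.tendsto _ : _)
      have h2 := (hΘ y hy).eventually_nhds
      have h3 : ∀ᶠ p in 𝓝 (y, (0 : ℝ)), Θ p ∈ W := by
        have h4 := (hΘ y hy).self_of_nhds.1.continuousAt
        rw [ContinuousAt, (hon y hy).2.2.2.1] at h4
        exact h4.eventually (mem_nhdsSet_iff_forall.1 hW y hy)
      exact hsw.eventually (h2.and h3)
    obtain ⟨δ, hδ, hδ2⟩ := Metric.eventually_nhds_iff.1 h1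
    have hδ3 : ∀ s, |s| < δ → ∀ y ∈ S, (∀ᶠ p in 𝓝 (y, s), good p) ∧ Θ (y, s) ∈ W := fun s hs =>
      hδ2 (by rwa [Real.dist_eq, sub_zero])
    refine ⟨δ, hδ, fun s z hz hG1 hG2 => ?_⟩
    obtain ⟨⟨hGs, hqs, hqS, hΘz⟩, hqSn, hXz, -⟩ := hWW hz
    obtain ⟨hg, hmem⟩ := hδ3 _ hG2 _ hqS
    have hg0 := hg.self_of_nhds
    have hqf : q (Θ (q z, G z + s)) = q z := hg0.2.1.trans (hon _ hqS).2.1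
    have hGf : G (Θ (q z, G z + s)) = G z + s := hg0.2.2
    have hpair : ContMDiffAt J (J.prod 𝓘(ℝ, ℝ)) ∞ (fun z => (q z, G z + s)) z :=
      hqs.prodMk (hGs.add contMDiffAt_const)
    have hfs : ContMDiffAt J J ∞ (fun z => Θ (q z, G z + s)) z :=
      ContMDiffAt.comp (g := Θ) (f := fun z => (q z, G z + s)) z hg0.1 hpair
    refine ⟨hmem, hGf, ?_, hfs, ?_⟩
    · simp only
      rw [hqf, hGf, add_neg_cancel_right, hΘz]
    · obtain ⟨⟨hGs', hqs', -⟩, -, hXz', hinj', -⟩ := hWW hmem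
      have hge := hpair.continuousAt.eventually hg
      -- Near S a vector is determined by its images under dq and dG. The map preserves q and shifts
      -- G by a constant, so both images agree.
      refine hinj' _ _ ?_ ?_
      · have h2 : (fun x => q (Θ (q x, G x + s))) =ᶠ[𝓝 z] q := by
          filter_upwards [hge, hqSn] with x h3 h4
          exact h3.2.1.trans (hon _ h4).2.1
        have h3 := md_comp_apply (J := J) (J' := J) (J'' := J) (g := q)
          (f := fun z => Θ (q z, G z + s)) z hqs'.mdiff hfs.mdiff (X z)
        rw [md_congr h2, hXz.1] at h3
        rw [← h3, hXz'.1, hqf]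
      · have h2 : (fun x => G (Θ (q x, G x + s))) =ᶠ[𝓝 z] fun x => G x + s := by
          filter_upwards [hge] with x h3
          exact h3.2.2
        have h3 := md_comp_apply (J := J) (J' := J) (J'' := 𝓘(ℝ, ℝ)) (g := G)
          (f := fun z => Θ (q z, G z + s)) z hGs'.mdiff hfs.mdiff (X z)
        have h4 : md J 𝓘(ℝ, ℝ) (fun x => G x + s) z (X z) = md J 𝓘(ℝ, ℝ) G z (X z) := by
          have := (hGs.mdiff.hasMFDerivAt.add (hasMFDerivAt_const s z)).mfderiv
          refine (congrArg (fun L : F →L[ℝ] ℝ => L (X z)) this).trans ?_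
          exact add_zero _
        rw [md_congr h2, h4, hXz.2] at h3
        rw [← h3, hXz'.2]

end StableCoordinates

/-! ### Second derivatives under composition, and convexity on rays. -/

section Hess

variable {V W : Type*} [NormedAddCommGroup V] [NormedSpace ℝ V] [NormedAddCommGroup W]
  [NormedSpace ℝ W]

/-- The second derivative of `f` at `p` in the direction `q`. -/
def hess (f : V → ℝ) (p q : V) : ℝ := fderiv ℝ (fderiv ℝ f) p q q

lemma hess_congr {f g : V → ℝ} {p : V} (h : f =ᶠ[𝓝 p] g) (q : V) : hess f p q = hess g p q := by
  unfold hess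
  rw [(h.fderiv).fderiv_eq]

lemma ContDiffAt.differentiableAt_fderiv {E : Type*} [NormedAddCommGroup E] [NormedSpace ℝ E]
    {g : V → E} {p : V} (hg : ContDiffAt ℝ 2 g p) :
    DifferentiableAt ℝ (fderiv ℝ g) p ∧ ∀ᶠ x in 𝓝 p, DifferentiableAt ℝ g x :=
  ⟨(hg.fderiv_right (m := 1) (by norm_num)).differentiableAt (by simp),
    (hg.eventually (by simp)).mono fun _ hx => hx.differentiableAt (by simp)⟩

lemma hess_comp_affine {g : W → ℝ} {a : W} {L : V →L[ℝ] W} {p : V}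
    (hg : ContDiffAt ℝ 2 g (a + L p)) (q : V) :
    hess (fun x => g (a + L x)) p q = hess g (a + L p) (L q) := by
  obtain ⟨h1, h2⟩ := hg.differentiableAt_fderiv
  have hL : ∀ x, HasFDerivAt (fun x => a + L x) L x := fun x => L.hasFDerivAt.const_add a
  have hc : ContinuousAt (fun x => a + L x) p := (hL p).continuousAt
  have h3 : fderiv ℝ (fun x => g (a + L x)) =ᶠ[𝓝 p] fun x => (fderiv ℝ g (a + L x)).comp L := by
    filter_upwards [hc.eventually h2] with x hx
    exact (hx.hasFDerivAt.comp x (hL x)).fderiv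
  have h4 : HasFDerivAt (fun x => fderiv ℝ g (a + L x)) ((fderiv ℝ (fderiv ℝ g) (a + L p)).comp L) p :=
    h1.hasFDerivAt.comp p (hL p)
  have h5 := h4.clm_comp (hasFDerivAt_const L p)
  unfold hess
  rw [h3.fderiv_eq, h5.fderiv]
  simp

lemma hess_add {f g : V → ℝ} {p : V} (hf : ContDiffAt ℝ 2 f p) (hg : ContDiffAt ℝ 2 g p) (q : V) :
    hess (fun x => f x + g x) p q = hess f p q + hess g p q := by
  obtain ⟨h1, h2⟩ := hf.differentiableAt_fderiv
  obtain ⟨h3, h4⟩ := hg.differentiableAt_fderiv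
  have h5 : fderiv ℝ (fun x => f x + g x) =ᶠ[𝓝 p] fun x => fderiv ℝ f x + fderiv ℝ g x := by
    filter_upwards [h2, h4] with x h2 h4
    exact (h2.hasFDerivAt.fun_add h4.hasFDerivAt).fderiv
  unfold hess
  rw [h5.fderiv_eq, (h1.hasFDerivAt.fun_add h3.hasFDerivAt).fderiv]
  rfl

lemma hess_comp {φ : ℝ → ℝ} {g : V → ℝ} {p : V} (hφ : ContDiffAt ℝ 2 φ (g p))
    (hg : ContDiffAt ℝ 2 g p) (q : V) :
    hess (fun x => φ (g x)) p q =
      deriv (deriv φ) (g p) * (fderiv ℝ g p q) ^ 2 + deriv φ (g p) * hess g p q := by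
  obtain ⟨h1, h2⟩ := hg.differentiableAt_fderiv
  have h3 : ∀ᶠ y in 𝓝 (g p), DifferentiableAt ℝ φ y := hφ.differentiableAt_fderiv.2
  have h4 : DifferentiableAt ℝ (deriv φ) (g p) := by
    have h := hφ.differentiableAt_fderiv.1
    have e : deriv φ = fun y => fderiv ℝ φ y 1 := funext fun y => fderiv_apply_one_eq_deriv.symm
    rw [e]
    exact h.clm_apply (differentiableAt_const _)
  have h5 : fderiv ℝ (fun x => φ (g x)) =ᶠ[𝓝 p] fun x => deriv φ (g x) • fderiv ℝ g x := by
    filter_upwards [h2, hg.continuousAt.eventually h3] with x h2 h3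
    exact (h3.hasDerivAt.comp_hasFDerivAt x h2.hasFDerivAt).fderiv
  have h6 : HasFDerivAt (fun x => deriv φ (g x)) (deriv (deriv φ) (g p) • fderiv ℝ g p) p :=
    h4.hasDerivAt.comp_hasFDerivAt p (hg.differentiableAt (by simp)).hasFDerivAt
  have h7 : HasFDerivAt (fun x => deriv φ (g x) • fderiv ℝ g x) _ p := h6.fun_smul h1.hasFDerivAt
  unfold hess
  rw [h5.fderiv_eq, h7.fderiv]
  simp only [add_apply, smul_apply, ContinuousLinearMap.smulRight_apply, smul_eq_mul]
  ring

/-- A function with positive Hessian is convex on rays from the origin. -/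
lemma le_of_hess_pos {f : V → ℝ} (hf : ContDiff ℝ ∞ f) (h : ∀ p q, q ≠ 0 → 0 < hess f p q) (p : V)
    {s : ℝ} (hs : s ∈ Icc (0 : ℝ) 1) : f (s • p) ≤ (1 - s) * f 0 + s * f p := by
  let L : ℝ →L[ℝ] V := ContinuousLinearMap.toSpanSingleton ℝ p
  let g : ℝ → ℝ := fun t => f (0 + L t)
  have hg : ContDiff ℝ ∞ g := hf.comp (contDiff_const.add L.contDiff)
  have hd : ∀ t, deriv (deriv g) t = hess f (0 + L t) p := by
    intro t
    have h1 : hess g t 1 = hess f (0 + L t) (L 1) :=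
      hess_comp_affine (hf.contDiffAt.of_le (by norm_cast)) 1
    have h2 := hess_comp (φ := g) (g := fun x : ℝ => x) (p := t)
      (hg.contDiffAt.of_le (by norm_cast)) contDiffAt_id 1
    have h3 : hess (fun x : ℝ => x) t 1 = 0 := by
      unfold hess
      have : fderiv ℝ (fun x : ℝ => x) = fun _ => ContinuousLinearMap.id ℝ ℝ :=
        funext fun x => fderiv_fun_id
      rw [this, fderiv_const_apply]
      rfl
    rw [h3, fderiv_fun_id] at h2
    have h4 : L 1 = p := by simp [L]
    rw [h4] at h1
    have h5 : hess g t 1 = deriv (deriv g) t := by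
      refine h2.trans ?_
      simp
    rw [← h5, h1]
  have hconv : ConvexOn ℝ univ g := by
    refine convexOn_of_deriv2_nonneg' convex_univ (hg.differentiable (by simp)).differentiableOn ?_ ?_
    · have hg2 : ContDiff ℝ ((1 + 1 : ℕ) : ℕ∞ω) g := hg.of_le (by norm_cast)
      have h7 := hg2.iterate_deriv' 1 1
      exact (h7.differentiable (by simp)).differentiableOn
    · intro t _
      simp only [Function.iterate_succ, Function.iterate_zero, Function.comp_apply, id_eq]
      rw [hd]
      by_cases hp : p = 0
      · rw [hp]; simp [hess]
      · exact (h _ _ hp).le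
  have h6 := hconv.2 (mem_univ 0) (mem_univ 1) (sub_nonneg.2 hs.2) hs.1 (by ring)
  simpa [g, L] using h6

end Hess

/-! ### Fibres of the cotangent bundle in charts. -/

section FibreCoordinates

variable {n : ℕ} {M : Type*} [TopologicalSpace M] [ChartedSpace (EuclideanSpace ℝ (Fin n)) M]
  [IsManifold (𝓡 n) ∞ M]

/-- The linear coordinate change on the cotangent space at `x` given by the chart at `x₀`. -/
def fibreCoord (x₀ x : M) : (EuclideanSpace ℝ (Fin n) →L[ℝ] ℝ) →L[ℝ] (EuclideanSpace ℝ (Fin n) →L[ℝ] ℝ) :=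
  (ContinuousLinearMap.compL ℝ (EuclideanSpace ℝ (Fin n)) (EuclideanSpace ℝ (Fin n)) ℝ).flip
    (md 𝓘(ℝ, EuclideanSpace ℝ (Fin n)) (𝓡 n) (extChartAt (𝓡 n) x₀).symm (extChartAt (𝓡 n) x₀ x))

lemma fibreCoord_injective {x₀ x : M} (hx : x ∈ (extChartAt (𝓡 n) x₀).source) :
    Function.Injective (fibreCoord (n := n) x₀ x) := by
  refine (injective_iff_map_eq_zero _).2 fun p hp => ?_
  ext v
  have h1 := congrArg (fun L : EuclideanSpace ℝ (Fin n) →L[ℝ] ℝ => L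
    (md (𝓡 n) 𝓘(ℝ, EuclideanSpace ℝ (Fin n)) (extChartAt (𝓡 n) x₀) x v)) hp
  have h2 : p (md 𝓘(ℝ, EuclideanSpace ℝ (Fin n)) (𝓡 n) (extChartAt (𝓡 n) x₀).symm
    (extChartAt (𝓡 n) x₀ x) (md (𝓡 n) 𝓘(ℝ, EuclideanSpace ℝ (Fin n)) (extChartAt (𝓡 n) x₀) x v)) = 0 := h1
  rwa [md_symm_md hx] at h2

lemma fibreCoord_surjective {x₀ x : M} (hx : x ∈ (extChartAt (𝓡 n) x₀).source) :
    Function.Surjective (fibreCoord (n := n) x₀ x) := by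
  intro v
  refine ⟨v.comp (md (𝓡 n) 𝓘(ℝ, EuclideanSpace ℝ (Fin n)) (extChartAt (𝓡 n) x₀) x), ?_⟩
  ext u
  have h1 := md_md_symm (J := 𝓡 n) ((extChartAt (𝓡 n) x₀).map_source hx) u
  rw [(extChartAt (𝓡 n) x₀).left_inv hx] at h1
  exact congrArg v h1

lemma extChartAt_cot_source (z₀ z : CotangentBundle (𝓡 n) M) :
    z ∈ (extChartAt (cotModel n) z₀).source ↔ z.proj ∈ (extChartAt (𝓡 n) z₀.proj).source := by
  rw [extChartAt_source, FiberBundle.chartedSpace_chartAt, extChartAt_source]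
  simp only [mfld_simps]
  refine ⟨fun h => h.1.1, fun h => ⟨⟨h, mem_univ _⟩, ?_⟩⟩
  rw [Trivialization.coe_fst']
  · exact h
  · exact ⟨h, mem_univ _⟩

/-- The charts of the cotangent bundle are linear on fibres. This allows fibre Hessians at varying
base points to be compared in one chart. -/
lemma extChartAt_cot (z₀ : CotangentBundle (𝓡 n) M) {x : M}
    (hx : x ∈ (extChartAt (𝓡 n) z₀.proj).source) (p : EuclideanSpace ℝ (Fin n) →L[ℝ] ℝ) :
    extChartAt (cotModel n) z₀ ⟨x, p⟩ = (extChartAt (𝓡 n) z₀.proj x, fibreCoord z₀.proj x p) := by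
  have h1 : extChartAt (cotModel n) z₀ ⟨x, p⟩ = (extChartAt (𝓡 n) z₀.1 x,
      (trivializationAt (EuclideanSpace ℝ (Fin n) →L[ℝ] ℝ)
        (fun x : M => TangentSpace (𝓡 n) x →L[ℝ] Trivial M ℝ x) z₀.1 ⟨x, p⟩).2) := by
    rw [extChartAt_coe, Function.comp_apply, hom_chart, hom_trivializationAt_apply]; rfl
  rw [h1]
  have h2 := trivializationAt_form_snd (J := 𝓡 n) (fun _ : M => p) hx
  refine Prod.ext rfl (h2.trans ?_)
  unfold formInChart
  rfl

/-- On fibres, a function is its coordinate expression composed with an affine map. -/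
lemma onFibre_eq (G : CotangentBundle (𝓡 n) M → ℝ) (z₀ : CotangentBundle (𝓡 n) M) {x : M}
    (hx : x ∈ (extChartAt (𝓡 n) z₀.proj).source) :
    onFibre G x = fun p => G ((extChartAt (cotModel n) z₀).symm ((extChartAt (𝓡 n) z₀.proj x, 0) +
      ContinuousLinearMap.inr ℝ (EuclideanSpace ℝ (Fin n)) _ (fibreCoord z₀.proj x p))) := by
  funext p
  have h1 : ((extChartAt (𝓡 n) z₀.proj x, 0) + ContinuousLinearMap.inr ℝ (EuclideanSpace ℝ (Fin n)) _
      (fibreCoord z₀.proj x p)) = extChartAt (cotModel n) z₀ ⟨x, p⟩ := by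
    rw [extChartAt_cot z₀ hx]
    simp
  rw [h1, (extChartAt (cotModel n) z₀).left_inv]
  · rfl
  · rw [extChartAt_cot_source]
    exact hx

lemma extChartAt_cot' (z₀ : CotangentBundle (𝓡 n) M) {x : M}
    (hx : x ∈ (extChartAt (𝓡 n) z₀.proj).source) (p : EuclideanSpace ℝ (Fin n) →L[ℝ] ℝ) :
    (extChartAt (𝓡 n) z₀.proj x, (0 : EuclideanSpace ℝ (Fin n) →L[ℝ] ℝ)) +
      ((ContinuousLinearMap.inr ℝ (EuclideanSpace ℝ (Fin n)) _).comp (fibreCoord z₀.proj x)) p =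
    extChartAt (cotModel n) z₀ ⟨x, p⟩ := by
  rw [extChartAt_cot z₀ hx]
  simp

lemma contDiffAt_inChart' {G : CotangentBundle (𝓡 n) M → ℝ} {z₀ z : CotangentBundle (𝓡 n) M}
    (hz : z ∈ (extChartAt (cotModel n) z₀).source) (hG : ContMDiffAt (cotModel n) 𝓘(ℝ, ℝ) ∞ G z) :
    ContDiffAt ℝ ∞ (fun y => G ((extChartAt (cotModel n) z₀).symm y))
      (extChartAt (cotModel n) z₀ z) :=
  contDiffAt_mapInChart (J' := 𝓘(ℝ, ℝ)) (x₁ := G z) hz (by simp) hG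

lemma contDiffAt_onFibre {G : CotangentBundle (𝓡 n) M → ℝ} {x : M}
    {p : EuclideanSpace ℝ (Fin n) →L[ℝ] ℝ} (hG : ContMDiffAt (cotModel n) 𝓘(ℝ, ℝ) ∞ G ⟨x, p⟩) :
    ContDiffAt ℝ ∞ (onFibre G x) p := by
  have hx : x ∈ (extChartAt (𝓡 n) (⟨x, p⟩ : CotangentBundle (𝓡 n) M).proj).source :=
    mem_extChartAt_source (I := 𝓡 n) x
  rw [onFibre_eq G ⟨x, p⟩ hx]
  have h1 := contDiffAt_inChart' (z₀ := ⟨x, p⟩) (mem_extChartAt_source _) hG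
  rw [← extChartAt_cot' ⟨x, p⟩ hx] at h1
  exact ContDiffAt.comp (f := fun p' => (extChartAt (𝓡 n) x x, (0 : EuclideanSpace ℝ (Fin n) →L[ℝ] ℝ)) +
      ((ContinuousLinearMap.inr ℝ (EuclideanSpace ℝ (Fin n)) _).comp (fibreCoord x x)) p') p h1
    (contDiffAt_const.add (ContinuousLinearMap.contDiff _).contDiffAt)

/-- A fibre is included into the chart by an affine map, so its Hessian is the chart Hessian on
vertical vectors, with no first-order correction. -/
lemma hess_onFibre {G : CotangentBundle (𝓡 n) M → ℝ} {z₀ : CotangentBundle (𝓡 n) M} {x : M}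
    (hx : x ∈ (extChartAt (𝓡 n) z₀.proj).source) {p : EuclideanSpace ℝ (Fin n) →L[ℝ] ℝ}
    (hG : ContMDiffAt (cotModel n) 𝓘(ℝ, ℝ) ∞ G ⟨x, p⟩) (q : EuclideanSpace ℝ (Fin n) →L[ℝ] ℝ) :
    hess (onFibre G x) p q = hess (fun y => G ((extChartAt (cotModel n) z₀).symm y))
        (extChartAt (cotModel n) z₀ ⟨x, p⟩) (0, fibreCoord z₀.proj x q) ∧
      fderiv ℝ (onFibre G x) p q = fderiv ℝ (fun y => G ((extChartAt (cotModel n) z₀).symm y))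
        (extChartAt (cotModel n) z₀ ⟨x, p⟩) (0, fibreCoord z₀.proj x q) := by
  have h1 := contDiffAt_inChart' (z₀ := z₀) ((extChartAt_cot_source z₀ ⟨x, p⟩).2 hx) hG
  rw [onFibre_eq G z₀ hx]
  rw [← extChartAt_cot' z₀ hx] at h1 ⊢
  constructor
  · exact hess_comp_affine (h1.of_le (by norm_cast)) q
  · have h2 := (h1.differentiableAt (by simp)).hasFDerivAt.comp p
      ((((ContinuousLinearMap.inr ℝ (EuclideanSpace ℝ (Fin n)) _).comp
        (fibreCoord z₀.proj x))).hasFDerivAt.const_add (extChartAt (𝓡 n) z₀.proj x, 0))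
    exact congrArg (fun L => L q) h2.fderiv

lemma t2Space_cotangentBundle [T2Space M] : T2Space (CotangentBundle (𝓡 n) M) := by
  refine ⟨fun a b hab => ?_⟩
  by_cases h : a.proj = b.proj
  · let e := trivializationAt (EuclideanSpace ℝ (Fin n) →L[ℝ] ℝ)
      (fun x : M => TangentSpace (𝓡 n) x →L[ℝ] Trivial M ℝ x) a.proj
    have ha : a ∈ e.source := e.mem_source.2 (FiberBundle.mem_baseSet_trivializationAt' a.proj)
    have hb : b ∈ e.source := e.mem_source.2 (by
      rw [← h]; exact FiberBundle.mem_baseSet_trivializationAt' a.proj)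
    have hne : e a ≠ e b := fun he => hab (e.injOn ha hb he)
    obtain ⟨U, V, hU, hV, haU, hbV, hd⟩ := t2_separation hne
    refine ⟨_, _, e.toOpenPartialHomeomorph.isOpen_inter_preimage hU,
      e.toOpenPartialHomeomorph.isOpen_inter_preimage hV, ⟨ha, haU⟩, ⟨hb, hbV⟩, ?_⟩
    exact (hd.preimage e).mono inter_subset_right inter_subset_right
  · obtain ⟨U, V, hU, hV, haU, hbV, hd⟩ := t2_separation h
    have hc : Continuous (TotalSpace.proj : CotangentBundle (𝓡 n) M → M) :=
      FiberBundle.continuous_proj _ _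
    exact ⟨_, _, hU.preimage hc, hV.preimage hc, haU, hbV, hd.preimage _⟩

end FibreCoordinates

/-! ### Compactness of the sublevels of Tonelli Hamiltonians. -/

section Sublevels

variable {n : ℕ} {M : Type*} [TopologicalSpace M] [ChartedSpace (EuclideanSpace ℝ (Fin n)) M]
  [IsManifold (𝓡 n) ∞ M]

lemma IsTonelli.tendsto_onFibre {H : CotangentBundle (𝓡 n) M → ℝ} (hH : IsTonelli H) (x : M) :
    Tendsto (onFibre H x) (cobounded _) atTop := by
  refine tendsto_atTop_mono' _ ?_ tendsto_norm_cobounded_atTop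
  filter_upwards [(hH.superlinear x).eventually_ge_atTop 1,
    tendsto_norm_cobounded_atTop.eventually_gt_atTop (0 : ℝ)] with _ h1 h2
  rwa [le_div_iff₀ h2, one_mul] at h1

lemma IsTonelli.contDiff_onFibre {H : CotangentBundle (𝓡 n) M → ℝ} (hH : IsTonelli H) (x : M) :
    ContDiff ℝ ∞ (onFibre H x) :=
  contDiff_iff_contDiffAt.2 fun _ => contDiffAt_onFibre (hH.smooth _)

/-- Superlinearity is given fibre by fibre; convexity makes it locally uniform. If H exceeds m + 1
on a sphere of the fibre and lies below m + 1 at the origin, convexity on rays forbids values below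
m + 1 outside the sphere. Both conditions are open in the base point. -/
lemma IsTonelli.exists_compact_local [T2Space M] [CompactSpace M]
    {H : CotangentBundle (𝓡 n) M → ℝ} (hH : IsTonelli H) (c : ℝ) (x₀ : M) :
    ∃ K ∈ 𝓝 x₀, ∃ C : Set (CotangentBundle (𝓡 n) M), IsCompact C ∧
      ∀ z : CotangentBundle (𝓡 n) M, H z ≤ c → z.proj ∈ K → z ∈ C := by
  let z₀ : CotangentBundle (𝓡 n) M := ⟨x₀, (0 : EuclideanSpace ℝ (Fin n) →L[ℝ] ℝ)⟩
  let φ := extChartAt (𝓡 n) x₀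
  let c₀ := extChartAt (cotModel n) z₀
  have hx₀ : x₀ ∈ φ.source := mem_extChartAt_source (I := 𝓡 n) x₀
  have hc₀ : ∀ x ∈ φ.source, ∀ p : EuclideanSpace ℝ (Fin n) →L[ℝ] ℝ,
      c₀ ⟨x, p⟩ = (φ x, fibreCoord (n := n) x₀ x p) := fun x hx p => extChartAt_cot z₀ hx p
  have hs : ∀ x ∈ φ.source, ∀ p : EuclideanSpace ℝ (Fin n) →L[ℝ] ℝ,
      (⟨x, p⟩ : CotangentBundle (𝓡 n) M) ∈ c₀.source := fun x hx p =>
    (extChartAt_cot_source z₀ ⟨x, p⟩).2 hx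
  let Hh : EuclideanSpace ℝ (Fin n) × (EuclideanSpace ℝ (Fin n) →L[ℝ] ℝ) → ℝ :=
    fun y => H (c₀.symm y)
  have hHh : ∀ x ∈ φ.source, ∀ p : EuclideanSpace ℝ (Fin n) →L[ℝ] ℝ,
      Hh (φ x, fibreCoord (n := n) x₀ x p) = H ⟨x, p⟩ := by
    intro x hx p
    simp only [Hh]
    rw [← hc₀ x hx, c₀.left_inv (hs x hx p)]
  have hcont : ∀ v, ContinuousAt Hh (φ x₀, v) := by
    intro v
    obtain ⟨p, hp⟩ := fibreCoord_surjective hx₀ v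
    have h1 := contDiffAt_inChart' (z₀ := z₀) (hs x₀ hx₀ p) (hH.smooth _)
    have h2 : extChartAt (cotModel n) z₀ ⟨x₀, p⟩ = (φ x₀, v) := by rw [← hp]; exact hc₀ x₀ hx₀ p
    rw [h2] at h1
    exact h1.continuousAt
  set m := max c (H z₀) with hm
  obtain ⟨R₀, hR₀⟩ : ∃ R₀ : ℝ, ∀ p : EuclideanSpace ℝ (Fin n) →L[ℝ] ℝ, R₀ ≤ ‖p‖ →
      m + 1 < H ⟨x₀, p⟩ := by
    have h1 := (hH.tendsto_onFibre x₀).eventually_gt_atTop (m + 1)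
    rw [← comap_norm_atTop, eventually_comap] at h1
    obtain ⟨R₀, hR₀⟩ := eventually_atTop.1 h1
    exact ⟨R₀, fun p hp => hR₀ _ hp p rfl⟩
  -- Large enough that a covector with coordinate norm R has fibre norm at least R₀.
  set R : ℝ := (‖fibreCoord (n := n) x₀ x₀‖ + 1) * (|R₀| + 1) with hR
  have hRpos : 0 < R := by positivity
  have hsph : ∀ v ∈ Metric.sphere (0 : EuclideanSpace ℝ (Fin n) →L[ℝ] ℝ) R,
      m + 1 < Hh (φ x₀, v) := by
    intro v hv
    obtain ⟨p, rfl⟩ := fibreCoord_surjective hx₀ v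
    rw [hHh x₀ hx₀]
    refine hR₀ p ?_
    rw [mem_sphere_zero_iff_norm] at hv
    have h1 := (fibreCoord (n := n) x₀ x₀).le_opNorm p
    rw [hv, hR] at h1
    by_contra hlt
    rw [not_le] at hlt
    have h2 : ‖p‖ ≤ |R₀| := hlt.le.trans (le_abs_self _)
    have h3 := mul_le_mul_of_nonneg_left h2 (norm_nonneg (fibreCoord (n := n) x₀ x₀))
    nlinarith [norm_nonneg (fibreCoord (n := n) x₀ x₀), abs_nonneg R₀]
  have hev1 : ∀ᶠ y in 𝓝 (φ x₀), ∀ v ∈ Metric.sphere (0 : EuclideanSpace ℝ (Fin n) →L[ℝ] ℝ) R,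
      m + 1 < Hh (y, v) :=
    (isCompact_sphere _ _).eventually_forall_of_forall_eventually fun v hv =>
      (hcont v).eventually (lt_mem_nhds (hsph v hv))
  have hev2 : ∀ᶠ y in 𝓝 (φ x₀), Hh (y, 0) < m + 1 := by
    have h1 : ContinuousAt (fun y => Hh (y, 0)) (φ x₀) :=
      ContinuousAt.comp (g := Hh) (f := fun y => (y, 0)) (hcont 0) (by fun_prop)
    refine h1.eventually (gt_mem_nhds ?_)
    have h2 := hHh x₀ hx₀ 0
    rw [map_zero] at h2
    exact lt_of_eq_of_lt h2 (lt_of_le_of_lt (le_max_right _ _) (lt_add_one _))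
  have hφc : ContinuousAt φ x₀ := continuousAt_extChartAt (I := 𝓡 n) x₀
  obtain ⟨K, hK, hKs, hKc⟩ := local_compact_nhds (inter_mem (inter_mem
    (hφc.eventually hev1) (hφc.eventually hev2))
    ((isOpen_extChartAt_source (I := 𝓡 n) x₀).mem_nhds hx₀))
  refine ⟨K, hK, c₀.symm '' ((φ '' K) ×ˢ Metric.closedBall 0 R), ?_, ?_⟩
  · have hKφ : IsCompact (φ '' K) := hKc.image_of_continuousOn
      ((continuousOn_extChartAt (I := 𝓡 n) x₀).mono fun x hx => (hKs hx).2)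
    refine (hKφ.prod (isCompact_closedBall _ _)).image_of_continuousOn
      ((continuousOn_extChartAt_symm (I := cotModel n) z₀).mono ?_)
    rintro ⟨y, v⟩ ⟨⟨x, hx, rfl⟩, -⟩
    obtain ⟨p, rfl⟩ := fibreCoord_surjective (hKs hx).2 v
    rw [← hc₀ x (hKs hx).2]
    exact c₀.map_source (hs x (hKs hx).2 p)
  · have key : ∀ (x : M) (p : EuclideanSpace ℝ (Fin n) →L[ℝ] ℝ), H ⟨x, p⟩ ≤ c → x ∈ K →
        (⟨x, p⟩ : CotangentBundle (𝓡 n) M) ∈ c₀.symm '' ((φ '' K) ×ˢ Metric.closedBall 0 R) := ?_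
    · exact fun z => key z.proj z.2
    intro x p hz hx
    obtain ⟨⟨h1, h2⟩, hxs⟩ := hKs hx
    refine ⟨c₀ ⟨x, p⟩, ?_, c₀.left_inv (hs x hxs p)⟩
    rw [hc₀ x hxs p]
    refine ⟨⟨x, hx, rfl⟩, ?_⟩
    rw [mem_closedBall_zero_iff]
    by_contra hlt
    rw [not_le] at hlt
    set v := fibreCoord (n := n) x₀ x p with hv
    have hvpos : 0 < ‖v‖ := hRpos.trans hlt
    have hsI : R / ‖v‖ ∈ Icc (0 : ℝ) 1 := ⟨by positivity, (div_le_one hvpos).2 hlt.le⟩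
    have h3 := le_of_hess_pos (hH.contDiff_onFibre x) (hH.convex x) p hsI
    have h4 : m + 1 < onFibre H x ((R / ‖v‖) • p) := by
      have h5 := h1 ((R / ‖v‖) • v) (by
        rw [mem_sphere_zero_iff_norm, norm_smul, Real.norm_of_nonneg hsI.1]
        field_simp)
      rwa [hv, ← map_smul, hHh x hxs] at h5
    have h5 : onFibre H x 0 < m + 1 := by
      have h2' : Hh (φ x, 0) < m + 1 := h2
      have h6 := hHh x hxs 0
      rw [map_zero] at h6
      rwa [h6] at h2'
    have h6 : onFibre H x p < m + 1 :=
      lt_of_le_of_lt (hz.trans (le_max_left _ _)) (lt_add_one _)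
    have h7 := mul_le_mul_of_nonneg_left h5.le (sub_nonneg.2 hsI.2)
    have h8 := mul_le_mul_of_nonneg_left h6.le hsI.1
    linarith

theorem IsTonelli.isCompact_sublevel [T2Space M] [CompactSpace M]
    {H : CotangentBundle (𝓡 n) M → ℝ} (hH : IsTonelli H) (c : ℝ) : IsCompact {z | H z ≤ c} := by
  have : T2Space (CotangentBundle (𝓡 n) M) := t2Space_cotangentBundle
  choose K hK C hC hKC using fun x : M => hH.exists_compact_local c x
  obtain ⟨T, hT⟩ := CompactSpace.elim_nhds_subcover K hK
  refine (T.isCompact_biUnion fun x _ => hC x).of_isClosed_subset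
    (isClosed_le hH.smooth.continuous continuous_const) fun z hz => ?_
  have h1 : z.proj ∈ ⋃ x ∈ T, K x := hT ▸ mem_univ _
  simp only [mem_iUnion] at h1 ⊢
  obtain ⟨x, hx, hzx⟩ := h1
  exact ⟨x, hx, hKC x z hz hzx⟩

/-- The compact sublevels at integer heights exhaust the bundle. The cutoff functions in
`exists_flow_near` need this. -/
lemma IsTonelli.sigmaCompactSpace [T2Space M] [CompactSpace M]
    {H : CotangentBundle (𝓡 n) M → ℝ} (hH : IsTonelli H) :
    SigmaCompactSpace (CotangentBundle (𝓡 n) M) := by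
  refine ⟨⟨fun n : ℕ => {z | H z ≤ n}, fun n => hH.isCompact_sublevel n, ?_⟩⟩
  refine eq_univ_of_forall fun z => ?_
  obtain ⟨n, hn⟩ := exists_nat_ge (H z)
  exact mem_iUnion.2 ⟨n, hn⟩

end Sublevels

/-! ### Positivity of fibre Hessians near the level. -/

section LevelHessian

/-- If the differentials of `g` and `h` are positively proportional along the level of `h` through
`y`, then so are their second derivatives on vectors tangent to the level. -/
lemma hess_proportional {W : Type*} [NormedAddCommGroup W] [NormedSpace ℝ W] [CompleteSpace W]
    {g h : W → ℝ} {y q : W} (hg : ContDiffAt ℝ ∞ g y) (hh : ContDiffAt ℝ ∞ h y)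
    (hne : fderiv ℝ h y ≠ 0)
    (hprop : ∀ᶠ x in 𝓝 y, h x = h y → ∃ c : ℝ, 0 < c ∧ ∀ w, fderiv ℝ g x w * c = fderiv ℝ h x w)
    (hq : fderiv ℝ h y q = 0) : ∃ c : ℝ, 0 < c ∧ hess g y q * c = hess h y q := by
  obtain ⟨e, he⟩ : ∃ e, fderiv ℝ h y e ≠ 0 := by
    by_contra hcon
    push Not at hcon
    exact hne (ContinuousLinearMap.ext hcon)
  obtain ⟨c, hc, hcp⟩ := hprop.self_of_nhds rfl
  -- β vanishes wherever dg and dh are proportional, hence on the level, so y is trivially a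
  -- constrained extremum of β. Lagrange multipliers make dβ a multiple of dh, and dβ(q) = 0 expands
  -- to the proportionality of the second derivatives.
  let β : W → ℝ := fun x => fderiv ℝ g x q * fderiv ℝ h x e - fderiv ℝ g x e * fderiv ℝ h x q
  have hg2 : ContDiffAt ℝ 1 (fderiv ℝ g) y := hg.fderiv_right (m := 1) (by norm_cast)
  have hh2 : ContDiffAt ℝ 1 (fderiv ℝ h) y := hh.fderiv_right (m := 1) (by norm_cast)
  have hβs : ContDiffAt ℝ 1 β y :=
    ((hg2.clm_apply contDiffAt_const).mul (hh2.clm_apply contDiffAt_const)).sub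
      ((hg2.clm_apply contDiffAt_const).mul (hh2.clm_apply contDiffAt_const))
  have hβ0 : ∀ᶠ x in 𝓝 y, h x = h y → β x = 0 := by
    filter_upwards [hprop] with x hx hxy
    obtain ⟨c, hc, hcp⟩ := hx hxy
    simp only [β]
    rw [← hcp, ← hcp]
    ring
  have hext : IsLocalExtrOn β {x | h x = h y} y := by
    refine Or.inl ?_
    have h1 := hβ0.self_of_nhds rfl
    change ∀ᶠ x in 𝓝[{x | h x = h y}] y, β y ≤ β x
    rw [eventually_nhdsWithin_iff]
    filter_upwards [hβ0] with x hx hxy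
    rw [h1, hx hxy]
  obtain ⟨a, b, hab, hLag⟩ := hext.exists_multipliers_of_hasStrictFDerivAt_1d
    (hh.hasStrictFDerivAt (by simp)) (hβs.hasStrictFDerivAt (by simp))
  have hb : b ≠ 0 := by
    rintro rfl
    have h1 := congrArg (fun L : W →L[ℝ] ℝ => L e) hLag
    simp at h1
    rcases h1 with rfl | h1
    · exact hab rfl
    · exact he h1
  have hβq : fderiv ℝ β y q = 0 := by
    have h1 := congrArg (fun L : W →L[ℝ] ℝ => L q) hLag
    simp [hq] at h1
    exact h1.resolve_left hb
  have d1 : ∀ v, HasFDerivAt (fun x => fderiv ℝ g x v) ((fderiv ℝ (fderiv ℝ g) y).flip v) y :=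
    fun v => by
      have := (hg2.differentiableAt (by simp)).hasFDerivAt.clm_apply (hasFDerivAt_const v y)
      simpa using this
  have d2 : ∀ v, HasFDerivAt (fun x => fderiv ℝ h x v) ((fderiv ℝ (fderiv ℝ h) y).flip v) y :=
    fun v => by
      have := (hh2.differentiableAt (by simp)).hasFDerivAt.clm_apply (hasFDerivAt_const v y)
      simpa using this
  have hβd : HasFDerivAt β _ y := ((d1 q).mul (d2 e)).sub ((d1 e).mul (d2 q))
  have hgq : fderiv ℝ g y q = 0 := by
    have := hcp q
    rw [hq] at this
    exact (mul_eq_zero.1 this).resolve_right hc.ne'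
  rw [hβd.fderiv] at hβq
  simp [hq, hgq] at hβq
  refine ⟨c, hc, ?_⟩
  have he' : fderiv ℝ g y e ≠ 0 := fun h0 => he (by rw [← hcp, h0, zero_mul])
  unfold hess
  refine mul_left_cancel₀ he' ?_
  rw [← hcp e] at hβq
  linarith

/-- At y₀ each unit vector has its own A: zero when dg annihilates it, a large one otherwise.
Positivity is open in (y, v) and monotone in A, so compactness of the sphere gives a common A, and
homogeneity of degree two extends it to all v ≠ 0. -/
lemma exists_hess_pos_near {V W : Type*} [NormedAddCommGroup V] [NormedSpace ℝ V]
    [FiniteDimensional ℝ V] [NormedAddCommGroup W] [NormedSpace ℝ W] {g : W → ℝ} {y₀ : W}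
    (hg : ContDiffAt ℝ ∞ g y₀) (ι : V →L[ℝ] W)
    (hpos : ∀ v ≠ 0, fderiv ℝ g y₀ (ι v) = 0 → 0 < hess g y₀ (ι v)) :
    ∃ A, ∀ᶠ y in 𝓝 y₀, ∀ v ≠ 0, 0 < hess g y (ι v) + A * (fderiv ℝ g y (ι v)) ^ 2 := by
  let Q : ℝ → W × V → ℝ := fun A p => hess g p.1 (ι p.2) + A * (fderiv ℝ g p.1 (ι p.2)) ^ 2
  have hQmono : ∀ p A A', A ≤ A' → Q A p ≤ Q A' p := fun p A A' hA => by
    simp only [Q]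
    gcongr
  have hQc : ∀ A v, ContinuousAt (Q A) (y₀, v) := by
    intro A v
    have h1 : ContinuousAt (fderiv ℝ g) y₀ := (hg.fderiv_right (m := 0) (by norm_cast)).continuousAt
    have h2 : ContinuousAt (fderiv ℝ (fderiv ℝ g)) y₀ :=
      ((hg.fderiv_right (m := 1) (by norm_cast)).fderiv_right (m := 0) (by norm_num)).continuousAt
    have h3 : ContinuousAt (fun p : W × V => ι p.2) (y₀, v) := by fun_prop
    have h4 : ContinuousAt (fun p : W × V => fderiv ℝ g p.1) (y₀, v) :=
      ContinuousAt.comp (g := fderiv ℝ g) (f := Prod.fst) h1 continuousAt_fst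
    have h5 : ContinuousAt (fun p : W × V => fderiv ℝ (fderiv ℝ g) p.1) (y₀, v) :=
      ContinuousAt.comp (g := fderiv ℝ (fderiv ℝ g)) (f := Prod.fst) h2 continuousAt_fst
    exact ((h5.clm_apply h3).clm_apply h3).add (continuousAt_const.mul ((h4.clm_apply h3).pow 2))
  have hQpos : ∀ v ≠ 0, ∃ A, 0 < Q A (y₀, v) := by
    intro v hv
    by_cases hd : fderiv ℝ g y₀ (ι v) = 0
    · refine ⟨0, ?_⟩
      simpa [Q] using hpos v hv hd
    · refine ⟨(|hess g y₀ (ι v)| + 1) / (fderiv ℝ g y₀ (ι v)) ^ 2, ?_⟩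
      simp only [Q]
      rw [div_mul_cancel₀ _ (pow_ne_zero 2 hd)]
      linarith [neg_abs_le (hess g y₀ (ι v))]
  obtain ⟨A, hA⟩ : ∃ A, ∀ᶠ y in 𝓝 y₀, ∀ v ∈ Metric.sphere (0 : V) 1, 0 < Q A (y, v) := by
    have : ProperSpace V := FiniteDimensional.proper_real V
    refine IsCompact.induction_on (isCompact_sphere (0 : V) 1)
      (p := fun s => ∃ A, ∀ᶠ y in 𝓝 y₀, ∀ v ∈ s, 0 < Q A (y, v)) ?_ ?_ ?_ ?_
    · exact ⟨0, by simp⟩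
    · rintro s t hst ⟨A, hA⟩
      exact ⟨A, hA.mono fun y hy v hv => hy v (hst hv)⟩
    · rintro s t ⟨A, hA⟩ ⟨A', hA'⟩
      refine ⟨max A A', ?_⟩
      filter_upwards [hA, hA'] with y h1 h2 v hv
      rcases hv with hv | hv
      · exact (h1 v hv).trans_le (hQmono _ _ _ (le_max_left _ _))
      · exact (h2 v hv).trans_le (hQmono _ _ _ (le_max_right _ _))
    · intro v hv
      obtain ⟨A, hA⟩ := hQpos v (by
        rintro rfl
        simp at hv)
      have h1 := (hQc A v).eventually (lt_mem_nhds hA)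
      rw [nhds_prod_eq, eventually_prod_iff] at h1
      obtain ⟨pa, hpa, pb, hpb, hab⟩ := h1
      exact ⟨{v | pb v}, mem_nhdsWithin_of_mem_nhds hpb, A, hpa.mono fun y hy v hv => hab hy hv⟩
  refine ⟨A, hA.mono fun y hy v hv => ?_⟩
  have hvpos : 0 < ‖v‖ := norm_pos_iff.2 hv
  have h3 := hy (‖v‖⁻¹ • v) (by
    rw [mem_sphere_zero_iff_norm, norm_smul, norm_inv, norm_norm, inv_mul_cancel₀ hvpos.ne'])
  have h4 : Q A (y, ‖v‖⁻¹ • v) = (‖v‖⁻¹) ^ 2 * Q A (y, v) := by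
    simp only [Q, hess, map_smul, smul_apply, smul_eq_mul]
    ring
  rw [h4] at h3
  exact pos_of_mul_pos_right h3 (by positivity)

variable {n : ℕ} {M : Type*} [TopologicalSpace M] [ChartedSpace (EuclideanSpace ℝ (Fin n)) M]
  [IsManifold (𝓡 n) ∞ M]

/-- Positivity of the fibre Hessian of `e^{AG}`, up to a factor. -/
def FibrePos (G : CotangentBundle (𝓡 n) M → ℝ) (A : ℝ) (z : CotangentBundle (𝓡 n) M) : Prop :=
  ∀ q : EuclideanSpace ℝ (Fin n) →L[ℝ] ℝ, q ≠ 0 →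
    0 < hess (onFibre G z.proj) z.2 q + A * (fderiv ℝ (onFibre G z.proj) z.2 q) ^ 2

lemma FibrePos.mono {G : CotangentBundle (𝓡 n) M → ℝ} {A A' : ℝ} {z : CotangentBundle (𝓡 n) M}
    (h : FibrePos G A z) (hA : A ≤ A') : FibrePos G A' z := fun q hq =>
  (h q hq).trans_le (by gcongr)

/-- In the chart at z₀, a vertical vector annihilated by dG is also annihilated by dH, and on it the
Hessian of G is a positive multiple of that of H by `hess_proportional`. So `exists_hess_pos_near`
applies to the vertical inclusion. -/
lemma exists_fibrePos_local {H G : CotangentBundle (𝓡 n) M → ℝ} (hH : IsTonelli H)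
    {z₀ : CotangentBundle (𝓡 n) M}
    (hG : ∀ᶠ z in 𝓝 z₀, ContMDiffAt (cotModel n) 𝓘(ℝ, ℝ) ∞ G z)
    (hne : md (cotModel n) 𝓘(ℝ, ℝ) H z₀ ≠ 0)
    (hprop : ∀ z, H z = H z₀ → ∃ c : ℝ, 0 < c ∧
      ∀ w, md (cotModel n) 𝓘(ℝ, ℝ) G z w * c = md (cotModel n) 𝓘(ℝ, ℝ) H z w) :
    ∃ A : ℝ, ∀ᶠ z in 𝓝 z₀, FibrePos G A z := by
  set c₀ := extChartAt (cotModel n) z₀ with hc₀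
  let g : EuclideanSpace ℝ (Fin n) × (EuclideanSpace ℝ (Fin n) →L[ℝ] ℝ) → ℝ := fun y => G (c₀.symm y)
  let h : EuclideanSpace ℝ (Fin n) × (EuclideanSpace ℝ (Fin n) →L[ℝ] ℝ) → ℝ := fun y => H (c₀.symm y)
  have hz₀ : z₀ ∈ c₀.source := mem_extChartAt_source (I := cotModel n) z₀
  have hgs : ContDiffAt ℝ ∞ g (c₀ z₀) := contDiffAt_inChart' hz₀ hG.self_of_nhds
  have hhs : ContDiffAt ℝ ∞ h (c₀ z₀) := contDiffAt_inChart' hz₀ (hH.smooth _)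
  have hcs : Tendsto c₀.symm (𝓝 (c₀ z₀)) (𝓝 z₀) := by
    have := continuousAt_extChartAt_symm (I := cotModel n) z₀
    rwa [ContinuousAt, extChartAt_to_inv] at this
  have htgt : c₀.target ∈ 𝓝 (c₀ z₀) :=
    (isOpen_extChartAt_target (I := cotModel n) z₀).mem_nhds (c₀.map_source hz₀)
  have hfd : ∀ f : CotangentBundle (𝓡 n) M → ℝ, ∀ y ∈ c₀.target,
      MDifferentiableAt (cotModel n) 𝓘(ℝ, ℝ) f (c₀.symm y) → ∀ w,
      fderiv ℝ (fun y => f (c₀.symm y)) y w = md (cotModel n) 𝓘(ℝ, ℝ) f (c₀.symm y)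
        (md 𝓘(ℝ, EuclideanSpace ℝ (Fin n) × (EuclideanSpace ℝ (Fin n) →L[ℝ] ℝ)) (cotModel n)
          c₀.symm y w) := by
    intro f y hy hf w
    rw [← md_eq_fderiv]
    exact md_comp_apply (g := f) (f := c₀.symm) y hf (extChartAt_symm_mdiff hy) w
  have hprop' : ∀ᶠ y in 𝓝 (c₀ z₀), h y = h (c₀ z₀) →
      ∃ c : ℝ, 0 < c ∧ ∀ w, fderiv ℝ g y w * c = fderiv ℝ h y w := by
    filter_upwards [htgt, hcs.eventually hG] with y hy hGy hyh
    have h1 : H (c₀.symm y) = H z₀ := by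
      have : H (c₀.symm y) = H (c₀.symm (c₀ z₀)) := hyh
      rwa [c₀.left_inv hz₀] at this
    obtain ⟨c, hc, hcp⟩ := hprop _ h1
    refine ⟨c, hc, fun w => ?_⟩
    rw [hfd G y hy hGy.mdiff, hfd H y hy (hH.smooth _).mdiff]
    exact hcp _
  have hne' : fderiv ℝ h (c₀ z₀) ≠ 0 := by
    intro h0
    refine hne (ContinuousLinearMap.ext fun v => ?_)
    have h1 := hfd H (c₀ z₀) (c₀.map_source hz₀) (hH.smooth _).mdiff
      (md (cotModel n) 𝓘(ℝ, EuclideanSpace ℝ (Fin n) × (EuclideanSpace ℝ (Fin n) →L[ℝ] ℝ)) c₀ z₀ v)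
    rw [hc₀, md_symm_md hz₀, ← hc₀, c₀.left_inv hz₀] at h1
    rw [← h1]
    have h0' : fderiv ℝ (fun y => H (c₀.symm y)) (c₀ z₀) = 0 := h0
    rw [h0']
    rfl
  obtain ⟨A, hA⟩ := exists_hess_pos_near hgs
    (ContinuousLinearMap.inr ℝ (EuclideanSpace ℝ (Fin n)) (EuclideanSpace ℝ (Fin n) →L[ℝ] ℝ))
    (fun v hv hd => by
      obtain ⟨c', hc', hcp'⟩ := hprop'.self_of_nhds rfl
      have hq : fderiv ℝ h (c₀ z₀) (ContinuousLinearMap.inr ℝ _ _ v) = 0 := by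
        rw [← hcp', hd, zero_mul]
      obtain ⟨c, hc, hcp⟩ := hess_proportional hgs hhs hne' hprop' hq
      have hx₀ : z₀.proj ∈ (extChartAt (𝓡 n) z₀.proj).source :=
        mem_extChartAt_source (I := 𝓡 n) z₀.proj
      obtain ⟨q, rfl⟩ := fibreCoord_surjective hx₀ v
      have h1 := (hess_onFibre (z₀ := z₀) (p := z₀.2) hx₀ (hH.smooth z₀) q).1
      have h2 : 0 < hess (onFibre H z₀.proj) z₀.2 q := hH.convex z₀.proj z₀.2 q (by
        rintro rfl
        exact hv (map_zero _))
      refine pos_of_mul_pos_left ?_ hc.le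
      rw [hcp]
      exact lt_of_lt_of_eq h2 h1)
  refine ⟨A, ?_⟩
  have hcc : ContinuousAt c₀ z₀ := continuousAt_extChartAt (I := cotModel n) z₀
  filter_upwards [hcc.eventually hA, hG,
    (isOpen_extChartAt_source (I := cotModel n) z₀).mem_nhds hz₀] with z hz hGz hzs q hq
  have hx := (extChartAt_cot_source z₀ z).1 hzs
  obtain ⟨h1, h2⟩ := hess_onFibre (p := z.2) hx hGz q
  have h3 := hz (fibreCoord z₀.proj z.proj q)
    fun h0 => hq (fibreCoord_injective hx (h0.trans (map_zero _).symm))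
  have e1 : hess (onFibre G z.proj) z.2 q = hess g (c₀ z)
    (ContinuousLinearMap.inr ℝ _ _ (fibreCoord z₀.proj z.proj q)) := h1
  have e2 : fderiv ℝ (onFibre G z.proj) z.2 q = fderiv ℝ g (c₀ z)
    (ContinuousLinearMap.inr ℝ _ _ (fibreCoord z₀.proj z.proj q)) := h2
  change 0 < hess (onFibre G z.proj) z.2 q + A * (fderiv ℝ (onFibre G z.proj) z.2 q) ^ 2
  rw [e1, e2]
  exact h3

theorem exists_fibrePos {H G : CotangentBundle (𝓡 n) M → ℝ} (hH : IsTonelli H) {k : ℝ}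
    (hS : IsCompact (H ⁻¹' {k}))
    (hG : ∀ᶠ z in 𝓝ˢ (H ⁻¹' {k}), ContMDiffAt (cotModel n) 𝓘(ℝ, ℝ) ∞ G z)
    (hne : ∀ z ∈ H ⁻¹' {k}, md (cotModel n) 𝓘(ℝ, ℝ) H z ≠ 0)
    (hprop : ∀ z ∈ H ⁻¹' {k}, ∃ c : ℝ, 0 < c ∧
      ∀ w, md (cotModel n) 𝓘(ℝ, ℝ) G z w * c = md (cotModel n) 𝓘(ℝ, ℝ) H z w) :
    ∃ A : ℝ, ∀ᶠ z in 𝓝ˢ (H ⁻¹' {k}), FibrePos G A z := by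
  have key : ∃ A : ℝ, ∃ U : Set (CotangentBundle (𝓡 n) M), IsOpen U ∧ H ⁻¹' {k} ⊆ U ∧
      ∀ z ∈ U, FibrePos G A z := by
    refine hS.induction_on (p := fun s => ∃ A : ℝ, ∃ U : Set (CotangentBundle (𝓡 n) M), IsOpen U ∧
      s ⊆ U ∧ ∀ z ∈ U, FibrePos G A z) ?_ ?_ ?_ ?_
    · exact ⟨0, ∅, isOpen_empty, subset_rfl, by simp⟩
    · rintro s t hst ⟨A, U, h1, h2, h3⟩
      exact ⟨A, U, h1, hst.trans h2, h3⟩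
    · rintro s t ⟨A, U, h1, h2, h3⟩ ⟨A', U', h1', h2', h3'⟩
      refine ⟨max A A', U ∪ U', h1.union h1', union_subset_union h2 h2', ?_⟩
      rintro z (hz | hz)
      · exact (h3 z hz).mono (le_max_left _ _)
      · exact (h3' z hz).mono (le_max_right _ _)
    · intro z hz
      obtain ⟨A, hA⟩ := exists_fibrePos_local hH (eventually_nhdsSet_iff_forall.1 hG z hz)
        (hne z hz) (fun z' hz' => hprop z' (hz'.trans hz))
      obtain ⟨U, hU, hUo, hzU⟩ := eventually_nhds_iff.1 hA
      exact ⟨U, mem_nhdsWithin_of_mem_nhds (hUo.mem_nhds hzU), A, U, hUo, subset_rfl, hU⟩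
  obtain ⟨A, U, h1, h2, h3⟩ := key
  exact ⟨A, eventually_nhdsSet_iff_exists.2 ⟨U, h1, h2, h3⟩⟩

end LevelHessian

/-! ### One-variable profiles for the gluing. -/

section Profiles

/-- A smooth convex regularization of `u ↦ max 0 u`. -/
lemma exists_smooth_posPart {τ : ℝ} (hτ : 0 < τ) : ∃ P : ℝ → ℝ, ContDiff ℝ ∞ P ∧
    (∀ u, 0 ≤ deriv P u ∧ deriv P u ≤ 1 ∧ 0 ≤ deriv (deriv P) u) ∧ (∀ u ≤ -τ, P u = 0) ∧
    (∀ u, τ ≤ u → P u = u) ∧ (∀ u, 0 ≤ P u) ∧ (∀ u, u ≤ P u) ∧ ∀ u ≤ τ, P u ≤ τ := by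
  let σ : ℝ → ℝ := fun t => Real.smoothTransition ((t + τ) / (2 * τ))
  have hσ : ContDiff ℝ ∞ σ := Real.smoothTransition.contDiff.comp
    ((contDiff_id.add contDiff_const).div_const _)
  have hσ0 : ∀ t ≤ -τ, σ t = 0 := fun t ht => Real.smoothTransition.zero_of_nonpos
    (div_nonpos_of_nonpos_of_nonneg (by linarith) (by linarith))
  have hσ1 : ∀ t, τ ≤ t → σ t = 1 := fun t ht => Real.smoothTransition.one_of_one_le
    ((one_le_div (by linarith)).2 (by linarith))
  -- This symmetry gives σ the integral τ over [-τ, τ], so P(τ) = τ and P continues exactly as the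
  -- identity.
  have hsym : ∀ t, σ t + σ (-t) = 1 := by
    intro t
    have e : (-t + τ) / (2 * τ) = 1 - (t + τ) / (2 * τ) := by field_simp; ring
    simp only [σ, e, Real.smoothTransition]
    set x := (t + τ) / (2 * τ)
    have hp := Real.smoothTransition.pos_denom x
    rw [sub_sub_cancel, add_comm (expNegInvGlue (1 - x)), ← add_div, div_self hp.ne']
  have hmono : Monotone σ := by
    intro s t hst
    exact Real.smoothTransition.monotone (by gcongr)
  let P : ℝ → ℝ := fun u => ∫ t in (-τ)..u, σ t
  have hP : ∀ u, HasDerivAt P (σ u) u := fun u =>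
    intervalIntegral.integral_hasDerivAt_right (hσ.continuous.intervalIntegrable _ _)
      (hσ.continuous.stronglyMeasurableAtFilter _ _) hσ.continuous.continuousAt
  have hdP : deriv P = σ := funext fun u => (hP u).deriv
  have hPs : ContDiff ℝ ∞ P := by
    rw [contDiff_infty_iff_deriv, hdP]
    exact ⟨fun u => (hP u).differentiableAt, hσ⟩
  have hPm : Monotone P := monotone_of_deriv_nonneg (fun u => (hP u).differentiableAt)
    fun u => by rw [hdP]; exact Real.smoothTransition.nonneg _
  have hQm : Antitone fun u => P u - u := by
    refine antitone_of_deriv_nonpos (fun u => ((hP u).sub (hasDerivAt_id u)).differentiableAt)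
      fun u => ?_
    have : deriv (fun u => P u - u) u = σ u - 1 := ((hP u).fun_sub (hasDerivAt_id' u)).deriv
    rw [this]
    linarith [Real.smoothTransition.le_one ((u + τ) / (2 * τ))]
  have hP0 : ∀ u ≤ -τ, P u = 0 := by
    intro u hu
    have : P u = ∫ t in (-τ)..u, (0 : ℝ) := by
      refine intervalIntegral.integral_congr fun t ht => hσ0 t ?_
      rw [uIcc_of_ge hu] at ht
      exact ht.2
    rw [this, intervalIntegral.integral_zero]
  have hPτ : P τ = τ := by
    have h1 : ∫ t in (-τ)..τ, σ (-t) = P τ := by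
      rw [intervalIntegral.integral_comp_neg, neg_neg]
    have h2 : ∫ t in (-τ)..τ, (σ t + σ (-t)) = 2 * τ := by
      simp only [hsym]
      rw [intervalIntegral.integral_const, smul_eq_mul]
      ring
    have hc : Continuous fun t => σ (-t) := hσ.continuous.comp continuous_neg
    rw [intervalIntegral.integral_add (hσ.continuous.intervalIntegrable _ _)
      (hc.intervalIntegrable _ _), h1] at h2
    have h3 : P τ + P τ = 2 * τ := h2
    linarith
  have hPge : ∀ u, τ ≤ u → P u = u := by
    intro u hu
    have h1 : P u - P τ = ∫ t in τ..u, σ t :=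
      intervalIntegral.integral_interval_sub_left (hσ.continuous.intervalIntegrable _ _)
        (hσ.continuous.intervalIntegrable _ _)
    have h2 : ∫ t in τ..u, σ t = ∫ t in τ..u, (1 : ℝ) := by
      refine intervalIntegral.integral_congr fun t ht => hσ1 t ?_
      rw [uIcc_of_le hu] at ht
      exact ht.1
    rw [h2, intervalIntegral.integral_const, smul_eq_mul, hPτ] at h1
    linarith
  refine ⟨P, hPs, fun u => ?_, hP0, hPge, fun u => ?_, fun u => ?_, fun u hu => ?_⟩
  · rw [hdP]
    exact ⟨Real.smoothTransition.nonneg _, Real.smoothTransition.le_one _, hmono.deriv_nonneg⟩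
  · rcases le_total u (-τ) with h | h
    · exact (hP0 u h).ge
    · exact (hP0 _ le_rfl).ge.trans (hPm h)
  · rcases le_total τ u with h | h
    · exact (hPge u h).ge
    · have := hQm h
      simp only [hPτ] at this
      linarith
  · exact (hPm hu).trans hPτ.le

/-- An increasing function equal to a flat affine function on the left of `k` and to the identity
on the right of `k + θ`, made convex by exponentiation. -/
lemma exists_profile (k : ℝ) {θ μ : ℝ} (hθ : 0 < θ) (hμ : 0 < μ) (hμ1 : μ < 1) :
    ∃ ψ : ℝ → ℝ, ContDiff ℝ ∞ ψ ∧ (∀ s ≤ k, ψ s = k + μ * (s - k - 1)) ∧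
      (∀ s, k + θ ≤ s → ψ s = s) ∧ (∀ s, 0 < deriv ψ s) ∧
      ∃ A₀ : ℝ, ∀ s, 0 ≤ deriv (deriv ψ) s + A₀ * deriv ψ s ^ 2 := by
  let χ : ℝ → ℝ := fun s => Real.smoothTransition ((s - k) / θ)
  have hχ : ContDiff ℝ ∞ χ := Real.smoothTransition.contDiff.comp
    ((contDiff_id.sub contDiff_const).div_const _)
  have hχ0 : ∀ s ≤ k, χ s = 0 := fun s hs => Real.smoothTransition.zero_of_nonpos
    (div_nonpos_of_nonpos_of_nonneg (by linarith) hθ.le)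
  have hχ1 : ∀ s, k + θ ≤ s → χ s = 1 := fun s hs => Real.smoothTransition.one_of_one_le
    ((one_le_div hθ).2 (by linarith))
  have hχn : ∀ s, 0 ≤ χ s := fun s => Real.smoothTransition.nonneg _
  have hχm : Monotone χ := fun s t hst => Real.smoothTransition.monotone (by gcongr)
  have hχd : ∀ s ≤ k, deriv χ s = 0 := fun s hs =>
    IsLocalMin.deriv_eq_zero (Eventually.of_forall fun t => (hχ0 s hs).le.trans (hχn t))
  -- Interpolation from k + μ(s - k - 1) to s. Their difference (1 - μ)(s - k) + μ is positive for s
  -- ≥ k, which keeps ψ' ≥ μ. The offset gives ψ(k) = k - μ < k, the gap by which the other function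
  -- wins on S.
  let ψ : ℝ → ℝ := fun s => k + μ * (s - k - 1) + χ s * ((1 - μ) * (s - k) + μ)
  have hψ : ContDiff ℝ ∞ ψ := by
    refine ContDiff.add ?_ (hχ.mul ?_) <;> fun_prop
  have hd : ∀ s, HasDerivAt ψ (μ + (deriv χ s * ((1 - μ) * (s - k) + μ) + χ s * (1 - μ))) s := by
    intro s
    have h1 : HasDerivAt (fun s : ℝ => k + μ * (s - k - 1)) μ s := by
      simpa using (((hasDerivAt_id' s).sub_const k).sub_const 1).const_mul μ |>.const_add k
    have h2 : HasDerivAt (fun s : ℝ => (1 - μ) * (s - k) + μ) (1 - μ) s := by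
      simpa using (((hasDerivAt_id' s).sub_const k).const_mul (1 - μ)).add_const μ
    exact h1.fun_add (((hχ.differentiable (by simp)) s).hasDerivAt.fun_mul h2)
  have hlow : ∀ s, μ ≤ deriv ψ s := by
    intro s
    rw [(hd s).deriv]
    rcases le_total s k with h | h
    · rw [hχd s h, hχ0 s h]
      linarith
    · have h1 : 0 ≤ (1 - μ) * (s - k) := mul_nonneg (by linarith) (by linarith)
      have h2 : 0 ≤ deriv χ s * ((1 - μ) * (s - k) + μ) :=
        mul_nonneg hχm.deriv_nonneg (by linarith)
      have h3 : 0 ≤ χ s * (1 - μ) := mul_nonneg (hχn s) (by linarith)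
      linarith
  have hleft : ∀ s ≤ k, ψ s = k + μ * (s - k - 1) := fun s hs => by
    simp only [ψ, hχ0 s hs]; ring
  have hright : ∀ s, k + θ ≤ s → ψ s = s := fun s hs => by
    simp only [ψ, hχ1 s hs]; ring
  have hdd : Continuous (deriv (deriv ψ)) :=
    ((contDiff_infty_iff_deriv.1 (contDiff_infty_iff_deriv.1 hψ).2).2).continuous
  have hout : ∀ s, s ∉ Icc k (k + θ) → deriv (deriv ψ) s = 0 := by
    intro s hs
    have hc : ∀ c : ℝ, deriv ψ =ᶠ[𝓝 s] (fun _ => c) → deriv (deriv ψ) s = 0 := fun c h => by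
      rw [h.deriv_eq, deriv_const]
    rcases lt_or_ge s k with h | h
    · refine hc μ ?_
      filter_upwards [Iio_mem_nhds h] with t ht
      rw [(hd t).deriv, hχd t (mem_Iio.1 ht).le, hχ0 t (mem_Iio.1 ht).le]
      ring
    · have h' : k + θ < s := by
        by_contra h2
        exact hs ⟨h, not_lt.1 h2⟩
      refine hc 1 ?_
      filter_upwards [Ioi_mem_nhds h'] with t ht
      have e : ψ =ᶠ[𝓝 t] fun s => s := by
        filter_upwards [Ioi_mem_nhds (mem_Ioi.1 ht)] with u hu
        exact hright u (mem_Ioi.1 hu).le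
      rw [e.deriv_eq, deriv_id'']
  obtain ⟨C, hC⟩ := (isCompact_Icc (a := k) (b := k + θ)).exists_bound_of_continuousOn
    hdd.continuousOn
  -- ψ'' vanishes outside [k, k + θ], is at least -|C| inside, and ψ' ≥ μ; hence A₀ = |C| / μ².
  refine ⟨ψ, hψ, hleft, hright, fun s => hμ.trans_le (hlow s), |C| / μ ^ 2, fun s => ?_⟩
  by_cases hs : s ∈ Icc k (k + θ)
  · have h1 := (abs_le.1 (hC s hs)).1
    have h2 : |C| ≤ |C| / μ ^ 2 * deriv ψ s ^ 2 := by
      have h3 : μ ^ 2 ≤ deriv ψ s ^ 2 := by gcongr; exact hlow s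
      calc |C| = |C| / μ ^ 2 * μ ^ 2 := by field_simp
        _ ≤ _ := by gcongr
    linarith [le_abs_self C]
  · rw [hout s hs]
    positivity

end Profiles

/-! ### Convexity of exponentials and of regularized maxima. -/

section HessianOfReparametrization

variable {V : Type*} [NormedAddCommGroup V] [NormedSpace ℝ V]

lemma hess_neg (f : V → ℝ) (p q : V) : hess (fun x => - f x) p q = - hess f p q := by
  unfold hess
  have h : fderiv ℝ (fun x => - f x) = fun x => - fderiv ℝ f x := funext fun x => fderiv_fun_neg
  rw [h, fderiv_fun_neg]
  rfl

/-- The Hessian is the hypothesis multiplied by A exp(Aρ(f)) > 0: the exponential contributes the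
square of the first derivative with weight A. -/
lemma hess_exp_comp_pos {ρ : ℝ → ℝ} (hρ : ContDiff ℝ ∞ ρ) {A B : ℝ} (hA : 0 < A) {f : V → ℝ}
    {p q : V} (hf : ContDiffAt ℝ 2 f p)
    (h : 0 < (deriv (deriv ρ) (f p) + A * deriv ρ (f p) ^ 2) * fderiv ℝ f p q ^ 2
      + deriv ρ (f p) * hess f p q) :
    0 < hess (fun x => Real.exp (A * ρ (f x)) + B) p q := by
  have hρ' : ∀ t, HasDerivAt ρ (deriv ρ t) t := fun t =>
    (hρ.differentiable (by simp) t).hasDerivAt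
  have hρ'' : ∀ t, HasDerivAt (deriv ρ) (deriv (deriv ρ) t) t := fun t =>
    ((contDiff_infty_iff_deriv.1 hρ).2.differentiable (by simp) t).hasDerivAt
  let φ : ℝ → ℝ := fun t => Real.exp (A * ρ t) + B
  have h1 : ∀ t, HasDerivAt φ (Real.exp (A * ρ t) * (A * deriv ρ t)) t := fun t =>
    ((hρ' t).const_mul A).exp.add_const B
  have h2 : deriv φ = fun t => Real.exp (A * ρ t) * (A * deriv ρ t) := funext fun t => (h1 t).deriv
  have h3 : deriv (deriv φ) (f p) = Real.exp (A * ρ (f p)) * (A * deriv ρ (f p)) *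
      (A * deriv ρ (f p)) + Real.exp (A * ρ (f p)) * (A * deriv (deriv ρ) (f p)) := by
    rw [h2]
    exact (((hρ' _).const_mul A).exp.fun_mul ((hρ'' _).const_mul A)).deriv
  have hφ : ContDiff ℝ ∞ φ := (Real.contDiff_exp.comp (contDiff_const.mul hρ)).add contDiff_const
  have h4 := hess_comp (φ := φ) (hφ.contDiffAt.of_le (by norm_cast)) hf q
  rw [h3, h2] at h4
  have h5 : hess (fun x => Real.exp (A * ρ (f x)) + B) p q = _ := h4
  rw [h5]
  have h6 : 0 < Real.exp (A * ρ (f p)) * A := by positivity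
  refine (mul_pos h6 h).trans_eq ?_
  ring

/-- With d = P'(x - y) in [0, 1], the Hessian is the convex combination of those of y and x with
weights 1 - d and d, plus P''(x - y) times a square. -/
lemma hess_regMax_pos {P : ℝ → ℝ} (hP : ContDiff ℝ ∞ P)
    (hP' : ∀ u, 0 ≤ deriv P u ∧ deriv P u ≤ 1 ∧ 0 ≤ deriv (deriv P) u) {x y : V → ℝ} {p q : V}
    (hx : ContDiffAt ℝ 2 x p) (hy : ContDiffAt ℝ 2 y p) (hxp : 0 < hess x p q)
    (hyp : 0 < hess y p q) : 0 < hess (fun v => y v + P (x v + - y v)) p q := by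
  have hxy : ContDiffAt ℝ 2 (fun v => x v + - y v) p := hx.add hy.neg
  have hP2 : ContDiffAt ℝ 2 P (x p + - y p) := hP.contDiffAt.of_le (by norm_cast)
  have h1 := hess_comp (φ := P) (g := fun v => x v + - y v) hP2 hxy q
  have h2 := hess_add (f := y) (g := fun v => P (x v + - y v)) hy
    (ContDiffAt.comp (g := P) (f := fun v => x v + - y v) p hP2 hxy) q
  have h3 : hess (fun v => x v + - y v) p q = hess x p q - hess y p q := by
    rw [hess_add hx hy.neg, hess_neg]
    ring
  rw [h2, h1, h3]
  obtain ⟨a, b, c⟩ := hP' (x p + - y p)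
  set d := deriv P (x p + - y p)
  have h4 : 0 ≤ deriv (deriv P) (x p + - y p) * fderiv ℝ (fun v => x v + - y v) p q ^ 2 := by
    positivity
  have h5 : 0 < hess y p q * (1 - d) + hess x p q * d := by
    rcases eq_or_lt_of_le b with h | h
    · rw [h]; linarith
    · have := mul_pos hyp (sub_pos.2 h)
      have := mul_nonneg hxp.le a
      linarith
  linarith

end HessianOfReparametrization

/-! ### The regularized maximum is a Tonelli Hamiltonian. -/

section Gluing

variable {n : ℕ} {M : Type*} [TopologicalSpace M] [ChartedSpace (EuclideanSpace ℝ (Fin n)) M]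
  [IsManifold (𝓡 n) ∞ M]

/-- Sublevels are compact, so |H - k| is bounded away from 0 on the part of {H ≤ k + 1} outside the
interior of W. The bound 1 on η keeps the tube inside this sublevel. -/
lemma IsTonelli.exists_tube [T2Space M] [CompactSpace M] {H : CotangentBundle (𝓡 n) M → ℝ}
    (hH : IsTonelli H) {k : ℝ} {W : Set (CotangentBundle (𝓡 n) M)} (hW : W ∈ 𝓝ˢ (H ⁻¹' {k})) :
    ∃ η > 0, ∀ z, |H z - k| < η → z ∈ W := by
  have hc : Continuous H := hH.smooth.continuous
  have hK : IsCompact ({z | H z ≤ k + 1} \ interior W) := (hH.isCompact_sublevel _).diff isOpen_interior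
  obtain ⟨c, hc0, hcK⟩ := hK.exists_forall_le' (f := fun z => |H z - k|) (a := 0)
    (by fun_prop) (by
      rintro z ⟨-, hz⟩
      refine abs_pos.2 fun h => hz ?_
      exact subset_interior_iff_mem_nhdsSet.2 hW (sub_eq_zero.1 h))
  refine ⟨min c 1, by positivity, fun z hz => ?_⟩
  by_contra hzW
  have h1 := hcK z ⟨?_, fun h => hzW (interior_subset h)⟩
  · exact absurd (hz.trans_le (min_le_left _ _)) (not_lt.2 h1)
  · have := (abs_lt.1 (hz.trans_le (min_le_right _ _))).2
    exact (sub_le_iff_le_add'.1 this.le)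

/-- The regularized maximum of `exp (A (k + κ G)) + 1` and `exp (A ψ(H)) + 1` in the tube
`|H - k| < η`, extended by the second function. -/
def gluedHam (H G : CotangentBundle (𝓡 n) M → ℝ) (k η κ A : ℝ) (ψ P : ℝ → ℝ)
    (z : CotangentBundle (𝓡 n) M) : ℝ :=
  (Real.exp (A * ψ (H z)) + 1) + open Classical in if |H z - k| < η then
    P ((Real.exp (A * (k + κ * G z)) + 1) + - (Real.exp (A * ψ (H z)) + 1)) else 0

lemma contDiff_exp_comp {ρ : ℝ → ℝ} (hρ : ContDiff ℝ ∞ ρ) (A B : ℝ) :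
    ContDiff ℝ ∞ fun t => Real.exp (A * ρ t) + B :=
  (Real.contDiff_exp.comp (contDiff_const.mul hρ)).add contDiff_const

variable {H G : CotangentBundle (𝓡 n) M → ℝ} {k η κ A : ℝ} {ψ P : ℝ → ℝ}

lemma gluedHam_of_far {z : CotangentBundle (𝓡 n) M} (hedge : ∀ z, η / 2 ≤ |H z - k| → |H z - k| < η →
      P ((Real.exp (A * (k + κ * G z)) + 1) + - (Real.exp (A * ψ (H z)) + 1)) = 0)
    (hz : η / 2 ≤ |H z - k|) : gluedHam H G k η κ A ψ P z = Real.exp (A * ψ (H z)) + 1 := by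
  unfold gluedHam
  split_ifs with h
  · rw [hedge z hz h, add_zero]
  · rw [add_zero]

lemma gluedHam_of_near {z : CotangentBundle (𝓡 n) M} (hz : |H z - k| < η) :
    gluedHam H G k η κ A ψ P z = (Real.exp (A * ψ (H z)) + 1) +
      P ((Real.exp (A * (k + κ * G z)) + 1) + - (Real.exp (A * ψ (H z)) + 1)) := by
  unfold gluedHam
  rw [if_pos hz]

/-- The two branches agree on the overlap η/2 ≤ |H - k| < η, so smoothness and convexity are checked
separately in the tube and away from it. Far out in each fibre the function is exp(AH) + 1, which
dominates AH and inherits superlinearity. -/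
theorem isTonelli_gluedHam (hH : IsTonelli H) (hη : 0 < η) (hκ : 0 < κ) (hA : 0 < A)
    (hG : ∀ z, |H z - k| < η → ContMDiffAt (cotModel n) 𝓘(ℝ, ℝ) ∞ G z)
    (hGp : ∀ z, |H z - k| < η → FibrePos G (A * κ) z)
    (hψ : ContDiff ℝ ∞ ψ) (hψ' : ∀ s, 0 < deriv ψ s)
    (hψ'' : ∀ s, 0 ≤ deriv (deriv ψ) s + A * deriv ψ s ^ 2) (hψr : ∀ s, k + η ≤ s → ψ s = s)
    (hP : ContDiff ℝ ∞ P)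
    (hP' : ∀ u, 0 ≤ deriv P u ∧ deriv P u ≤ 1 ∧ 0 ≤ deriv (deriv P) u)
    (hedge : ∀ z, η / 2 ≤ |H z - k| → |H z - k| < η →
      P ((Real.exp (A * (k + κ * G z)) + 1) + - (Real.exp (A * ψ (H z)) + 1)) = 0) :
    IsTonelli (gluedHam H G k η κ A ψ P) := by
  have hc : Continuous H := hH.smooth.continuous
  have hy : ContDiff ℝ ∞ fun t => Real.exp (A * ψ t) + 1 := contDiff_exp_comp hψ A 1
  have hρ : ContDiff ℝ ∞ fun t : ℝ => k + κ * t := by fun_prop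
  have hx : ContDiff ℝ ∞ fun t => Real.exp (A * (k + κ * t)) + 1 := contDiff_exp_comp hρ A 1
  refine ⟨fun z => ?_, fun x p q hq => ?_, fun x => ?_⟩
  · have hyz : ContMDiffAt (cotModel n) 𝓘(ℝ, ℝ) ∞ (fun z => Real.exp (A * ψ (H z)) + 1) z :=
      ContMDiffAt.comp (g := fun t => Real.exp (A * ψ t) + 1) (f := H) z hy.contMDiff.contMDiffAt
        (hH.smooth z)
    by_cases hz : |H z - k| < η
    · have hxz : ContMDiffAt (cotModel n) 𝓘(ℝ, ℝ) ∞
          (fun z => Real.exp (A * (k + κ * G z)) + 1) z :=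
        ContMDiffAt.comp (g := fun t => Real.exp (A * (k + κ * t)) + 1) (f := G) z
          hx.contMDiff.contMDiffAt (hG z hz)
      have hs : ContMDiffAt (cotModel n) 𝓘(ℝ, ℝ) ∞ (fun z => (Real.exp (A * ψ (H z)) + 1) +
          P ((Real.exp (A * (k + κ * G z)) + 1) + - (Real.exp (A * ψ (H z)) + 1))) z :=
        hyz.add (ContMDiffAt.comp (g := P) z hP.contMDiff.contMDiffAt (hxz.add hyz.neg))
      refine hs.congr_of_eventuallyEq ?_
      have : ∀ᶠ z in 𝓝 z, |H z - k| < η := by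
        have : Continuous fun z => |H z - k| := by fun_prop
        exact this.continuousAt.eventually_lt_const hz
      filter_upwards [this] with z' hz'
      exact gluedHam_of_near hz'
    · refine hyz.congr_of_eventuallyEq ?_
      have : ∀ᶠ z in 𝓝 z, η / 2 < |H z - k| := by
        have : Continuous fun z => |H z - k| := by fun_prop
        exact this.continuousAt.eventually_const_lt (by linarith)
      filter_upwards [this] with z' hz'
      exact gluedHam_of_far hedge hz'.le
  · have hHx := hH.contDiff_onFibre x
    have hHp : ContDiffAt ℝ 2 (onFibre H x) p := hHx.contDiffAt.of_le (by norm_cast)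
    have hyp : 0 < hess (fun p => Real.exp (A * ψ (onFibre H x p)) + 1) p q := by
      refine hess_exp_comp_pos hψ hA hHp ?_
      have h1 : 0 < hess (onFibre H x) p q := hH.convex x p q hq
      have := mul_nonneg (hψ'' (onFibre H x p)) (sq_nonneg (fderiv ℝ (onFibre H x) p q))
      have := mul_pos (hψ' (onFibre H x p)) h1
      linarith
    change 0 < hess (onFibre (gluedHam H G k η κ A ψ P) x) p q
    by_cases hz : |onFibre H x p - k| < η
    · have hev : ∀ᶠ p in 𝓝 p, |onFibre H x p - k| < η := by
        have hc := hHx.continuous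
        have : Continuous fun p => |onFibre H x p - k| := by fun_prop
        exact this.continuousAt.eventually_lt_const hz
      have e : onFibre (gluedHam H G k η κ A ψ P) x =ᶠ[𝓝 p] fun p =>
          (Real.exp (A * ψ (onFibre H x p)) + 1) + P ((Real.exp (A * (k + κ * onFibre G x p)) + 1) +
            - (Real.exp (A * ψ (onFibre H x p)) + 1)) := by
        filter_upwards [hev] with p' hp'
        exact gluedHam_of_near hp'
      rw [hess_congr e]
      have hGp2 : ContDiffAt ℝ 2 (onFibre G x) p :=
        (contDiffAt_onFibre (hG ⟨x, p⟩ hz)).of_le (by norm_cast)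
      have hd : deriv (fun t : ℝ => k + κ * t) = fun _ => κ := funext fun t => by
        simp
      have hxp : 0 < hess (fun p => Real.exp (A * (k + κ * onFibre G x p)) + 1) p q := by
        refine hess_exp_comp_pos hρ hA hGp2 ?_
        rw [hd, deriv_const]
        have h1 : 0 < hess (onFibre G x) p q + A * κ * (fderiv ℝ (onFibre G x) p q) ^ 2 :=
          hGp ⟨x, p⟩ hz q hq
        refine (mul_pos hκ h1).trans_eq ?_
        ring
      exact hess_regMax_pos hP hP'
        (ContDiffAt.comp (g := fun t => Real.exp (A * (k + κ * t)) + 1) (f := onFibre G x) p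
          (hx.contDiffAt.of_le (by norm_cast)) hGp2)
        (ContDiffAt.comp (g := fun t => Real.exp (A * ψ t) + 1) (f := onFibre H x) p
          (hy.contDiffAt.of_le (by norm_cast)) hHp) hxp hyp
    · have hev : ∀ᶠ p in 𝓝 p, η / 2 < |onFibre H x p - k| := by
        have hc := hHx.continuous
        have : Continuous fun p => |onFibre H x p - k| := by fun_prop
        exact this.continuousAt.eventually_const_lt (by linarith)
      have e : onFibre (gluedHam H G k η κ A ψ P) x =ᶠ[𝓝 p] fun p =>
          Real.exp (A * ψ (onFibre H x p)) + 1 := by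
        filter_upwards [hev] with p' hp'
        exact gluedHam_of_far hedge hp'.le
      rw [hess_congr e]
      exact hyp
  · have h1 : Tendsto (fun p => A * (onFibre H x p / ‖p‖)) (cobounded _) atTop :=
      (hH.superlinear x).const_mul_atTop hA
    refine tendsto_atTop_mono' _ ?_ h1
    filter_upwards [(hH.tendsto_onFibre x).eventually_ge_atTop (k + η)] with p hp
    have h2 : gluedHam H G k η κ A ψ P ⟨x, p⟩ = Real.exp (A * ψ (onFibre H x p)) + 1 := by
      refine gluedHam_of_far hedge ?_
      have : η ≤ onFibre H x p - k := by linarith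
      have : η ≤ |onFibre H x p - k| := this.trans (le_abs_self _)
      change η / 2 ≤ |onFibre H x p - k|
      linarith
    rw [← mul_div_assoc]
    refine div_le_div_of_nonneg_right ?_ (norm_nonneg p)
    change _ ≤ gluedHam H G k η κ A ψ P ⟨x, p⟩
    rw [h2, hψr _ hp]
    linarith [Real.add_one_le_exp (A * onFibre H x p)]

end Gluing

/-! ### Choice of the gluing constants. -/

section GluingExistence

variable {n : ℕ} {M : Type*} [TopologicalSpace M] [T2Space M] [CompactSpace M]
  [ChartedSpace (EuclideanSpace ℝ (Fin n)) M] [IsManifold (𝓡 n) ∞ M]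

/-- A function `G` that vanishes to first order like `H - k` along the regular level `H = k` of a
Tonelli Hamiltonian can be reparametrized and extended to a Tonelli Hamiltonian which has the same
levels as `H` away from a neighbourhood of this level. -/
theorem exists_tonelli_extension {H G : CotangentBundle (𝓡 n) M → ℝ} (hH : IsTonelli H) {k : ℝ}
    (hne : ∀ z ∈ H ⁻¹' {k}, md (cotModel n) 𝓘(ℝ, ℝ) H z ≠ 0)
    {W₀ : Set (CotangentBundle (𝓡 n) M)} (hW₀ : W₀ ∈ 𝓝ˢ (H ⁻¹' {k}))
    (hG : ∀ z ∈ W₀, ContMDiffAt (cotModel n) 𝓘(ℝ, ℝ) ∞ G z)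
    (hGpos : ∀ z ∈ W₀, k < H z → 0 < G z) (hGneg : ∀ z ∈ W₀, H z < k → G z < 0)
    (hG0 : ∀ z ∈ H ⁻¹' {k}, G z = 0)
    (hprop : ∀ z ∈ H ⁻¹' {k}, ∃ c : ℝ, 0 < c ∧
      ∀ w, md (cotModel n) 𝓘(ℝ, ℝ) G z w * c = md (cotModel n) 𝓘(ℝ, ℝ) H z w) :
    ∃ (H' : CotangentBundle (𝓡 n) M → ℝ) (A κ ε : ℝ), IsTonelli H' ∧ 0 < A ∧ 0 < κ ∧ 0 < ε ∧
      (∀ r ≤ k - ε, H' ⁻¹' {r} = H ⁻¹' {r}) ∧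
      (∀ r ≥ k + ε, H' ⁻¹' {Real.exp (A * r) + 1} = H ⁻¹' {r}) ∧
      H' ⁻¹' {Real.exp (A * k) + 1} = H ⁻¹' {k} ∧
      ∀ᶠ z in 𝓝ˢ (H ⁻¹' {k}), H' z = Real.exp (A * (k + κ * G z)) + 1 := by
  have hc : Continuous H := hH.smooth.continuous
  have hS : IsCompact (H ⁻¹' {k}) :=
    (hH.isCompact_sublevel k).of_isClosed_subset (isClosed_singleton.preimage hc)
      fun z hz => le_of_eq hz
  obtain ⟨A₀, hA₀⟩ := exists_fibrePos hH hS (Filter.mem_of_superset hW₀ hG) hne hprop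
  obtain ⟨η₀, hη₀, htube⟩ := hH.exists_tube (inter_mem hW₀ hA₀)
  obtain ⟨η, hη, hηη₀⟩ : ∃ η > 0, η < η₀ := ⟨η₀ / 2, by positivity, by linarith⟩
  have ht : ∀ z, |H z - k| ≤ η → z ∈ W₀ ∧ FibrePos G A₀ z := fun z hz =>
    htube z (hz.trans_lt hηη₀)
  have hGc : ∀ z, |H z - k| ≤ η → ContinuousAt G z := fun z hz =>
    (hG z (ht z hz).1).continuousAt
  have hK : IsCompact ({z | H z ≤ k + η} ∩ {z | |H z - k| ≤ η}) :=
    (hH.isCompact_sublevel _).inter_right (isClosed_le (by fun_prop) continuous_const)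
  obtain ⟨C, hC⟩ := hK.exists_bound_of_continuousOn (f := G)
    fun z hz => (hGc z hz.2).continuousWithinAt
  have hC' : ∀ z, |H z - k| ≤ η → |G z| ≤ |C| := fun z hz =>
    (hC z ⟨show H z ≤ k + η by linarith [(abs_le.1 hz).2], hz⟩).trans (le_abs_self C)
  -- κ shrinks G so that k + κG ≤ k + η/4 on the tube, below the value H ≥ k + η/2 of ψ(H) at the
  -- upper edge.
  obtain ⟨κ, hκ, hκη⟩ : ∃ κ > 0, κ * |C| ≤ η / 4 := by
    refine ⟨η / (4 * (|C| + 1)), by positivity, ?_⟩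
    rw [div_mul_eq_mul_div, div_le_div_iff₀ (by positivity) (by norm_num)]
    nlinarith [abs_nonneg C]
  have hκG : ∀ z, |H z - k| ≤ η → κ * G z ≤ η / 4 := fun z hz =>
    (mul_le_mul_of_nonneg_left ((le_abs_self _).trans (hC' z hz)) hκ.le).trans hκη
  have hK' : IsCompact (({z | H z ≤ k + η} ∩ {z | |H z - k| ≤ η}) ∩ {z | H z - k ≤ -(η / 2)}) :=
    hK.inter_right (isClosed_le (by fun_prop) continuous_const)
  -- Uniform negativity of G at the lower edge of the tube.
  obtain ⟨g₀, hg₀, hg₀G⟩ := hK'.exists_forall_le' (f := fun z => - G z) (a := 0)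
    (fun z hz => (hGc z hz.1.2).neg.continuousWithinAt) (by
      rintro z ⟨hz, hz'⟩
      have hz'' : H z - k ≤ -(η / 2) := hz'
      exact neg_pos.2 (hGneg z (ht z hz.2).1 (by linarith)))
  have hg₀G' : ∀ z, |H z - k| ≤ η → H z - k ≤ -(η / 2) → κ * G z ≤ - (κ * g₀) := by
    intro z hz hz'
    have h1 := hg₀G z ⟨⟨show H z ≤ k + η by linarith, hz⟩, hz'⟩
    have h2 := mul_le_mul_of_nonneg_left h1 hκ.le
    linarith
  -- ψ is so flat that ψ(H) ≥ k - κg₀/2 on the tube below k, above the value k + κG ≤ k - κg₀ at the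
  -- lower edge.
  obtain ⟨μ, hμ, hμ1, hμη⟩ : ∃ μ > 0, μ < 1 ∧ μ * (η + 1) ≤ κ * g₀ / 2 := by
    refine ⟨min (1 / 2) (κ * g₀ / 2 / (η + 1)), by positivity,
      (min_le_left _ _).trans_lt (by norm_num), ?_⟩
    rw [← le_div_iff₀ (by positivity)]
    exact min_le_right _ _
  obtain ⟨ψ, hψ, hψl, hψr, hψ', A₁, hA₁⟩ := exists_profile k (half_pos hη) hμ hμ1
  obtain ⟨A, hA, hAA₀, hAA₁⟩ : ∃ A > 0, A₀ ≤ A * κ ∧ A₁ ≤ A := by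
    refine ⟨max 1 (max (A₀ / κ) A₁), by positivity, ?_, (le_max_right _ _).trans (le_max_right _ _)⟩
    rw [← div_le_iff₀ hκ]
    exact (le_max_left _ _).trans (le_max_right _ _)
  have hexp : ∀ s t, s < t → 0 < Real.exp (A * t) - Real.exp (A * s) := fun s t hst =>
    sub_pos.2 (Real.exp_lt_exp.2 (mul_lt_mul_of_pos_left hst hA))
  have hexple : ∀ s t, s ≤ t → Real.exp (A * s) ≤ Real.exp (A * t) := fun s t hst =>
    Real.exp_le_exp.2 (mul_le_mul_of_nonneg_left hst hA.le)
  -- The first two bounds are the margins at the upper and lower edges, where P has to vanish. The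
  -- third is half the gap at S, where P has to be the identity; it also keeps F below exp(Ak) + 1
  -- where H < k.
  obtain ⟨τ, hτ, hτ1, hτ2, hτ3⟩ : ∃ τ > 0,
      τ ≤ Real.exp (A * (k + η / 2)) - Real.exp (A * (k + η / 4)) ∧
      τ ≤ Real.exp (A * (k - κ * g₀ / 2)) - Real.exp (A * (k - κ * g₀)) ∧
      2 * τ ≤ Real.exp (A * k) - Real.exp (A * (k - μ)) := by
    have hκg : 0 < κ * g₀ := by positivity
    have h1 := hexp (k + η / 4) (k + η / 2) (by linarith)
    have h2 := hexp (k - κ * g₀) (k - κ * g₀ / 2) (by linarith)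
    have h3 := half_pos (hexp (k - μ) k (by linarith))
    refine ⟨min (Real.exp (A * (k + η / 2)) - Real.exp (A * (k + η / 4)))
      (min (Real.exp (A * (k - κ * g₀ / 2)) - Real.exp (A * (k - κ * g₀)))
        ((Real.exp (A * k) - Real.exp (A * (k - μ))) / 2)), lt_min h1 (lt_min h2 h3),
      min_le_left _ _, (min_le_right _ _).trans (min_le_left _ _), ?_⟩
    rw [mul_comm, ← le_div_iff₀ two_pos]
    exact (min_le_right _ _).trans (min_le_right _ _)
  obtain ⟨P, hP, hP', hP0, hPid, hPnn, hPge, hPle⟩ := exists_smooth_posPart hτ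
  have hedge : ∀ z, η / 2 ≤ |H z - k| → |H z - k| < η →
      P ((Real.exp (A * (k + κ * G z)) + 1) + - (Real.exp (A * ψ (H z)) + 1)) = 0 := by
    intro z hz hz'
    refine hP0 _ ?_
    rcases le_abs'.1 hz with h | h
    · have h1 := hexple _ _ (show k + κ * G z ≤ k - κ * g₀ by
        linarith [hg₀G' z hz'.le h])
      have h2 := hexple (k - κ * g₀ / 2) (ψ (H z)) (by
        rw [hψl _ (by linarith)]
        have h3 : - η ≤ H z - k := (abs_lt.1 hz').1.le
        have h4 := mul_le_mul_of_nonneg_left h3 hμ.le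
        linarith)
      linarith
    · have h1 := hexple _ _ (show k + κ * G z ≤ k + η / 4 by linarith [hκG z hz'.le])
      have h2 := hexple (k + η / 2) (ψ (H z)) (by
        rw [hψr _ (by linarith)]
        linarith)
      linarith
  let F := gluedHam H G k η κ A ψ P
  have hF : IsTonelli F := isTonelli_gluedHam hH hη hκ hA (fun z hz => hG z (ht z hz.le).1)
    (fun z hz => (ht z hz.le).2.mono hAA₀) hψ hψ'
    (fun s => (hA₁ s).trans (by gcongr)) (fun s hs => hψr s (by linarith)) hP hP' hedge
  have hFfar : ∀ z, k + η / 2 ≤ H z → F z = Real.exp (A * H z) + 1 := by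
    intro z hz
    have h1 : F z = _ := gluedHam_of_far hedge ((le_sub_iff_add_le'.2 hz).trans (le_abs_self _))
    rw [h1, hψr _ hz]
  have hF1 : ∀ z, 1 < F z := by
    intro z
    have h1 : Real.exp (A * ψ (H z)) + 1 ≤ F z := by
      by_cases hz : |H z - k| < η
      · have h1 : F z = _ := gluedHam_of_near hz
        rw [h1]
        exact le_add_of_nonneg_right (hPnn _)
      · have h1 : F z = _ := gluedHam_of_far hedge (by linarith)
        exact h1.ge
    linarith [Real.exp_pos (A * ψ (H z))]
  have hFneg : ∀ z, H z < k → F z < Real.exp (A * k) + 1 := by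
    intro z hz
    have hy := hexple (ψ (H z)) (k - μ) (by
      rw [hψl _ hz.le]
      have := mul_neg_of_pos_of_neg hμ (sub_neg.2 hz)
      linarith)
    by_cases hz' : |H z - k| < η
    · have h1 : F z = _ := gluedHam_of_near hz'
      rw [h1]
      rcases le_total τ ((Real.exp (A * (k + κ * G z)) + 1) + - (Real.exp (A * ψ (H z)) + 1))
        with h | h
      · rw [hPid _ h]
        have h2 := hexp (k + κ * G z) k (by
          linarith [mul_neg_of_pos_of_neg hκ (hGneg z (ht z hz'.le).1 hz)])
        linarith
      · linarith [hPle _ h]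
    · have h1 : F z = _ := gluedHam_of_far hedge (by linarith)
      rw [h1]
      linarith
  have hFpos : ∀ z, k < H z → Real.exp (A * k) + 1 < F z := by
    intro z hz
    by_cases hz' : |H z - k| < η
    · have h1 : F z = _ := gluedHam_of_near hz'
      rw [h1]
      have h2 := hexp k (k + κ * G z) (by
          linarith [mul_pos hκ (hGpos z (ht z hz'.le).1 hz)])
      linarith [hPge ((Real.exp (A * (k + κ * G z)) + 1) + - (Real.exp (A * ψ (H z)) + 1))]
    · rw [hFfar z]
      · linarith [hexp _ _ hz]
      · rw [abs_of_pos (sub_pos.2 hz)] at hz'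
        linarith
  have hFS : ∀ᶠ z in 𝓝ˢ (H ⁻¹' {k}), F z = Real.exp (A * (k + κ * G z)) + 1 := by
    refine eventually_nhdsSet_iff_forall.2 fun z hz => ?_
    have hz' : H z = k := hz
    have hzη : |H z - k| < η := by rwa [hz', sub_self, abs_zero]
    have h1 : ∀ᶠ z in 𝓝 z, |H z - k| < η := by
      have : Continuous fun z => |H z - k| := by fun_prop
      exact this.continuousAt.eventually_lt_const hzη
    have hGz := hGc z hzη.le
    have h2 : ContinuousAt (fun z => (Real.exp (A * (k + κ * G z)) + 1) +
        - (Real.exp (A * ψ (H z)) + 1)) z := by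
      have := hψ.continuous.comp hc |>.continuousAt (x := z)
      have h3 : ContinuousAt (fun z => ψ (H z)) z := this
      exact (((continuousAt_const.mul (continuousAt_const.add (continuousAt_const.mul hGz))).rexp).add
        continuousAt_const).add (((continuousAt_const.mul h3).rexp).add continuousAt_const).neg
    have h3 : τ < (Real.exp (A * (k + κ * G z)) + 1) + - (Real.exp (A * ψ (H z)) + 1) := by
      rw [hG0 z hz, hz', hψl k le_rfl, mul_zero, add_zero,
        show k + μ * (k - k - 1) = k - μ by ring]
      linarith
    filter_upwards [h1, h2.eventually_const_lt h3] with y hy hy'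
    have h1 : F y = _ := gluedHam_of_near hy
    rw [h1, hPid _ hy'.le]
    ring
  obtain ⟨D, hD⟩ := (hH.isCompact_sublevel (k + η)).exists_bound_of_continuousOn (f := F)
    hF.smooth.continuous.continuousOn
  obtain ⟨m, hm⟩ : ∃ m : ℝ, ∀ z, m ≤ H z := by
    obtain ⟨D', hD'⟩ := (hH.isCompact_sublevel k).exists_bound_of_continuousOn (f := H)
      hc.continuousOn
    refine ⟨min k (-D'), fun z => ?_⟩
    rcases le_total (H z) k with h | h
    · exact (min_le_right _ _).trans (abs_le.1 (hD' z h)).1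
    · exact (min_le_left _ _).trans h
  have hlim : Tendsto (fun ε : ℝ => Real.exp (A * (k + ε)) + 1) atTop atTop :=
    tendsto_atTop_add_const_right _ _ (Real.tendsto_exp_atTop.comp
      ((tendsto_atTop_add_const_left _ _ tendsto_id).const_mul_atTop hA))
  -- With ε > k and ε > k - m, the number k - ε lies below all values of F and H, so both low levels
  -- are empty. The last condition places exp(A(k + ε)) + 1 above the maximum of F on {H ≤ k + η},
  -- so the high levels lie where F = exp(AH) + 1.
  obtain ⟨ε, ⟨hε1, hε2⟩, hε3, hε4⟩ := (((eventually_gt_atTop η).and (eventually_gt_atTop k)).and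
    ((eventually_gt_atTop (k - m)).and (hlim.eventually_gt_atTop D))).exists
  refine ⟨F, A, κ, ε, hF, hA, hκ, hη.trans hε1, fun r hr => ?_, fun r hr => ?_, ?_, hFS⟩
  · have h1 : H ⁻¹' {r} = ∅ := by
      refine eq_empty_of_forall_notMem fun z hz => ?_
      have : H z = r := hz
      linarith [hm z]
    have h2 : F ⁻¹' {r} = ∅ := by
      refine eq_empty_of_forall_notMem fun z hz => ?_
      have : F z = r := hz
      linarith [hF1 z]
    rw [h1, h2]
  · ext z
    change F z = _ ↔ H z = r
    constructor
    · intro hz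
      rcases le_total (H z) (k + η) with h | h
      · have h1 := (abs_le.1 (hD z h)).2
        have h2 := hexple _ _ hr
        linarith
      · rw [hFfar z (by linarith)] at hz
        exact mul_left_cancel₀ hA.ne' (Real.exp_injective (add_right_cancel hz))
    · intro hz
      rw [hFfar z (by linarith), hz]
  · ext z
    change F z = _ ↔ H z = k
    constructor
    · intro hz
      rcases lt_trichotomy (H z) k with h | h | h
      · exact absurd hz (hFneg z h).ne
      · exact h
      · exact absurd hz (hFpos z h).ne'
    · intro hz
      rw [hFS.self_of_nhdsSet z hz, hG0 z hz, mul_zero, add_zero]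

end GluingExistence

/-! ### Symplectic linear algebra of Hamiltonian fields and characteristic lines. -/

/-- The form `p dx` on `E × E'` is smooth. -/
lemma contDiffAt_pairing {E : Type*} [NormedAddCommGroup E] [NormedSpace ℝ E]
    {G : Type*} [NormedAddCommGroup G] [NormedSpace ℝ G]
    {P : G →L[ℝ] E} {Q : G →L[ℝ] (E →L[ℝ] ℝ)} {a : G → G →L[ℝ] ℝ} {y : G}
    (h : ∀ᶠ t in 𝓝 y, ∀ u, a t u = Q t (P u)) : ContDiffAt ℝ ∞ a y := by
  let L : G →L[ℝ] (G →L[ℝ] ℝ) := ((ContinuousLinearMap.compL ℝ G E ℝ).flip P).comp Q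
  have e : a =ᶠ[𝓝 y] L := h.mono fun t ht => ContinuousLinearMap.ext fun u => ht u
  exact L.contDiff.contDiffAt.congr_of_eventuallyEq e

section Symplectic

variable {n : ℕ} {M : Type*} [TopologicalSpace M] [ChartedSpace (EuclideanSpace ℝ (Fin n)) M]
  [IsManifold (𝓡 n) ∞ M]

/-- The model vector space of the cotangent bundle of an `n`-manifold. -/
abbrev CotSpace (n : ℕ) : Type := EuclideanSpace ℝ (Fin n) × (EuclideanSpace ℝ (Fin n) →L[ℝ] ℝ)

/-- The Liouville form with values in the dual of the model vector space. -/
def liouvilleForm (z : CotangentBundle (𝓡 n) M) : CotSpace n →L[ℝ] ℝ := liouville z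

/-- The Hamiltonian vector field with values in the model vector space. -/
def hamField (H : CotangentBundle (𝓡 n) M → ℝ) (z : CotangentBundle (𝓡 n) M) : CotSpace n :=
  hamVF H z

lemma formSmoothAt_liouvilleForm (z : CotangentBundle (𝓡 n) M) :
    FormSmoothAt (cotModel n) liouvilleForm z := by
  refine contDiffAt_pairing (P := ContinuousLinearMap.fst ℝ (EuclideanSpace ℝ (Fin n))
    (EuclideanSpace ℝ (Fin n) →L[ℝ] ℝ)) (Q := ContinuousLinearMap.snd ℝ _ _) ?_
  filter_upwards [(isOpen_extChartAt_target (I := cotModel n) z).mem_nhds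
    (mem_extChartAt_target (I := cotModel n) z)] with y hy u
  exact liouville_inChart z y hy u

variable {H : CotangentBundle (𝓡 n) M → ℝ} {z : CotangentBundle (𝓡 n) M}

lemma extd_hamField (H : CotangentBundle (𝓡 n) M → ℝ) (z : CotangentBundle (𝓡 n) M)
    (w : CotSpace n) : extd (cotModel n) liouvilleForm z (hamField H z) w =
      - md (cotModel n) 𝓘(ℝ, ℝ) H z w :=
  (hamVF_iff H z (hamVF H z)).2 rfl w

lemma eq_hamField {v : CotSpace n} (h : ∀ w, extd (cotModel n) liouvilleForm z v w =
    - md (cotModel n) 𝓘(ℝ, ℝ) H z w) : v = hamField H z :=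
  (hamVF_iff H z v).1 h

lemma eq_zero_of_extd_liouvilleForm {v : CotSpace n}
    (h : ∀ w, extd (cotModel n) liouvilleForm z v w = 0) : v = 0 := by
  have h0 : ∀ w : CotSpace n,
      md (cotModel n) 𝓘(ℝ, ℝ) (fun _ : CotangentBundle (𝓡 n) M => (0 : ℝ)) z w = 0 :=
    fun w => md_const_apply _ _ _
  have h1 := eq_hamField (H := fun _ => 0) fun w => by rw [h, h0, neg_zero]
  have h2 := eq_hamField (H := fun _ => 0) (z := z) (v := 0) fun w => by
    have := extd_smul_left (J := cotModel n) liouvilleForm z 0 w 0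
    rw [zero_smul, zero_mul] at this
    rw [this, h0, neg_zero]
  exact h1.trans h2.symm

lemma hamField_ne_zero (h : md (cotModel n) 𝓘(ℝ, ℝ) H z ≠ 0) : hamField H z ≠ 0 := by
  intro h0
  refine h (ContinuousLinearMap.ext fun w => ?_)
  have h1 := extd_hamField H z w
  have h2 := extd_smul_left (J := cotModel n) liouvilleForm z 0 w 0
  rw [zero_smul, zero_mul] at h2
  rw [h0, h2] at h1
  exact (neg_eq_zero.1 h1.symm)

lemma md_hamField (H : CotangentBundle (𝓡 n) M → ℝ) (z : CotangentBundle (𝓡 n) M) :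
    md (cotModel n) 𝓘(ℝ, ℝ) H z (hamField H z) = 0 := by
  have h := extd_hamField H z (hamField H z)
  rw [extd_self] at h
  exact neg_eq_zero.1 h.symm

lemma mem_charLine {v : CotSpace n} : v ∈ charLine H z ↔
    md (cotModel n) 𝓘(ℝ, ℝ) H z v = 0 ∧ ∀ w, md (cotModel n) 𝓘(ℝ, ℝ) H z w = 0 →
      extd (cotModel n) liouvilleForm z v w = 0 := Iff.rfl

/-- If ω(v, ·) vanishes on the kernel of dH, it is a multiple of dH, so v differs from a multiple of
X_H by a vector in the kernel of ω, which is zero. -/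
lemma mem_charLine_iff (h : md (cotModel n) 𝓘(ℝ, ℝ) H z ≠ 0) {v : CotSpace n} :
    v ∈ charLine H z ↔ ∃ c : ℝ, v = c • hamField H z := by
  rw [mem_charLine]
  constructor
  · rintro ⟨-, hv⟩
    obtain ⟨u, hu⟩ : ∃ u, md (cotModel n) 𝓘(ℝ, ℝ) H z u ≠ 0 := by
      by_contra! h'
      exact h (ContinuousLinearMap.ext h')
    set a := md (cotModel n) 𝓘(ℝ, ℝ) H z u
    set t := extd (cotModel n) liouvilleForm z v u / a with ht
    suffices h0 : v + t • hamField H z = 0 from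
      ⟨-t, (eq_neg_of_add_eq_zero_left h0).trans (neg_smul t (hamField H z)).symm⟩
    refine eq_zero_of_extd_liouvilleForm (z := z) fun w => ?_
    set b := md (cotModel n) 𝓘(ℝ, ℝ) H z w
    have h1 := hv (w + (-(b / a)) • u) (by
      rw [map_add, map_smul, smul_eq_mul]
      field_simp
      ring)
    rw [extd_add_right, extd_smul_right] at h1
    rw [extd_add_left, extd_smul_left, extd_hamField]
    linear_combination h1
  · rintro ⟨c, rfl⟩
    refine ⟨by rw [map_smul, md_hamField, smul_zero], fun w hw => ?_⟩
    rw [extd_smul_left, extd_hamField, hw, neg_zero, mul_zero]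

/-- The Hamiltonian field is defined by choice; it is regular because it coincides with the smooth
field dual to -dH. -/
lemma contMDiffAt_apply_hamField {lam : CotangentBundle (𝓡 n) M → CotSpace n →L[ℝ] ℝ}
    {S : Set (CotangentBundle (𝓡 n) M)} (hlam : ∀ᶠ z in 𝓝ˢ S, FormSmoothAt (cotModel n) lam z)
    (hH : ∀ z, ContMDiffAt (cotModel n) 𝓘(ℝ, ℝ) ∞ H z) :
    ∀ᶠ z in 𝓝ˢ S, ContMDiffAt (cotModel n) 𝓘(ℝ, ℝ) ∞ (fun z => lam z (hamField H z)) z := by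
  obtain ⟨Z, hZ⟩ := exists_dual_vf_near (J := cotModel n) (S := S) (xi := liouvilleForm)
    (lam := fun z => (-1 : ℝ) • md (cotModel n) 𝓘(ℝ, ℝ) H z)
    (Eventually.of_forall formSmoothAt_liouvilleForm)
    (Eventually.of_forall fun z => (FormSmoothAt.md (hH z)).1.smul contMDiffAt_const)
    (fun z _ v hv => eq_zero_of_extd_liouvilleForm hv)
  filter_upwards [hlam, hZ.eventually_nhdsSet] with z h1 h2
  refine (h1.apply h2.self_of_nhds.1).congr_of_eventuallyEq ?_
  filter_upwards [h2] with y hy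
  rw [eq_hamField (v := Z y) fun w => by
    rw [hy.2 w]
    exact neg_one_mul _]

end Symplectic

/-! ### The sign of a stabilizing form. -/

section Stabilizing

variable {n : ℕ} {M : Type*} [TopologicalSpace M] [ChartedSpace (EuclideanSpace ℝ (Fin n)) M]
  [IsManifold (𝓡 n) ∞ M]

/-- A stabilizing form, multiplied by the sign of its value on the Hamiltonian vector field, is
smooth near the level and positive on the Hamiltonian vector field. -/
theorem IsStabilizing.sign_smul {H : CotangentBundle (𝓡 n) M → ℝ}
    (hH : ∀ z, ContMDiffAt (cotModel n) 𝓘(ℝ, ℝ) ∞ H z) {k : ℝ} (hk : IsRegularLevel H k)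
    {lam : OneForm (cotModel n) (CotangentBundle (𝓡 n) M)} (hlam : IsStabilizing H k lam) :
    ∃ lam₁ : CotangentBundle (𝓡 n) M → CotSpace n →L[ℝ] ℝ,
      (∀ z, ∀ w : CotSpace n, lam₁ z w = Real.sign (lam z (hamVF H z)) * lam z w) ∧
      (∀ᶠ z in 𝓝ˢ (H ⁻¹' {k}), FormSmoothAt (cotModel n) lam₁ z) ∧
      (∀ z ∈ H ⁻¹' {k}, 0 < lam₁ z (hamField H z)) ∧
      ∀ z ∈ H ⁻¹' {k}, ∀ w, md (cotModel n) 𝓘(ℝ, ℝ) H z w = 0 →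
        extd (cotModel n) lam₁ z (hamField H z) w = 0 := by
  let mu : CotangentBundle (𝓡 n) M → CotSpace n →L[ℝ] ℝ := lam
  have hmu : ∀ᶠ z in 𝓝ˢ (H ⁻¹' {k}), FormSmoothAt (cotModel n) mu z := by
    obtain ⟨U, hU, hSU, hs⟩ := hlam.smooth
    exact eventually_nhdsSet_iff_exists.2 ⟨U, hU, hSU, fun z hz =>
      (formSmoothAt_iff lam z).2 (hs.contMDiffAt (hU.mem_nhds hz))⟩
  have hX : ∀ z ∈ H ⁻¹' {k}, hamField H z ∈ charLine H z ∧ hamField H z ≠ 0 := fun z hz =>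
    ⟨(mem_charLine_iff (hk z hz)).2 ⟨1, (one_smul ℝ (hamField H z)).symm⟩,
      hamField_ne_zero (hk z hz)⟩
  let σ : CotangentBundle (𝓡 n) M → ℝ := fun z => Real.sign (mu z (hamField H z))
  have hne : ∀ z ∈ H ⁻¹' {k}, mu z (hamField H z) ≠ 0 := fun z hz =>
    hlam.ne_zero z hz _ (hX z hz).1 (hX z hz).2
  -- λ(X_H) is continuous near S and non-zero on S, so near each point of S the sign is constant.
  -- The product is locally λ or -λ, and multiplication by the sign commutes with d.
  have hloc : ∀ᶠ z in 𝓝ˢ (H ⁻¹' {k}), FormSmoothAt (cotModel n) mu z ∧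
      (fun y => σ y • mu y) =ᶠ[𝓝 z] fun y => σ z • mu y := by
    refine eventually_nhdsSet_iff_forall.2 fun z hz => ?_
    have h1 : ContinuousAt (fun z => mu z (hamField H z)) z :=
      ((contMDiffAt_apply_hamField hmu hH).self_of_nhdsSet z hz).continuousAt
    have h2 : ∀ᶠ y in 𝓝 z, σ y = σ z := by
      rcases lt_or_gt_of_ne (hne z hz) with h | h
      · filter_upwards [h1.eventually_lt_const h] with y hy
        simp only [σ, Real.sign_of_neg hy, Real.sign_of_neg h]
      · filter_upwards [h1.eventually_const_lt h] with y hy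
        simp only [σ, Real.sign_of_pos hy, Real.sign_of_pos h]
    filter_upwards [eventually_nhdsSet_iff_forall.1 hmu z hz, h2.eventually_nhds, h2]
      with y hy hy' hyz
    refine ⟨hy, ?_⟩
    filter_upwards [hy'] with x hx
    rw [hx, hyz]
  refine ⟨fun z => σ z • mu z, fun z w => rfl, ?_, fun z hz => ?_, fun z hz w hw => ?_⟩
  · filter_upwards [hloc] with z hz
    exact (hz.1.smul contMDiffAt_const).congr hz.2
  · change 0 < σ z * mu z (hamField H z)
    rcases lt_or_gt_of_ne (hne z hz) with h | h
    · simp only [σ, Real.sign_of_neg h]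
      linarith
    · simp only [σ, Real.sign_of_pos h]
      linarith
  · obtain ⟨h1, h2⟩ := hloc.self_of_nhdsSet z hz
    have h3 : extd (cotModel n) mu z (hamField H z) w = 0 :=
      hlam.annihilates z hz _ (hX z hz).1 (hX z hz).2 w hw
    have h4 : ∀ v : CotSpace n,
        md (cotModel n) 𝓘(ℝ, ℝ) (fun _ : CotangentBundle (𝓡 n) M => σ z) z v = 0 :=
      fun v => md_const_apply _ _ _
    rw [extd_congr h2, extd_smul h1 contMDiffAt_const, h4, h4, h3]
    ring

end Stabilizing

/-! ### Assembly of the lemma. -/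

section Main

/-- A Tonelli Hamiltonian with a level that is stabilized by `lam` can be changed to a Tonelli
Hamiltonian `F` with essentially the same levels, such that near this level `F` is a function of
`G`, the Hamiltonian vector field `X` of `G` is the Reeb field of an extension of `lam`, and the
levels of `G` are conjugate by maps `Ψ s` that preserve `X`. -/
theorem exists_adapted_hamiltonian {n : ℕ} {M : Type*} [TopologicalSpace M] [T2Space M]
    [CompactSpace M] [ChartedSpace (EuclideanSpace ℝ (Fin n)) M] [IsManifold (𝓡 n) ∞ M]
    {H : CotangentBundle (𝓡 n) M → ℝ} (hH : IsTonelli H) {k : ℝ} (hk : IsRegularLevel H k)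
    {lam : OneForm (cotModel n) (CotangentBundle (𝓡 n) M)} (hlam : IsStabilizing H k lam) :
    ∃ (F G : CotangentBundle (𝓡 n) M → ℝ) (A κ ε δ δ₁ : ℝ)
      (lam' : CotangentBundle (𝓡 n) M → CotSpace n →L[ℝ] ℝ)
      (X : CotangentBundle (𝓡 n) M → CotSpace n)
      (Ψ : ℝ → CotangentBundle (𝓡 n) M → CotangentBundle (𝓡 n) M)
      (W : Set (CotangentBundle (𝓡 n) M)),
      IsTonelli F ∧ 0 < A ∧ 0 < κ ∧ 0 < ε ∧
      (∀ r ≤ k - ε, F ⁻¹' {r} = H ⁻¹' {r}) ∧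
      (∀ r ≥ k + ε, F ⁻¹' {Real.exp (A * r) + 1} = H ⁻¹' {r}) ∧
      F ⁻¹' {Real.exp (A * k) + 1} = H ⁻¹' {k} ∧
      (∀ z ∈ H ⁻¹' {k}, ∀ w : CotSpace n, md (cotModel n) 𝓘(ℝ, ℝ) H z w = 0 →
        lam' z w = Real.sign (lam z (hamVF H z)) * lam z w) ∧
      IsOpen W ∧ 0 < δ ∧ δ < ε ∧ δ ≤ κ * δ₁ ∧
      (∀ z ∈ F ⁻¹' Ioo (Real.exp (A * (k - δ)) + 1) (Real.exp (A * (k + δ)) + 1), z ∈ W) ∧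
      (∀ z ∈ W, F z = Real.exp (A * (k + κ * G z)) + 1 ∧
        ContMDiffAt (cotModel n) 𝓘(ℝ, ℝ) ∞ G z ∧ FormSmoothAt (cotModel n) lam' z ∧
        hamField F z = (Real.exp (A * (k + κ * G z)) * (A * κ)) • X z ∧ lam' z (X z) = 1 ∧
        ∀ w, extd (cotModel n) lam' z (X z) w = 0) ∧
      ∀ s, ∀ z ∈ W, |G z| < δ₁ → |G z + s| < δ₁ →
        Ψ s z ∈ W ∧ G (Ψ s z) = G z + s ∧ Ψ (-s) (Ψ s z) = z ∧
        ContMDiffAt (cotModel n) (cotModel n) ∞ (Ψ s) z ∧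
        md (cotModel n) (cotModel n) (Ψ s) z (X z) = X (Ψ s z) := by
  have : T2Space (CotangentBundle (𝓡 n) M) := t2Space_cotangentBundle
  have : SigmaCompactSpace (CotangentBundle (𝓡 n) M) := hH.sigmaCompactSpace
  have hHc : Continuous H := hH.smooth.continuous
  have hS : IsCompact (H ⁻¹' {k}) :=
    (hH.isCompact_sublevel k).of_isClosed_subset (isClosed_singleton.preimage hHc)
      fun z hz => le_of_eq hz
  obtain ⟨lam₁, hlam₁, hsm, hpos, hker⟩ := hlam.sign_smul (fun z => hH.smooth z) hk
  have hmdh : ∀ z, md (cotModel n) 𝓘(ℝ, ℝ) (fun z => H z - k) z = md (cotModel n) 𝓘(ℝ, ℝ) H z := by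
    intro z
    refine ContinuousLinearMap.ext fun w => ?_
    have h1 : md (cotModel n) 𝓘(ℝ, ℝ) (fun z => H z - k) z w =
        md 𝓘(ℝ, ℝ) 𝓘(ℝ, ℝ) (fun t => t - k) (H z) (md (cotModel n) 𝓘(ℝ, ℝ) H z w) :=
      md_comp_apply (g := fun t : ℝ => t - k) (f := H) z
        (by exact ((differentiableAt_id).sub_const k).mdifferentiableAt) (hH.smooth z).mdiff w
    rw [h1, md_eq_fderiv, fderiv_sub_const]
    simp
  obtain ⟨G, lam', X, Ψ, W₀, hW₀, hnear, hon, hΨ⟩ :=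
    exists_stable_coordinates (J := cotModel n) hS (xi := liouvilleForm) (lam := lam₁)
      (h := fun z => H z - k) (Xh := hamField H)
      (Eventually.of_forall formSmoothAt_liouvilleForm) hsm
      (fun z _ v hv => eq_zero_of_extd_liouvilleForm hv)
      (Eventually.of_forall fun z => (hH.smooth z).sub contMDiffAt_const)
      (fun z => sub_eq_zero.symm) (fun z _ w => by rw [extd_hamField, hmdh])
      hpos (fun z hz w hw => hker z hz w (by rwa [hmdh] at hw))
  obtain ⟨F, A, κ, ε, hF, hA, hκ, hε, hlow, hhigh, hlev, hFG⟩ :=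
    exists_tonelli_extension hH (k := k) (fun z hz => hk z hz) hW₀ (fun z hz => (hnear z hz).1)
      (fun z hz h => (hnear z hz).2.2.1 (sub_pos.2 h))
      (fun z hz h => (hnear z hz).2.2.2.1 (sub_neg.2 h)) (fun z hz => (hon z hz).1)
      (fun z hz => ⟨_, hpos z hz, fun w => by rw [(hon z hz).2.1 w, hmdh]⟩)
  obtain ⟨W, hWo, hSW, hW⟩ := eventually_nhdsSet_iff_exists.1
    ((show ∀ᶠ z in 𝓝ˢ (H ⁻¹' {k}), z ∈ W₀ from hW₀).and hFG)
  have hWn : W ∈ 𝓝ˢ (H ⁻¹' {k}) := hWo.mem_nhdsSet.2 hSW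
  obtain ⟨δ₁, hδ₁, hΨ⟩ := hΨ W hWn fun z hz => (hW z hz).1
  obtain ⟨η, hη, htube⟩ := hF.exists_tube (k := Real.exp (A * k) + 1) (W := W) (by rwa [hlev])
  -- The exponential bounds place the slab of F inside W. The value k + r corresponds to G = r / κ,
  -- so δ ≤ κ δ₁ keeps |G| < δ₁, where the maps Ψ are controlled.
  obtain ⟨δ, hδ, hδε, hδκ, hδη, hδη'⟩ : ∃ δ > 0, δ < ε ∧ δ ≤ κ * δ₁ ∧
      Real.exp (A * (k + δ)) < Real.exp (A * k) + η ∧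
      Real.exp (A * k) - η < Real.exp (A * (k - δ)) := by
    have hc1 : Continuous (fun δ : ℝ => Real.exp (A * (k + δ))) := by fun_prop
    have hc2 : Continuous (fun δ : ℝ => Real.exp (A * (k - δ))) := by fun_prop
    have h1 := (hc1.tendsto 0).eventually_lt_const (u := Real.exp (A * k) + η) (by simpa using hη)
    have h2 := (hc2.tendsto 0).eventually_const_lt (u := Real.exp (A * k) - η) (by simpa using hη)
    have h3 : ∀ᶠ δ in 𝓝[>] (0 : ℝ), 0 < δ := self_mem_nhdsWithin
    have h4 : ∀ᶠ δ in 𝓝 (0 : ℝ), δ < ε := Iio_mem_nhds hε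
    have h5 : ∀ᶠ δ in 𝓝 (0 : ℝ), δ < κ * δ₁ := Iio_mem_nhds (mul_pos hκ hδ₁)
    obtain ⟨δ, h3, ⟨h1, h2⟩, h4, h5⟩ := (h3.and
      (((h1.and h2).and (h4.and h5)).filter_mono nhdsWithin_le_nhds)).exists
    exact ⟨δ, h3, h4, h5.le, h1, h2⟩
  let ρ : ℝ → ℝ := fun t => Real.exp (A * (k + κ * t)) + 1
  have hρ : ∀ t, HasDerivAt ρ (Real.exp (A * (k + κ * t)) * (A * κ)) t := fun t => by
    have h := (((((hasDerivAt_id' t).const_mul κ).const_add k).const_mul A).exp).add_const (1 : ℝ)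
    rwa [mul_one] at h
  have hmdF : ∀ z ∈ W, ∀ w, md (cotModel n) 𝓘(ℝ, ℝ) F z w =
      Real.exp (A * (k + κ * G z)) * (A * κ) * md (cotModel n) 𝓘(ℝ, ℝ) G z w := by
    intro z hz w
    have e : F =ᶠ[𝓝 z] fun z => ρ (G z) := by
      filter_upwards [hWo.mem_nhds hz] with y hy
      exact (hW y hy).2
    have h1 : md (cotModel n) 𝓘(ℝ, ℝ) (fun z => ρ (G z)) z w =
        md 𝓘(ℝ, ℝ) 𝓘(ℝ, ℝ) ρ (G z) (md (cotModel n) 𝓘(ℝ, ℝ) G z w) :=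
      md_comp_apply (g := ρ) (f := G) z (hρ _).differentiableAt.mdifferentiableAt
        (hnear z (hW z hz).1).1.mdiff w
    rw [md_congr e, h1, md_eq_fderiv, (hρ (G z)).hasFDerivAt.fderiv]
    exact mul_comm _ _
  have hXF : ∀ z ∈ W, hamField F z = (Real.exp (A * (k + κ * G z)) * (A * κ)) • X z := by
    intro z hz
    refine (eq_hamField fun w => ?_).symm
    rw [extd_smul_left, (hnear z (hW z hz).1).2.2.2.2.1, hmdF z hz]
    ring
  refine ⟨F, G, A, κ, ε, δ, δ₁, lam', X, Ψ, W, hF, hA, hκ, hε, hlow, hhigh, hlev,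
    fun z hz w hw => ?_, hWo, hδ, hδε, hδκ, fun z hz => ?_, fun z hz => ?_, hΨ⟩
  · exact ((hon z hz).2.2 w (by rwa [hmdh])).trans (hlam₁ z w)
  · exact htube z (abs_lt.2 ⟨by linarith [hz.1], by linarith [hz.2]⟩)
  · obtain ⟨h1, h2, -, -, -, h3, h4⟩ := hnear z (hW z hz).1
    exact ⟨(hW z hz).2, h1, h2, hXF z hz, h3, h4⟩

/-- On W the field X_F is the positive factor Aκ exp(A(k + κG)) times X, and this factor depends
only on G. So λ'(X_F) is constant on levels, i_{X_F} dλ' = 0, and the characteristic lines are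
spanned by X, which the shifts Ψ preserve. -/
theorem mainTheorem2 {n : ℕ} {M : Type*} [TopologicalSpace M] [T2Space M] [CompactSpace M]
    [ChartedSpace (EuclideanSpace ℝ (Fin n)) M] [IsManifold (𝓡 n) ∞ M]
    (H : CotangentBundle (𝓡 n) M → ℝ) (hH : IsTonelli H)
    (k : ℝ) (hk : IsRegularLevel H k)
    (lam : OneForm (cotModel n) (CotangentBundle (𝓡 n) M)) (hlam : IsStabilizing H k lam) :
    ∃ ε : ℝ, 0 < ε ∧ ∃ (H' : CotangentBundle (𝓡 n) M → ℝ) (A B : ℝ),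
      IsTonelli H' ∧ 0 < A ∧ 0 < B ∧
      (∀ r ≤ k - ε, H' ⁻¹' {r} = H ⁻¹' {r}) ∧
      (∀ r ≥ k + ε, H' ⁻¹' {Real.exp (A * r) + B} = H ⁻¹' {r}) ∧
      H' ⁻¹' {Real.exp (A * k) + B} = H ⁻¹' {k} ∧
      ∃ δ : ℝ, 0 < δ ∧ δ < ε ∧
        (∃ lam' : OneForm (cotModel n) (CotangentBundle (𝓡 n) M),
          lam'.SmoothOn (cotModel n)
            (H' ⁻¹' Ioo (Real.exp (A * (k - δ)) + B) (Real.exp (A * (k + δ)) + B)) ∧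
          (∀ z ∈ H ⁻¹' {k}, ∀ w ∈ levelTangent H z,
            lam' z w = Real.sign (lam z (hamVF H z)) * lam z w) ∧
          (∀ r ∈ Ioo (-δ) δ, ∃ c : ℝ, 0 < c ∧
            ∀ z ∈ H' ⁻¹' {Real.exp (A * (k + r)) + B}, lam' z (hamVF H' z) = c) ∧
          (∀ z ∈ H' ⁻¹' Ioo (Real.exp (A * (k - δ)) + B) (Real.exp (A * (k + δ)) + B),
            ∀ w, lam'.d (cotModel n) z (hamVF H' z) w = 0)) ∧
        (∀ r ∈ Ioo (-δ) δ, ∀ s ∈ Ioo (-δ) δ,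
          ConjugateLevels H' (Real.exp (A * (k + r)) + B) (Real.exp (A * (k + s)) + B)) := by
  obtain ⟨F, G, A, κ, ε, δ, δ₁, lam', X, Ψ, W, hF, hA, hκ, hε, hlow, hhigh, hlev, hext, hWo, hδ, hδε,
    hδκ, hVW, hW, hΨ⟩ := exists_adapted_hamiltonian hH hk hlam
  have hexp : ∀ {s t}, Real.exp (A * s) + 1 < Real.exp (A * t) + 1 ↔ s < t := fun {s t} => by
    rw [add_lt_add_iff_right, Real.exp_lt_exp, mul_lt_mul_iff_right₀ hA]
  have hVr : ∀ r ∈ Ioo (-δ) δ, ∀ z ∈ F ⁻¹' {Real.exp (A * (k + r)) + 1},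
      z ∈ W ∧ κ * G z = r := by
    intro r hr z hz
    have hz' : F z = Real.exp (A * (k + r)) + 1 := hz
    have hzW := hVW z ⟨by rw [hz', hexp]; linarith [hr.1], by rw [hz', hexp]; linarith [hr.2]⟩
    refine ⟨hzW, ?_⟩
    rw [(hW z hzW).1] at hz'
    have := mul_left_cancel₀ hA.ne' (Real.exp_injective (add_right_cancel hz'))
    linarith
  have hcp : ∀ t, 0 < Real.exp (A * (k + κ * t)) * (A * κ) := fun t => by positivity
  have hlamF : ∀ z ∈ W, lam' z (hamField F z) = Real.exp (A * (k + κ * G z)) * (A * κ) := by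
    intro z hz
    rw [(hW z hz).2.2.2.1, map_smul, (hW z hz).2.2.2.2.1, smul_eq_mul, mul_one]
  -- λ'(X_F) > 0 forces X_F ≠ 0, hence dF ≠ 0; no separate regularity of the nearby levels is
  -- needed.
  have hmdF0 : ∀ z ∈ W, md (cotModel n) 𝓘(ℝ, ℝ) F z ≠ 0 := by
    intro z hz h0
    have h1 : (0 : CotSpace n) = hamField F z := eq_hamField fun w => by
      have := extd_smul_left (J := cotModel n) liouvilleForm z 0 w 0
      rw [zero_smul, zero_mul] at this
      rw [this, h0]
      simp
    have h2 := hlamF z hz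
    rw [← h1, map_zero] at h2
    exact (hcp _).ne h2
  have hchar : ∀ z ∈ W, ∀ v : CotSpace n, v ∈ charLine F z ↔ ∃ c : ℝ, v = c • X z := by
    intro z hz v
    rw [mem_charLine_iff (hmdF0 z hz), (hW z hz).2.2.2.1]
    constructor
    · rintro ⟨c, rfl⟩
      exact ⟨c * (Real.exp (A * (k + κ * G z)) * (A * κ)), smul_smul _ _ _⟩
    · rintro ⟨c, rfl⟩
      refine ⟨c / (Real.exp (A * (k + κ * G z)) * (A * κ)), ?_⟩
      rw [smul_smul, div_mul_cancel₀ _ (hcp _).ne']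
  refine ⟨ε, hε, F, A, 1, hF, hA, one_pos, hlow, hhigh, hlev, δ, hδ, hδε, ⟨lam', ?_, ?_, ?_, ?_⟩, ?_⟩
  · intro z hz
    exact ((formSmoothAt_iff lam' z).1 (hW z (hVW z hz)).2.2.1).contMDiffWithinAt
  · exact hext
  · intro r hr
    refine ⟨Real.exp (A * (k + r)) * (A * κ), by positivity, fun z hz => ?_⟩
    obtain ⟨hzW, hzr⟩ := hVr r hr z hz
    rw [← hzr]
    exact hlamF z hzW
  · intro z hz w
    have hzW := hVW z hz
    have h1 : ∀ w : CotSpace n, extd (cotModel n) lam' z (hamField F z) w = 0 := fun w => by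
      rw [(hW z hzW).2.2.2.1, extd_smul_left, (hW z hzW).2.2.2.2.2, mul_zero]
    exact h1 w
  · intro r hr s hs
    have hGc : ContinuousOn G W := fun z hz =>
      (hW z hz).2.1.continuousAt.continuousWithinAt
    have hU : ∀ t : ℝ, IsOpen (W ∩ G ⁻¹' {g | |g| < δ₁ ∧ |g + t| < δ₁}) := fun t =>
      hGc.isOpen_inter_preimage hWo ((isOpen_lt continuous_abs continuous_const).inter
        (isOpen_lt (continuous_abs.comp (continuous_add_const t)) continuous_const))
    have hsmall : ∀ g, κ * g ∈ Ioo (-δ) δ → |g| < δ₁ := by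
      intro g hg
      have h1 : |κ * g| < κ * δ₁ := (abs_lt.2 hg).trans_le hδκ
      rw [abs_mul, abs_of_pos hκ] at h1
      exact lt_of_mul_lt_mul_left h1 hκ.le
    have key : ∀ r ∈ Ioo (-δ) δ, ∀ s ∈ Ioo (-δ) δ, ∀ t, κ * t = s - r →
        ∀ z ∈ F ⁻¹' {Real.exp (A * (k + r)) + 1},
          z ∈ W ∧ |G z| < δ₁ ∧ |G z + t| < δ₁ ∧ Ψ t z ∈ F ⁻¹' {Real.exp (A * (k + s)) + 1} := by
      intro r hr s hs t hts z hz
      obtain ⟨hzW, hzr⟩ := hVr r hr z hz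
      have h1 : |G z| < δ₁ := hsmall _ (by rwa [hzr])
      have h2 : κ * (G z + t) = s := by rw [mul_add, hzr, hts]; ring
      have h3 : |G z + t| < δ₁ := hsmall _ (by rwa [h2])
      obtain ⟨h4, h5, -⟩ := hΨ t z hzW h1 h3
      refine ⟨hzW, h1, h3, ?_⟩
      change F (Ψ t z) = _
      rw [(hW _ h4).1, h5, h2]
    -- The two levels are G = r / κ and G = s / κ, so the conjugacy is the shift of G by (s - r) /
    -- κ, with inverse the opposite shift.
    obtain ⟨t, ht⟩ : ∃ t, κ * t = s - r := ⟨(s - r) / κ, mul_div_cancel₀ _ hκ.ne'⟩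
    have ht' : κ * (-t) = r - s := by rw [mul_neg, ht]; ring
    have himg : ∀ z ∈ F ⁻¹' {Real.exp (A * (k + r)) + 1}, ∀ v : CotSpace n,
        (∃ u : CotSpace n, u ∈ charLine F z ∧ md (cotModel n) (cotModel n) (Ψ t) z u = v) ↔
          v ∈ charLine F (Ψ t z) := by
      intro z hz v
      obtain ⟨h1, h2, h3, -⟩ := key r hr s hs t ht z hz
      obtain ⟨h4, -, -, -, h5⟩ := hΨ t z h1 h2 h3
      have h6 : ∀ c : ℝ, md (cotModel n) (cotModel n) (Ψ t) z (c • X z) = c • X (Ψ t z) :=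
        fun c => by rw [map_smul, h5]
      rw [hchar _ h4]
      constructor
      · rintro ⟨u, hu, rfl⟩
        obtain ⟨c, rfl⟩ := (hchar z h1 u).1 hu
        exact ⟨c, h6 c⟩
      · rintro ⟨c, rfl⟩
        exact ⟨c • X z, (hchar z h1 _).2 ⟨c, rfl⟩, h6 c⟩
    refine ⟨Ψ t, Ψ (-t), _, _, hU t, fun z hz => ?_, fun z hz => ?_, hU (-t), fun z hz => ?_,
      fun z hz => ?_, fun z hz => (key r hr s hs t ht z hz).2.2.2,
      fun z hz => (key s hs r hr (-t) ht' z hz).2.2.2, fun z hz => ?_, fun z hz => ?_,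
      fun z hz => ?_⟩
    · obtain ⟨h1, h2, h3, -⟩ := key r hr s hs t ht z hz
      exact ⟨h1, h2, h3⟩
    · exact (hΨ t z hz.1 hz.2.1 hz.2.2).2.2.2.1.contMDiffWithinAt
    · obtain ⟨h1, h2, h3, -⟩ := key s hs r hr (-t) ht' z hz
      exact ⟨h1, h2, h3⟩
    · exact (hΨ (-t) z hz.1 hz.2.1 hz.2.2).2.2.2.1.contMDiffWithinAt
    · obtain ⟨h1, h2, h3, -⟩ := key r hr s hs t ht z hz
      exact (hΨ t z h1 h2 h3).2.2.1
    · obtain ⟨h1, h2, h3, -⟩ := key s hs r hr (-t) ht' z hz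
      have h4 := (hΨ (-t) z h1 h2 h3).2.2.1
      rwa [neg_neg] at h4
    · exact Set.ext (himg z hz)

end Main

end
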